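/- Work in the Euclidean plane $\mathbb R^2$. A real algebraic curve is the real zero set of a nonconstant polynomial; its degree is the least degree of a nonzero polynomial with that zero set. An irreducible quadratic curve is the infinite zero set of a real polynomial of degree $2$ that is not a union of two (possibly equal) lines. A frontal is a $C^\infty$ curve $\gamma$ with a $C^\infty$ unit field $\nu$ such that $\langle\dot\gamma,\nu\rangle=0$; it is a front if $(\gamma,\nu)$ can be chosen to be an immersion. A set is a front (respectively, regular as a parametrized curve) if near each of its points it is a finite union of images of fronts (respectively, of regular curves) through that point. For a real algebraic curve $\mathcal C$, let $E(\mathcal C)$ be the set of pairs $(x,n)$ with $x=\gamma(t_0)$, $n=\nu(t_0)$ for some injective frontal arc $(\gamma,\nu)$ with image in $\mathcal C$, satisfying $\langle x,n\rangle\ne0$. Let $\mathcal C^*$ be the set of all $x$ with $(x,n)\in E(\mathcal C)$ for some $n$ (the no-silhouette part). The primitive of $\mathcal C^*$ is the closure of $$\Big\{\,2x-\frac{\|x\|^2}{\langle x,n\rangle}\,n \;:\; (x,n)\in E(\mathcal C)\Big\}.$$ With $\Psi(x)=x/\|x\|^2$, the inversion $\mathcal I(\mathcal C)$ is the closure of $\Psi(\mathcal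 C\setminus\{0\})$. **Theorem 3.7.** Let $\mathcal C$ be a real algebraic curve such that $\mathcal C\setminus\{0\}\subset\overline{\mathcal C^*}$, such that $\mathcal C$ contains no circle through the origin, and such that $\mathcal C$ is not itself a line or a circle. Suppose that the primitive of $\mathcal C^*$ is an irreducible quadratic curve $C$, with equation $$a_{11}x^2+a_{22}y^2+2a_{12}xy+2a_1x+2a_2y+c=0 .$$ 1. $\mathcal C$ has degree $3$ or $4$ and is a front, $\mathcal I(\mathcal C)$ is an irreducible quadratic curve, $\mathcal I(\mathcal C)\setminus\{0\}=\Psi(\mathcal C\setminus\{0\})$, and $\mathcal C$ is the set of real solutions of $$(a_{12}^2-a_{11}a_{22})(x^2+y^2)^2+2(a_{12}a_2-a_1a_{22})(x^2+y^2)x+2(a_1a_{12}-a_2a_{11})(x^2+y^2)y$$ $$+(a_2^2-a_{22}c)x^2+2(a_{12}c-a_1a_2)xy+(a_1^2-a_{11}c)y^2=0 .$$ If $C$ is a parabola, then $\mathcal C$ has degree $3$. 2. If $\mathcal I(\mathcal C)$ is an ellipse, then the origin is an isolated point of $\mathcal C$, and $\mathcal C\setminus\{0\}$ is a regular curve. 3.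 If $\mathcal I(\mathcal C)$ is a hyperbola, then $\mathcal C$ is regular as a parametrized curve, it has a node at the origin whose two tangent directions are the asymptotic directions of $\mathcal I(\mathcal C)$, and it is a regular curve near every other point. 4. If $\mathcal I(\mathcal C)$ is a parabola, then $\mathcal C$ has an ordinary cusp at the origin (near the origin it is diffeomorphic to $\{(t^2,t^3)\}$) whose tangent direction is the direction of the axis of $\mathcal I(\mathcal C)$, and it is a regular curve near every other point. -/

import Mathlib

open scoped ContDiff

noncomputable section

namespace PlaneCurve

/-- The Euclidean plane. -/
abbrev Plane : Type := EuclideanSpace ℝ (Fin 2)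

/-! ### Algebraic curves -/

/-- The real zero set of a polynomial in two variables. -/
def polyZeros (F : MvPolynomial (Fin 2) ℝ) : Set Plane :=
  {x | MvPolynomial.eval (fun i => x i) F = 0}

/-- A real algebraic curve: the real zero set of a nonconstant polynomial. -/
def IsAlgebraicCurve (S : Set Plane) : Prop :=
  ∃ F : MvPolynomial (Fin 2) ℝ, 0 < F.totalDegree ∧ S = polyZeros F

/-- `S` is a real algebraic curve of degree `d` (cubic: `d = 3`, quartic: `d = 4`): `d` is the
least degree of a nonzero polynomial with real zero set `S`. -/
def HasDegree (S : Set Plane) (d : ℕ) : Prop :=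
  IsLeast {n : ℕ | ∃ F : MvPolynomial (Fin 2) ℝ, F ≠ 0 ∧ F.totalDegree = n ∧ S = polyZeros F} d

/-- A straight line. -/
def IsLine (S : Set Plane) : Prop :=
  ∃ a b c : ℝ, (a ≠ 0 ∨ b ≠ 0) ∧ S = {x : Plane | a * x 0 + b * x 1 + c = 0}

/-- Coefficients of
`a₁₁ x² + a₂₂ y² + 2 a₁₂ x y + 2 a₁ x + 2 a₂ y + c`. -/
structure QuadEq where
  a₁₁ : ℝ
  a₂₂ : ℝ
  a₁₂ : ℝ
  a₁ : ℝ
  a₂ : ℝ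
  c : ℝ

/-- The set of points that satisfy the equation. -/
def QuadEq.zeros (q : QuadEq) : Set Plane :=
  {x | q.a₁₁ * x 0 ^ 2 + q.a₂₂ * x 1 ^ 2 + 2 * q.a₁₂ * (x 0 * x 1)
    + 2 * q.a₁ * x 0 + 2 * q.a₂ * x 1 + q.c = 0}

/-- An irreducible quadratic curve: the zero set of a polynomial of degree two, which has
infinitely many points (it is neither empty nor a point) and is not the union of two, possibly
equal, lines. -/
def IsIrreducibleQuadraticCurve (S : Set Plane) : Prop :=
  (∃ q : QuadEq, (q.a₁₁ ≠ 0 ∨ q.a₂₂ ≠ 0 ∨ q.a₁₂ ≠ 0) ∧ S = q.zeros) ∧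
  S.Infinite ∧
  ¬ ∃ l₁ l₂ : Set Plane, IsLine l₁ ∧ IsLine l₂ ∧ S = l₁ ∪ l₂

/-- `u`, `v` is an orthonormal frame. -/
def IsFrame (u v : Plane) : Prop :=
  ‖u‖ = 1 ∧ ‖v‖ = 1 ∧ inner ℝ u v = 0

/-- An ellipse (circles included). -/
def IsEllipse (S : Set Plane) : Prop :=
  ∃ (p u v : Plane) (a b : ℝ), IsFrame u v ∧ 0 < a ∧ 0 < b ∧
    S = {x | (inner ℝ (x - p) u / a) ^ 2 + (inner ℝ (x - p) v / b) ^ 2 = 1}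

/-- A hyperbola whose asymptotes have the directions `d₁` and `d₂`. -/
def IsHyperbolaWithAsymptotes (S : Set Plane) (d₁ d₂ : Plane) : Prop :=
  ∃ (p u v : Plane) (a b : ℝ), IsFrame u v ∧ 0 < a ∧ 0 < b ∧
    S = {x | (inner ℝ (x - p) u / a) ^ 2 - (inner ℝ (x - p) v / b) ^ 2 = 1} ∧
    d₁ = a • u + b • v ∧ d₂ = a • u - b • v

/-- A parabola whose axis has the direction `v`. -/
def IsParabolaWithAxis (S : Set Plane) (v : Plane) : Prop :=
  ∃ (p u : Plane) (k : ℝ), IsFrame u v ∧ k ≠ 0 ∧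
    S = {x | inner ℝ (x - p) v = k * inner ℝ (x - p) u ^ 2}

/-- A parabola. -/
def IsParabola (S : Set Plane) : Prop :=
  ∃ v : Plane, IsParabolaWithAxis S v

/-! ### Frontals and fronts -/

/-- `(γ, ν)` is a smooth Legendrian curve on the open set `I` of parameters. -/
def IsLegendrianOn (γ ν : ℝ → Plane) (I : Set ℝ) : Prop :=
  ContDiffOn ℝ ∞ γ I ∧ ContDiffOn ℝ ∞ ν I ∧
    ∀ t ∈ I, ‖ν t‖ = 1 ∧ inner ℝ (deriv γ t) (ν t) = 0

/-- `γ` is a front on `I`: it has a Legendrian lift that is an immersion. -/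
def IsFrontOn (γ : ℝ → Plane) (I : Set ℝ) : Prop :=
  ∃ ν : ℝ → Plane, IsLegendrianOn γ ν I ∧ ∀ t ∈ I, deriv γ t ≠ 0 ∨ deriv ν t ≠ 0

/-- `γ` is a regular smooth curve on `I`. -/
def IsRegularOn (γ : ℝ → Plane) (I : Set ℝ) : Prop :=
  ContDiffOn ℝ ∞ γ I ∧ ∀ t ∈ I, deriv γ t ≠ 0

/-- Near each of its points, `S` is a finite union of images of open intervals under
parametrized curves through the point that have the property `P`. -/
def IsLocalUnionOf (P : (ℝ → Plane) → Set ℝ → Prop) (S : Set Plane) : Prop :=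
  ∀ x ∈ S, ∃ U : Set Plane, IsOpen U ∧ x ∈ U ∧
    ∃ (r : ℕ) (γ : Fin r → ℝ → Plane) (t ε : Fin r → ℝ),
      (∀ i, 0 < ε i ∧ γ i (t i) = x ∧ P (γ i) (Set.Ioo (t i - ε i) (t i + ε i))) ∧
      (⋃ i, γ i '' Set.Ioo (t i - ε i) (t i + ε i)) = U ∩ S

/-- A front set. -/
def IsFrontSet (S : Set Plane) : Prop :=
  IsLocalUnionOf IsFrontOn S

/-- `S` is regular as a parametrized curve: all its local branches are regular curves. -/
def IsRegularlyParametrized (S : Set Plane) : Prop :=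
  IsLocalUnionOf IsRegularOn S

/-! ### The primitive and the inversion -/

/-- The pairs `(x, n)` of a point `x` of `S` and a unit normal `n` at `x` of a nondegenerate
(injectively parametrized) frontal arc of `S` through `x`. -/
def contactElements (S : Set Plane) : Set (Plane × Plane) :=
  {e | ∃ (γ ν : ℝ → Plane) (t₀ ε : ℝ), 0 < ε ∧
    IsLegendrianOn γ ν (Set.Ioo (t₀ - ε) (t₀ + ε)) ∧
    Set.InjOn γ (Set.Ioo (t₀ - ε) (t₀ + ε)) ∧
    Set.MapsTo γ (Set.Ioo (t₀ - ε) (t₀ + ε)) S ∧ γ t₀ = e.1 ∧ ν t₀ = e.2}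

/-- The part of `S` on which the no-silhouette condition `⟨x, n⟩ ≠ 0` holds. -/
def noSilhouettePart (S : Set Plane) : Set Plane :=
  {x | ∃ n, (x, n) ∈ contactElements S ∧ inner ℝ x n ≠ 0}

/-- The locus of the points `2 x - (‖x‖² / ⟨x, n⟩) n`, taken over the no-silhouette part. -/
def primitiveLocus (S : Set Plane) : Set Plane :=
  {y | ∃ x n, (x, n) ∈ contactElements S ∧ inner ℝ x n ≠ 0 ∧
    y = (2 : ℝ) • x - (‖x‖ ^ 2 / inner ℝ x n) • n}

/-- The image of `S \ {0}` under `x ↦ x / ‖x‖²`. -/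
def puncturedInversion (S : Set Plane) : Set Plane :=
  EuclideanGeometry.inversion (0 : Plane) 1 '' (S \ {0})

/-- The inversion of a curve: the closure of the image of `S \ {0}` under `x ↦ x / ‖x‖²`. -/
def curveInversion (S : Set Plane) : Set Plane :=
  closure (puncturedInversion S)

/-! ### Points of a plane curve -/

/-- `φ` is a diffeomorphism from a neighbourhood of `x` onto a neighbourhood of the origin which
takes `x` to the origin and `S` to `T`. -/
def IsLocalModel (φ : OpenPartialHomeomorph Plane Plane) (S : Set Plane) (x : Plane)
    (T : Set Plane) : Prop :=
  x ∈ φ.source ∧ φ x = 0 ∧ ContDiffOn ℝ ∞ φ φ.source ∧ ContDiffOn ℝ ∞ φ.symm φ.target ∧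
    φ '' (φ.source ∩ S) = φ.target ∩ T

/-- Near `x`, the set `S` is a regular curve. -/
def IsRegularAt (S : Set Plane) (x : Plane) : Prop :=
  ∃ φ : OpenPartialHomeomorph Plane Plane, IsLocalModel φ S x {y | y 1 = 0}

/-- `x` is an isolated point of `S`. -/
def IsIsolatedPointOf (S : Set Plane) (x : Plane) : Prop :=
  ∃ U : Set Plane, IsOpen U ∧ U ∩ S = {x}

/-- `x` is a node of `S` whose two branches have the tangent directions `d₁` and `d₂`. -/
def HasNodeAt (S : Set Plane) (x d₁ d₂ : Plane) : Prop :=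
  d₁ ≠ 0 ∧ d₂ ≠ 0 ∧ ∃ φ : OpenPartialHomeomorph Plane Plane,
    IsLocalModel φ S x {y | y 0 * y 1 = 0} ∧
    (fderiv ℝ φ x d₁) 1 = 0 ∧ (fderiv ℝ φ x d₂) 0 = 0

/-- `x` is an ordinary cusp of `S` with the tangent direction `d`. -/
def HasOrdinaryCuspAt (S : Set Plane) (x d : Plane) : Prop :=
  d ≠ 0 ∧ ∃ φ : OpenPartialHomeomorph Plane Plane,
    IsLocalModel φ S x {y | ∃ t : ℝ, y 0 = t ^ 2 ∧ y 1 = t ^ 3} ∧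
    (fderiv ℝ φ x d) 1 = 0

end PlaneCurve

end

open PlaneCurve

noncomputable section

namespace PlaneCurve

/-! ### Coordinates -/

/-! The curve `Γ` is the pedal curve of the conic `C` with respect to the origin, hence the inverse
of the polar reciprocal of `C`; everything else is read off from the equation of an inverted conic.

Let `y = 2 γ - (‖γ‖² / ⟨γ, ν⟩) ν` along an arc of `Γ`. Then `⟨y, γ⟩ = ‖γ‖²`, and differentiation
with `⟨γ', ν⟩ = 0` gives `⟨y', γ⟩ = 0`. Where `y' ≠ 0`, the line `⟨z, γ⟩ = ‖γ‖²` is therefore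
tangent to `C` at `y`, so its pole `γ / ‖γ‖²` lies on the dual conic (`invPoly_dual_of_tangent`). If
`y` were constant near some parameter, the arc would lie on the circle with diameter from `0` to
`y`; by algebraicity `Γ` would contain this circle through the origin, which is excluded
(`invPoly_dual_of_noSilhouette`). Density carries the inclusion to all of `Γ \ {0}`.

For the converse, the inverse of a nondegenerate conic is a rational curve, and a polynomial that
vanishes at infinitely many of its points vanishes on all of it, complex points included
(`inverse_conic_subset`). A point at infinity of the dual conic, possibly complex, inverts to the
origin, which places the origin on `Γ`. This breaks down only if the dual conic is a circle; then
the punctured inverse is a line or a circle, and `Γ` without the origin would be one of the excluded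
curves (`curve_eq_invZeros`).

The equation has degree at most 4, and at most 3 if the quadratic part of `C` degenerates, as for a
parabola. No polynomial of degree at most 2 has the same real zero set
(`coeff_eq_zero_of_invZeros_eq`). Away from the origin, inversion preserves smoothness, and the
gradient does not vanish (`invPoly_gradient_ne_zero`). At the origin the lowest-order term is the
quadratic part of the dual conic; its signature decides between isolated point, node and cusp.
Explicit coordinate changes give the normal forms (`hasNodeAt_of_eq`, `hasOrdinaryCuspAt_of_eq`). -/

theorem norm_sq_eq (x : Plane) : ‖x‖ ^ 2 = x 0 ^ 2 + x 1 ^ 2 := by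
  rw [EuclideanSpace.real_norm_sq_eq, Fin.sum_univ_two]

theorem inner_eq (x y : Plane) : inner ℝ x y = x 0 * y 0 + x 1 * y 1 := by
  simp [PiLp.inner_apply, Fin.sum_univ_two, mul_comm]

theorem plane_ext {x y : Plane} (h0 : x 0 = y 0) (h1 : x 1 = y 1) : x = y := by
  ext i; fin_cases i <;> assumption

theorem sq_add_sq_pos {x : Plane} (h : x ≠ 0) : 0 < x 0 ^ 2 + x 1 ^ 2 := by
  rw [← norm_sq_eq]; positivity

theorem eq_zero_of_sq_add_sq {a b : ℝ} (h : a ^ 2 + b ^ 2 = 0) : a = 0 ∧ b = 0 := by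
  constructor <;> nlinarith [sq_nonneg a, sq_nonneg b]

/-! ### Conics -/

/-- The determinant of the symmetric matrix of the conic. -/
def QuadEq.det (q : QuadEq) : ℝ :=
  q.a₁₁ * (q.a₂₂ * q.c - q.a₂ ^ 2) - q.a₁₂ * (q.a₁₂ * q.c - q.a₂ * q.a₁)
    + q.a₁ * (q.a₁₂ * q.a₂ - q.a₂₂ * q.a₁)

/-- The polar reciprocal of a conic in the unit circle. -/
def QuadEq.dual (q : QuadEq) : QuadEq where
  a₁₁ := q.a₂ ^ 2 - q.a₂₂ * q.c
  a₂₂ := q.a₁ ^ 2 - q.a₁₁ * q.c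
  a₁₂ := q.a₁₂ * q.c - q.a₁ * q.a₂
  a₁ := q.a₁₂ * q.a₂ - q.a₁ * q.a₂₂
  a₂ := q.a₁ * q.a₁₂ - q.a₂ * q.a₁₁
  c := q.a₁₂ ^ 2 - q.a₁₁ * q.a₂₂

/-- The matrix of the dual is `-J adj(M) J` with `J = diag(1, 1, -1)`, because the line `⟨z, w⟩ = 1`
has the coordinates `(w, -1)`. Thus the dual of a nondegenerate conic is nondegenerate. -/
theorem QuadEq.det_dual (q : QuadEq) : q.dual.det = -q.det ^ 2 := by
  simp only [QuadEq.det, QuadEq.dual]; ring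

/-- The polynomial whose zero set is the inverse of the conic. -/
def QuadEq.invPoly (D : QuadEq) (x y : ℝ) : ℝ :=
  D.c * (x ^ 2 + y ^ 2) ^ 2 + 2 * D.a₁ * (x ^ 2 + y ^ 2) * x + 2 * D.a₂ * (x ^ 2 + y ^ 2) * y
    + D.a₁₁ * x ^ 2 + 2 * D.a₁₂ * (x * y) + D.a₂₂ * y ^ 2

theorem mem_zeros {q : QuadEq} {x : Plane} : x ∈ q.zeros ↔
    q.a₁₁ * x 0 ^ 2 + q.a₂₂ * x 1 ^ 2 + 2 * q.a₁₂ * (x 0 * x 1)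
    + 2 * q.a₁ * x 0 + 2 * q.a₂ * x 1 + q.c = 0 := Iff.rfl

theorem isLine_iff_affine {a b : ℝ} (c : ℝ) (h : a ≠ 0 ∨ b ≠ 0) :
    IsLine {x : Plane | a * x 0 + b * x 1 + c = 0} := ⟨a, b, c, h, rfl⟩

/-- The zero set of a binary quadratic form, translated, is the plane, a point or two lines. -/
theorem zeros_form_trichotomy (α β γ k l : ℝ) (S : Set Plane)
    (hS : S = {x : Plane | α * (x 0 - k) ^ 2 + 2 * β * ((x 0 - k) * (x 1 - l))
      + γ * (x 1 - l) ^ 2 = 0}) :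
    S = Set.univ ∨ S.Finite ∨ ∃ l₁ l₂ : Set Plane, IsLine l₁ ∧ IsLine l₂ ∧ S = l₁ ∪ l₂ := by
  by_cases hα : α = 0
  · subst hα
    by_cases h : β = 0 ∧ γ = 0
    · left; rw [hS]; ext x; simp [h.1, h.2]
    · right; right
      refine ⟨{x : Plane | 0 * x 0 + 1 * x 1 + (-l) = 0},
        {x : Plane | (2 * β) * x 0 + γ * x 1 + (-(2 * β * k) - γ * l) = 0},
        isLine_iff_affine _ (by simp), isLine_iff_affine _ ?_, ?_⟩
      · by_contra hc; push Not at hc; exact h ⟨by linarith [hc.1], hc.2⟩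
      · rw [hS]; ext x
        simp only [Set.mem_ofPred_eq, Set.mem_union]
        rw [← mul_eq_zero]
        constructor <;> intro hx <;> linear_combination hx
  · by_cases hd : 0 ≤ β ^ 2 - α * γ
    · right; right
      set δ := √(β ^ 2 - α * γ)
      have hδ : δ ^ 2 = β ^ 2 - α * γ := Real.sq_sqrt hd
      refine ⟨{x : Plane | α * x 0 + (β + δ) * x 1 + (-α * k - (β + δ) * l) = 0},
        {x : Plane | α * x 0 + (β - δ) * x 1 + (-α * k - (β - δ) * l) = 0},
        isLine_iff_affine _ (.inl hα), isLine_iff_affine _ (.inl hα), ?_⟩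
      rw [hS]; ext x
      simp only [Set.mem_ofPred_eq, Set.mem_union]
      rw [← mul_eq_zero]
      constructor <;> intro hx
      · linear_combination α * hx - (x 1 - l) ^ 2 * hδ
      · apply mul_left_cancel₀ hα
        linear_combination hx + (x 1 - l) ^ 2 * hδ
    · right; left
      apply Set.Subsingleton.finite
      have key : ∀ x ∈ S, x 0 = k ∧ x 1 = l := by
        intro x hx
        rw [hS] at hx
        simp only [Set.mem_ofPred_eq] at hx
        have h1 : (α * (x 0 - k) + β * (x 1 - l)) ^ 2 + (α * γ - β ^ 2) * (x 1 - l) ^ 2 = 0 := by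
          linear_combination α * hx
        have h2 : 0 < α * γ - β ^ 2 := by linarith
        have h3 : (x 1 - l) = 0 := by
          by_contra hne
          have : 0 < (x 1 - l) ^ 2 := by positivity
          nlinarith [sq_nonneg (α * (x 0 - k) + β * (x 1 - l)), mul_pos h2 this]
        rw [h3] at h1
        have h4 : α * (x 0 - k) = 0 := by nlinarith
        have h5 := (mul_eq_zero.mp h4).resolve_left hα
        constructor <;> linarith
      intro x hx y hy
      exact plane_ext ((key x hx).1.trans (key y hy).1.symm) ((key x hx).2.trans (key y hy).2.symm)

/-- The zero set of a quadratic polynomial in one linear form is the plane, empty, or two parallel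
lines. -/
theorem zeros_cylinder_trichotomy (μ ρ c a b : ℝ) (hab : a ≠ 0 ∨ b ≠ 0) (S : Set Plane)
    (hS : S = {x : Plane | μ * (a * x 0 + b * x 1) ^ 2 + 2 * ρ * (a * x 0 + b * x 1) + c = 0}) :
    S = Set.univ ∨ S.Finite ∨ ∃ l₁ l₂ : Set Plane, IsLine l₁ ∧ IsLine l₂ ∧ S = l₁ ∪ l₂ := by
  by_cases hμ : μ = 0
  · subst hμ
    by_cases hρ : ρ = 0
    · subst hρ
      by_cases hc : c = 0
      · left; rw [hS]; ext x; simp [hc]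
      · right; left; rw [hS]; simp [hc]
    · right; right
      have hl : S = {x : Plane | (2 * ρ * a) * x 0 + (2 * ρ * b) * x 1 + c = 0} := by
        rw [hS]; ext x
        simp only [Set.mem_ofPred_eq]
        constructor <;> intro hx <;> linear_combination hx
      have hline : IsLine S := by
        rw [hl]; apply isLine_iff_affine
        rcases hab with h | h
        · left; positivity
        · right; positivity
      exact ⟨S, S, hline, hline, by simp⟩
  · by_cases hd : 0 ≤ ρ ^ 2 - μ * c
    · right; right
      set δ := √(ρ ^ 2 - μ * c)
      have hδ : δ ^ 2 = ρ ^ 2 - μ * c := Real.sq_sqrt hd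
      have hab' : μ * a ≠ 0 ∨ μ * b ≠ 0 := by
        rcases hab with h | h
        · left; positivity
        · right; positivity
      refine ⟨{x : Plane | μ * a * x 0 + μ * b * x 1 + (ρ + δ) = 0},
        {x : Plane | μ * a * x 0 + μ * b * x 1 + (ρ - δ) = 0},
        isLine_iff_affine _ hab', isLine_iff_affine _ hab', ?_⟩
      rw [hS]; ext x
      simp only [Set.mem_ofPred_eq, Set.mem_union]
      rw [← mul_eq_zero]
      constructor <;> intro hx
      · linear_combination μ * hx - hδ
      · apply mul_left_cancel₀ hμ
        linear_combination hx + hδ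
    · right; left
      have : S = ∅ := by
        rw [hS]; ext x
        simp only [Set.mem_ofPred_eq, Set.mem_empty_iff_false, iff_false]
        intro hx
        have : (μ * (a * x 0 + b * x 1) + ρ) ^ 2 = ρ ^ 2 - μ * c := by linear_combination μ * hx
        exact hd (this ▸ sq_nonneg _)
      rw [this]; exact Set.finite_empty

theorem QuadEq.zeros_ne_univ {q : QuadEq} (h : q.a₁₁ ≠ 0 ∨ q.a₂₂ ≠ 0 ∨ q.a₁₂ ≠ 0) :
    q.zeros ≠ Set.univ := by
  intro hu
  have key : ∀ a b : ℝ, q.a₁₁ * a ^ 2 + q.a₂₂ * b ^ 2 + 2 * q.a₁₂ * (a * b)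
    + 2 * q.a₁ * a + 2 * q.a₂ * b + q.c = 0 := by
    intro a b
    have : (!₂[a, b] : Plane) ∈ q.zeros := by rw [hu]; trivial
    simpa [mem_zeros] using this
  have h0 := key 0 0
  have h1 := key 1 0
  have h2 := key (-1) 0
  have h3 := key 0 1
  have h4 := key 0 (-1)
  have h5 := key 1 1
  norm_num at h0 h1 h2 h3 h4 h5
  rcases h with h | h | h <;> apply h <;> linarith

/-- A kernel vector of a singular matrix is a vertex of the conic. A vertex at infinity makes the
equation depend on one linear form only; a finite vertex makes it a quadratic form centred there.
Both cases are incompatible with irreducibility. -/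
theorem det_ne_zero_of_irreducible {q : QuadEq} (h : IsIrreducibleQuadraticCurve q.zeros) :
    q.det ≠ 0 := by
  obtain ⟨⟨q', hq', hqq'⟩, hinf, hlines⟩ := h
  intro hdet
  have tri : q.zeros = Set.univ ∨ q.zeros.Finite ∨
      ∃ l₁ l₂ : Set Plane, IsLine l₁ ∧ IsLine l₂ ∧ q.zeros = l₁ ∪ l₂ := by
    have hM : (!![q.a₁₁, q.a₁₂, q.a₁; q.a₁₂, q.a₂₂, q.a₂; q.a₁, q.a₂, q.c] :
        Matrix (Fin 3) (Fin 3) ℝ).det = 0 := by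
      rw [Matrix.det_fin_three]
      simp only [QuadEq.det] at hdet
      simp
      linear_combination hdet
    obtain ⟨k, hk, hk0⟩ := Matrix.exists_mulVec_eq_zero_iff.mpr hM
    have e0 := congrFun hk0 0
    have e1 := congrFun hk0 1
    have e2 := congrFun hk0 2
    simp [Matrix.mulVec, dotProduct, Fin.sum_univ_three] at e0 e1 e2
    by_cases h2 : k 2 = 0
    · have hs : k 0 ^ 2 + k 1 ^ 2 ≠ 0 := by
        intro hs
        obtain ⟨h0, h1⟩ := eq_zero_of_sq_add_sq hs
        apply hk; ext i; fin_cases i <;> assumption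
      rw [h2] at e0 e1 e2
      refine zeros_cylinder_trichotomy ((q.a₁₁ + q.a₂₂) / (k 0 ^ 2 + k 1 ^ 2))
        ((q.a₁ * k 1 - q.a₂ * k 0) / (k 0 ^ 2 + k 1 ^ 2)) q.c (k 1) (-k 0) ?_ _ ?_
      · by_contra hc; push Not at hc; apply hs
        rw [hc.1, neg_eq_zero.mp hc.2]; ring
      · ext x
        rw [mem_zeros, Set.mem_ofPred_eq]
        have h11 : q.a₁₁ = (q.a₁₁ + q.a₂₂) / (k 0 ^ 2 + k 1 ^ 2) * k 1 ^ 2 := by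
          field_simp; linear_combination k 0 * e0 - k 1 * e1
        have h22 : q.a₂₂ = (q.a₁₁ + q.a₂₂) / (k 0 ^ 2 + k 1 ^ 2) * k 0 ^ 2 := by
          field_simp; linear_combination k 1 * e1 - k 0 * e0
        have h12 : q.a₁₂ = -((q.a₁₁ + q.a₂₂) / (k 0 ^ 2 + k 1 ^ 2) * (k 0 * k 1)) := by
          field_simp; linear_combination k 1 * e0 + k 0 * e1
        have h1 : q.a₁ = (q.a₁ * k 1 - q.a₂ * k 0) / (k 0 ^ 2 + k 1 ^ 2) * k 1 := by
          field_simp; linear_combination k 0 * e2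
        have h2 : q.a₂ = -((q.a₁ * k 1 - q.a₂ * k 0) / (k 0 ^ 2 + k 1 ^ 2) * k 0) := by
          field_simp; linear_combination k 1 * e2
        generalize (q.a₁₁ + q.a₂₂) / (k 0 ^ 2 + k 1 ^ 2) = μ at *
        generalize (q.a₁ * k 1 - q.a₂ * k 0) / (k 0 ^ 2 + k 1 ^ 2) = ρ at *
        rw [h11, h22, h12, h1, h2]
        constructor <;> intro hx <;> linear_combination hx
    · refine zeros_form_trichotomy q.a₁₁ q.a₁₂ q.a₂₂ (k 0 / k 2) (k 1 / k 2) _ ?_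
      have f0 : q.a₁₁ * (k 0 / k 2) + q.a₁₂ * (k 1 / k 2) + q.a₁ = 0 := by
        field_simp; linear_combination e0
      have f1 : q.a₁₂ * (k 0 / k 2) + q.a₂₂ * (k 1 / k 2) + q.a₂ = 0 := by
        field_simp; linear_combination e1
      have f2 : q.a₁ * (k 0 / k 2) + q.a₂ * (k 1 / k 2) + q.c = 0 := by
        field_simp; linear_combination e2
      ext x
      rw [mem_zeros, Set.mem_ofPred_eq]
      generalize k 0 / k 2 = u at *
      generalize k 1 / k 2 = v at *
      constructor <;> intro hx
      · linear_combination hx - (2 * x 0 - u) * f0 - (2 * x 1 - v) * f1 - f2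
      · linear_combination hx + (2 * x 0 - u) * f0 + (2 * x 1 - v) * f1 + f2
  rcases tri with h | h | h
  · exact QuadEq.zeros_ne_univ hq' (hqq' ▸ h)
  · exact hinf h
  · exact hlines h

/-- A nondegenerate conic contains no line: if its equation vanishes on the line through `p` with
the direction `e`, then the determinant vanishes or `e` is isotropic. -/
theorem det_mul_eq_zero_of_line {K : Type*} [Field K] (a₁₁ a₂₂ a₁₂ a₁ a₂ c p₀ p₁ e₀ e₁ : K)
    (h0 : a₁₁ * p₀ ^ 2 + a₂₂ * p₁ ^ 2 + 2 * a₁₂ * (p₀ * p₁) + 2 * a₁ * p₀ + 2 * a₂ * p₁ + c = 0)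
    (h1 : (a₁₁ * p₀ + a₁₂ * p₁ + a₁) * e₀ + (a₁₂ * p₀ + a₂₂ * p₁ + a₂) * e₁ = 0)
    (h2 : a₁₁ * e₀ ^ 2 + 2 * a₁₂ * (e₀ * e₁) + a₂₂ * e₁ ^ 2 = 0) :
    (a₁₁ * (a₂₂ * c - a₂ ^ 2) - a₁₂ * (a₁₂ * c - a₂ * a₁) + a₁ * (a₁₂ * a₂ - a₂₂ * a₁))
      * (e₀ ^ 2 + e₁ ^ 2) ^ 2 = 0 := by
  -- The `nᵢⱼ` are the entries of the matrix of the conic in the basis `(e, 0)`, `(p, 1)`, `(e^⊥,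
  -- 0)`, whose determinant is `‖e‖²` up to sign. The hypotheses say that the upper left 2×2 block
  -- is zero, so the 3×3 determinant vanishes.
  set n33 := a₁₁ * e₁ ^ 2 - 2 * a₁₂ * (e₀ * e₁) + a₂₂ * e₀ ^ 2
  set n13 := -a₁₁ * e₀ * e₁ + a₁₂ * (e₀ ^ 2 - e₁ ^ 2) + a₂₂ * e₀ * e₁ with h13
  set n23 := -(a₁₁ * p₀ + a₁₂ * p₁ + a₁) * e₁ + (a₁₂ * p₀ + a₂₂ * p₁ + a₂) * e₀ with h23
  set n12 := (a₁₁ * p₀ + a₁₂ * p₁ + a₁) * e₀ + (a₁₂ * p₀ + a₂₂ * p₁ + a₂) * e₁ with h12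
  set n22 := a₁₁ * p₀ ^ 2 + a₂₂ * p₁ ^ 2 + 2 * a₁₂ * (p₀ * p₁) + 2 * a₁ * p₀ + 2 * a₂ * p₁ + c
    with h22
  linear_combination (n22 * n33 - n23 ^ 2) * h2 + (-n12 * n33 + 2 * n23 * n13) * h1 - n13 ^ 2 * h0

theorem QuadEq.quad_ne_zero_of_det {q : QuadEq} (h : q.det ≠ 0) :
    q.a₁₁ ≠ 0 ∨ q.a₂₂ ≠ 0 ∨ q.a₁₂ ≠ 0 := by
  by_contra hc
  push Not at hc
  obtain ⟨h1, h2, h3⟩ := hc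
  apply h
  simp [QuadEq.det, h1, h2, h3]

theorem QuadEq.not_line_subset {q : QuadEq} (h : q.det ≠ 0) {l : Set Plane} (hl : IsLine l) :
    ¬ l ⊆ q.zeros := by
  obtain ⟨a, b, c, hab, rfl⟩ := hl
  intro hsub
  have hs : a ^ 2 + b ^ 2 ≠ 0 := by
    intro hs
    obtain ⟨h0, h1⟩ := eq_zero_of_sq_add_sq hs
    simp [h0, h1] at hab
  set p₀ := -a * c / (a ^ 2 + b ^ 2) with hp₀
  set p₁ := -b * c / (a ^ 2 + b ^ 2) with hp₁
  have key : ∀ t : ℝ, q.a₁₁ * (p₀ + t * b) ^ 2 + q.a₂₂ * (p₁ - t * a) ^ 2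
      + 2 * q.a₁₂ * ((p₀ + t * b) * (p₁ - t * a))
      + 2 * q.a₁ * (p₀ + t * b) + 2 * q.a₂ * (p₁ - t * a) + q.c = 0 := by
    intro t
    have : (!₂[p₀ + t * b, p₁ - t * a] : Plane) ∈ q.zeros := by
      apply hsub
      simp only [Set.mem_ofPred_eq, Matrix.cons_val_zero, Matrix.cons_val_one,
        hp₀, hp₁]
      field_simp
      ring
    simpa [mem_zeros] using this
  have k0 := key 0
  have k1 := key 1
  have k2 := key (-1)
  have := det_mul_eq_zero_of_line q.a₁₁ q.a₂₂ q.a₁₂ q.a₁ q.a₂ q.c p₀ p₁ b (-a)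
    (by linear_combination k0) (by linear_combination (k1 - k2) / 4)
    (by linear_combination (k1 + k2) / 2 - k0)
  rcases mul_eq_zero.mp this with h' | h'
  · exact h h'
  · apply hs
    have := pow_eq_zero_iff (two_ne_zero) |>.mp h'
    linear_combination this

theorem irreducible_of_det_ne_zero {q : QuadEq} (h : q.det ≠ 0) (hinf : q.zeros.Infinite) :
    IsIrreducibleQuadraticCurve q.zeros := by
  refine ⟨⟨q, QuadEq.quad_ne_zero_of_det h, rfl⟩, hinf, ?_⟩
  rintro ⟨l₁, l₂, h₁, -, heq⟩
  exact QuadEq.not_line_subset h h₁ (heq ▸ Set.subset_union_left)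

/-! ### Inversion -/

theorem inversion_apply (x : Plane) (i : Fin 2) :
    EuclideanGeometry.inversion (0 : Plane) 1 x i = x i / (x 0 ^ 2 + x 1 ^ 2) := by
  simp only [EuclideanGeometry.inversion, dist_zero_right, vsub_eq_sub, sub_zero, vadd_eq_add,
    add_zero, PiLp.smul_apply, smul_eq_mul, div_pow, one_pow, norm_sq_eq]
  ring

theorem inversion_ne_zero {x : Plane} (h : x ≠ 0) :
    EuclideanGeometry.inversion (0 : Plane) 1 x ≠ 0 := by
  intro h0
  exact h ((EuclideanGeometry.inversion_eq_center one_ne_zero).mp h0)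

theorem invPoly_inversion (D : QuadEq) {x : Plane} (h : x ≠ 0) :
    EuclideanGeometry.inversion (0 : Plane) 1 x ∈ D.zeros ↔ D.invPoly (x 0) (x 1) = 0 := by
  have hr := (sq_add_sq_pos h).ne'
  rw [mem_zeros, inversion_apply, inversion_apply, QuadEq.invPoly]
  rw [← mul_eq_zero_iff_left (pow_ne_zero 2 hr)]
  field_simp
  constructor <;> intro hx <;> linear_combination hx

/-- A singular point of the inverse of a nondegenerate conic is the origin. -/
theorem invPoly_gradient_ne_zero {D : QuadEq} (h : D.det ≠ 0) {x y : ℝ} (hxy : x ^ 2 + y ^ 2 ≠ 0)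
    (h0 : D.invPoly x y = 0)
    (h1 : 2 * D.c * (x ^ 2 + y ^ 2) * x + D.a₁ * (3 * x ^ 2 + y ^ 2) + 2 * D.a₂ * (x * y)
      + D.a₁₁ * x + D.a₁₂ * y = 0)
    (h2 : 2 * D.c * (x ^ 2 + y ^ 2) * y + 2 * D.a₁ * (x * y) + D.a₂ * (x ^ 2 + 3 * y ^ 2)
      + D.a₁₂ * x + D.a₂₂ * y = 0) : False := by
  simp only [QuadEq.invPoly] at h0
  -- Euler's relation isolates the last coordinate of `M (x, y, r)`, where `M` is the matrix of `D`
  -- and `r = x² + y²`; the gradient then yields the other two. Since `M` is invertible, `x = y =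
  -- 0`.
  have z2 : D.a₁ * x + D.a₂ * y + D.c * (x ^ 2 + y ^ 2) = 0 := by
    apply mul_left_cancel₀ hxy
    linear_combination x * h1 + y * h2 - h0
  have z0 : D.a₁₁ * x + D.a₁₂ * y + D.a₁ * (x ^ 2 + y ^ 2) = 0 := by
    linear_combination h1 - 2 * x * z2
  have z1 : D.a₁₂ * x + D.a₂₂ * y + D.a₂ * (x ^ 2 + y ^ 2) = 0 := by
    linear_combination h2 - 2 * y * z2
  have hx : D.det * x = 0 := by
    simp only [QuadEq.det]
    linear_combination (D.a₂₂ * D.c - D.a₂ ^ 2) * z0 + (D.a₁ * D.a₂ - D.a₁₂ * D.c) * z1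
      + (D.a₁₂ * D.a₂ - D.a₂₂ * D.a₁) * z2
  have hy : D.det * y = 0 := by
    simp only [QuadEq.det]
    linear_combination (D.a₁ * D.a₂ - D.a₁₂ * D.c) * z0 + (D.a₁₁ * D.c - D.a₁ ^ 2) * z1
      + (D.a₁₂ * D.a₁ - D.a₁₁ * D.a₂) * z2
  apply hxy
  rw [(mul_eq_zero.mp hx).resolve_left h, (mul_eq_zero.mp hy).resolve_left h]
  ring

/-! ### Rational parametrizations -/

open Polynomial in
-- One numerator `H` serves all extension fields at once. This is what transfers a vanishing
-- statement from real parameters to complex ones.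
theorem exists_clear_denominators (F : MvPolynomial (Fin 2) ℝ) (p : Fin 2 → ℝ[X]) (N : ℝ[X]) :
    ∃ (k : ℕ) (H : ℝ[X]), ∀ (K : Type) [Field K] [Algebra ℝ K] (s : K), aeval s N ≠ 0 →
      aeval s H = aeval s N ^ k * MvPolynomial.aeval (fun i => aeval s (p i) / aeval s N) F := by
  induction F using MvPolynomial.induction_on with
  | C a => exact ⟨0, C a, fun K _ _ s _ => by simp⟩
  | add F G hF hG =>
    obtain ⟨k, H, h⟩ := hF
    obtain ⟨l, J, h'⟩ := hG
    refine ⟨k + l, N ^ l * H + N ^ k * J, fun K _ _ s hs => ?_⟩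
    rw [map_add, map_add, map_mul, map_mul, h K s hs, h' K s hs, map_pow, map_pow]
    ring
  | mul_X F i hF =>
    obtain ⟨k, H, h⟩ := hF
    refine ⟨k + 1, H * p i, fun K _ _ s hs => ?_⟩
    rw [map_mul, map_mul, h K s hs, MvPolynomial.aeval_X]
    rw [pow_succ]
    field_simp

open Polynomial in
/-- A polynomial that vanishes at infinitely many real points of a rational curve vanishes at all
its points, complex ones included. -/
theorem aeval_ratCurve_eq_zero {F : MvPolynomial (Fin 2) ℝ} {p : Fin 2 → ℝ[X]} {N : ℝ[X]}
    (h : {s : ℝ | N.eval s ≠ 0 ∧ MvPolynomial.eval (fun i => (p i).eval s / N.eval s) F = 0}.Infinite)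
    (K : Type) [Field K] [Algebra ℝ K] (s : K) (hs : aeval s N ≠ 0) :
    MvPolynomial.aeval (fun i => aeval s (p i) / aeval s N) F = 0 := by
  obtain ⟨k, H, hH⟩ := exists_clear_denominators F p N
  have hH0 : H = 0 := by
    apply Polynomial.eq_zero_of_infinite_isRoot
    refine h.mono ?_
    rintro s ⟨hs, hF⟩
    have := hH ℝ s (by simpa [Polynomial.coe_aeval_eq_eval] using hs)
    simp only [Polynomial.coe_aeval_eq_eval] at this
    simp only [Set.mem_ofPred_eq, Polynomial.IsRoot]
    rw [this]
    exact mul_eq_zero_of_right _ hF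
  have := hH K s hs
  rw [hH0, map_zero] at this
  exact (mul_eq_zero.mp this.symm).resolve_left (pow_ne_zero _ hs)

/-- The tangent half-angle substitution. The form `(2 s, 1 - s²)` reaches every real direction with
a finite `s`, and every complex direction on which the Euclidean form is nonzero. -/
theorem exists_direction {K : Type*} [Field K] [CharZero K] {X Y ρ : K} (hρ : ρ ^ 2 = X ^ 2 + Y ^ 2)
    (h : ρ ≠ 0) : ∃ s l : K, l ≠ 0 ∧ X = l * (2 * s) ∧ Y = l * (1 - s ^ 2) := by
  by_cases hX : X = 0
  · refine ⟨0, Y, ?_, by simp [hX], by ring⟩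
    rintro rfl
    apply h
    simpa [hX] using hρ
  · have hs : ρ - Y ≠ 0 := by
      intro h0
      have : ρ = Y := sub_eq_zero.mp h0
      rw [this] at hρ
      apply hX
      simpa using hρ
    refine ⟨(ρ - Y) / X, X ^ 2 / (2 * (ρ - Y)), by simp [hX, hs], by field_simp, ?_⟩
    field_simp
    linear_combination hρ

theorem exists_real_direction {x y : ℝ} (h : x ^ 2 + y ^ 2 ≠ 0) :
    ∃ s l : ℝ, l ≠ 0 ∧ x = l * (2 * s) ∧ y = l * (1 - s ^ 2) := by
  have h0 : 0 ≤ x ^ 2 + y ^ 2 := by positivity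
  exact exists_direction (Real.sq_sqrt h0) (fun h' => h ((Real.sqrt_eq_zero h0).mp h'))

theorem mem_polyZeros {F : MvPolynomial (Fin 2) ℝ} {x : Plane} :
    x ∈ polyZeros F ↔ MvPolynomial.eval (fun i => x i) F = 0 := Iff.rfl

open Polynomial in
theorem ratCurve_subset_polyZeros {F : MvPolynomial (Fin 2) ℝ} {p : Fin 2 → ℝ[X]} {N : ℝ[X]}
    {S : Set Plane}
    (hS : ∀ x ∈ S, ∃ s : ℝ, N.eval s ≠ 0 ∧ ∀ i, x i = (p i).eval s / N.eval s)
    (h : (S ∩ polyZeros F).Infinite) :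
    {s : ℝ | N.eval s ≠ 0 ∧
      MvPolynomial.eval (fun i => (p i).eval s / N.eval s) F = 0}.Infinite ∧ S ⊆ polyZeros F := by
  have hinf : {s : ℝ | N.eval s ≠ 0 ∧
      MvPolynomial.eval (fun i => (p i).eval s / N.eval s) F = 0}.Infinite := by
    refine Set.Infinite.of_image (fun s => (WithLp.toLp 2 fun i => (p i).eval s / N.eval s : Plane))
      (h.mono ?_)
    rintro x ⟨hxS, hxF⟩
    obtain ⟨s, hs, hx⟩ := hS x hxS
    refine ⟨s, ⟨hs, ?_⟩, ?_⟩
    · rw [mem_polyZeros] at hxF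
      simpa only [← hx] using hxF
    · ext i; simp [hx]
  refine ⟨hinf, fun x hx => ?_⟩
  obtain ⟨s, hs, hx⟩ := hS x hx
  have := aeval_ratCurve_eq_zero hinf ℝ s (by simpa [Polynomial.coe_aeval_eq_eval] using hs)
  simp only [Polynomial.coe_aeval_eq_eval, ← hx] at this
  exact this

open Polynomial in
/-- An algebraic curve that has infinitely many points of a circle through the origin contains
the circle. -/
theorem circle_subset_polyZeros {F : MvPolynomial (Fin 2) ℝ} {y : Plane} (hy : y ≠ 0)
    (h : ({x : Plane | ‖x‖ ^ 2 = inner ℝ y x} ∩ polyZeros F).Infinite) :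
    {x : Plane | ‖x‖ ^ 2 = inner ℝ y x} ⊆ polyZeros F := by
  refine (ratCurve_subset_polyZeros
    (p := ![(C (y 0) * (2 * X) + C (y 1) * (1 - X ^ 2)) * (2 * X),
      (C (y 0) * (2 * X) + C (y 1) * (1 - X ^ 2)) * (1 - X ^ 2)])
    (N := (1 + X ^ 2) ^ 2) ?_ h).2
  intro x hx
  rw [Set.mem_ofPred_eq, norm_sq_eq, inner_eq] at hx
  -- The parametrization sends a direction `e` to `(⟨y, e⟩ / ‖e‖²) e`. The origin is the value at
  -- the direction orthogonal to `y`.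
  by_cases hx0 : x = 0
  · have h1 := (sq_add_sq_pos hy).ne'
    obtain ⟨s, l, hl, h0, h1⟩ := exists_real_direction (x := -y 1) (y := y 0)
      (by intro h; apply h1; linear_combination h)
    have : y 0 * (2 * s) + y 1 * (1 - s ^ 2) = 0 := by
      apply mul_left_cancel₀ hl
      linear_combination -y 0 * h0 - y 1 * h1
    refine ⟨s, by simp; positivity, fun i => ?_⟩
    fin_cases i <;> simp [this, hx0]
  · obtain ⟨s, l, hl, h0, h1⟩ := exists_real_direction (sq_add_sq_pos hx0).ne'
    rw [h0, h1] at hx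
    have hN : (1 + s ^ 2) ^ 2 ≠ 0 := by positivity
    have hk : l * (1 + s ^ 2) ^ 2 = y 0 * (2 * s) + y 1 * (1 - s ^ 2) := by
      apply mul_left_cancel₀ hl
      linear_combination hx
    refine ⟨s, by simpa using hN, fun i => ?_⟩
    fin_cases i
    · simp [← hk, h0]; field_simp
    · simp [← hk, h1]; field_simp

/-- Every point `w` of a nondegenerate conic is the second intersection point with a line through
a given point of the conic. -/
theorem exists_chord {D : QuadEq} (hD : D.det ≠ 0) {u v : Plane} (hu : u ∈ D.zeros)
    (hv : v ∈ D.zeros) : ∃ s : ℝ,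
      D.a₁₁ * (2 * s) ^ 2 + 2 * D.a₁₂ * ((2 * s) * (1 - s ^ 2)) + D.a₂₂ * (1 - s ^ 2) ^ 2 ≠ 0 ∧
      ∀ i, (D.a₁₁ * (2 * s) ^ 2 + 2 * D.a₁₂ * ((2 * s) * (1 - s ^ 2))
          + D.a₂₂ * (1 - s ^ 2) ^ 2) * u i
        - 2 * ((D.a₁₁ * u 0 + D.a₁₂ * u 1 + D.a₁) * (2 * s)
          + (D.a₁₂ * u 0 + D.a₂₂ * u 1 + D.a₂) * (1 - s ^ 2)) * (![2 * s, 1 - s ^ 2] : Fin 2 → ℝ) i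
        = (D.a₁₁ * (2 * s) ^ 2 + 2 * D.a₁₂ * ((2 * s) * (1 - s ^ 2))
          + D.a₂₂ * (1 - s ^ 2) ^ 2) * v i := by
  rw [mem_zeros] at hu hv
  set g₀ := D.a₁₁ * u 0 + D.a₁₂ * u 1 + D.a₁ with hg₀
  set g₁ := D.a₁₂ * u 0 + D.a₂₂ * u 1 + D.a₂ with hg₁
  -- A tangent direction at `u` is never asymptotic, since otherwise the conic would contain the
  -- tangent line. Hence `v = u` is reached by the tangent at `u`, and the other points by genuine
  -- chords.
  have line : ∀ s : ℝ, g₀ * (2 * s) + g₁ * (1 - s ^ 2) = 0 →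
      D.a₁₁ * (2 * s) ^ 2 + 2 * D.a₁₂ * ((2 * s) * (1 - s ^ 2)) + D.a₂₂ * (1 - s ^ 2) ^ 2 ≠ 0 := by
    intro s hg h2
    have := det_mul_eq_zero_of_line D.a₁₁ D.a₂₂ D.a₁₂ D.a₁ D.a₂ D.c (u 0) (u 1) (2 * s) (1 - s ^ 2)
      hu hg h2
    have hp : ((2 * s) ^ 2 + (1 - s ^ 2) ^ 2) ^ 2 ≠ 0 := by
      have : (2 * s) ^ 2 + (1 - s ^ 2) ^ 2 = (1 + s ^ 2) ^ 2 := by ring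
      rw [this]; positivity
    exact (mul_ne_zero hD hp) this
  by_cases huv : u = v
  · obtain ⟨s, hs⟩ : ∃ s : ℝ, g₀ * (2 * s) + g₁ * (1 - s ^ 2) = 0 := by
      by_cases hg : g₁ ^ 2 + g₀ ^ 2 = 0
      · obtain ⟨h1, h0⟩ := eq_zero_of_sq_add_sq hg
        exact ⟨0, by simp [h1]⟩
      · obtain ⟨s, l, hl, h0, h1⟩ := exists_real_direction (x := -g₁) (y := g₀)
          (by intro h; apply hg; linear_combination h)
        exact ⟨s, mul_left_cancel₀ hl (by linear_combination -g₀ * h0 - g₁ * h1)⟩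
    refine ⟨s, line s hs, fun i => ?_⟩
    rw [huv, hs]; ring
  · have hne : (v 0 - u 0) ^ 2 + (v 1 - u 1) ^ 2 ≠ 0 := by
      intro h
      obtain ⟨h0, h1⟩ := eq_zero_of_sq_add_sq h
      exact huv (plane_ext (by linarith) (by linarith))
    obtain ⟨s, l, hl, h0, h1⟩ := exists_real_direction hne
    have hlg : 2 * (g₀ * (2 * s) + g₁ * (1 - s ^ 2)) = -l * (D.a₁₁ * (2 * s) ^ 2
        + 2 * D.a₁₂ * ((2 * s) * (1 - s ^ 2)) + D.a₂₂ * (1 - s ^ 2) ^ 2) := by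
      apply mul_left_cancel₀ hl
      have e0 : v 0 = u 0 + l * (2 * s) := by linarith
      have e1 : v 1 = u 1 + l * (1 - s ^ 2) := by linarith
      rw [e0, e1] at hv
      rw [hg₀, hg₁]
      linear_combination hv - hu
    refine ⟨s, fun h2 => line s ?_ h2, fun i => ?_⟩
    · rw [h2] at hlg; linarith
    · rw [hlg]
      fin_cases i
      · simp; linear_combination -(D.a₁₁ * (2 * s) ^ 2
        + 2 * D.a₁₂ * ((2 * s) * (1 - s ^ 2)) + D.a₂₂ * (1 - s ^ 2) ^ 2) * h0
      · simp; linear_combination -(D.a₁₁ * (2 * s) ^ 2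
        + 2 * D.a₁₂ * ((2 * s) * (1 - s ^ 2)) + D.a₂₂ * (1 - s ^ 2) ^ 2) * h1

/-- A real binary quadratic form that is not a multiple of the Euclidean one has a complex zero
at which the Euclidean form does not vanish. -/
theorem exists_isotropic {α β γ : ℝ} (h : ¬ (α = γ ∧ β = 0)) : ∃ X Y : ℂ,
    X ^ 2 + Y ^ 2 ≠ 0 ∧ α * X ^ 2 + 2 * β * (X * Y) + γ * Y ^ 2 = 0 := by
  by_cases hα : α = 0
  · exact ⟨1, 0, by simp, by simp [hα]⟩
  · obtain ⟨δ, hδ⟩ : ∃ δ : ℂ, δ ^ 2 = (β ^ 2 - α * γ : ℂ) :=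
      IsAlgClosed.exists_pow_nat_eq _ two_pos
    by_contra hc
    push Not at hc
    have key : ∀ δ : ℂ, δ ^ 2 = (β ^ 2 - α * γ : ℂ) → (-β + δ : ℂ) ^ 2 + α ^ 2 = 0 := by
      intro δ hδ
      by_contra hne
      exact hc (-β + δ) α hne (by linear_combination α * hδ)
    have h1 := key δ hδ
    have h2 := key (-δ) (by rw [neg_sq, hδ])
    have h3 : (β : ℂ) * δ = 0 := by linear_combination (h2 - h1) / 4
    have h4 : (2 * β ^ 2 - α * γ + α ^ 2 : ℂ) = 0 := by
      linear_combination (h1 + h2) / 2 - hδ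
    rcases mul_eq_zero.mp h3 with hb | hd
    · have hb' : β = 0 := by exact_mod_cast hb
      apply h
      refine ⟨?_, hb'⟩
      have : α * (α - γ) = 0 := by
        rw [hb'] at h4
        have h5 : ((α * (α - γ) : ℝ) : ℂ) = 0 := by push_cast; push_cast at h4; linear_combination h4
        exact_mod_cast h5
      linarith [(mul_eq_zero.mp this).resolve_left hα]
    · rw [hd] at hδ
      have h5 : ((β ^ 2 + α ^ 2 : ℝ) : ℂ) = 0 := by push_cast; linear_combination h4 + hδ
      have h6 : β ^ 2 + α ^ 2 = 0 := by exact_mod_cast h5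
      exact hα (eq_zero_of_sq_add_sq h6).2

open Polynomial in
/-- An algebraic curve that has infinitely many points of the inverse of a nondegenerate conic
contains this inverse, and the origin as well unless the conic is a circle. -/
theorem inverse_conic_subset {D : QuadEq} (hD : D.det ≠ 0) {F : MvPolynomial (Fin 2) ℝ}
    (h : ({x : Plane | x ≠ 0 ∧ D.invPoly (x 0) (x 1) = 0} ∩ polyZeros F).Infinite) :
    {x : Plane | x ≠ 0 ∧ D.invPoly (x 0) (x 1) = 0} ⊆ polyZeros F ∧
      (¬ (D.a₁₁ = D.a₂₂ ∧ D.a₁₂ = 0) → (0 : Plane) ∈ polyZeros F) := by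
  obtain ⟨x₀, ⟨hx₀, hx₀D⟩, -⟩ := h.nonempty
  set u := EuclideanGeometry.inversion (0 : Plane) 1 x₀
  have hu : u ∈ D.zeros := (invPoly_inversion D hx₀).mpr hx₀D
  set E : Fin 2 → ℝ[X] := ![2 * X, 1 - X ^ 2]
  set Q : ℝ[X] := C D.a₁₁ * (2 * X) ^ 2 + 2 * C D.a₁₂ * ((2 * X) * (1 - X ^ 2))
    + C D.a₂₂ * (1 - X ^ 2) ^ 2 with hQ
  set G : ℝ[X] := 2 * (C (D.a₁₁ * u 0 + D.a₁₂ * u 1 + D.a₁) * (2 * X)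
    + C (D.a₁₂ * u 0 + D.a₂₂ * u 1 + D.a₂) * (1 - X ^ 2)) with hG
  set n : Fin 2 → ℝ[X] := fun i => Q * C (u i) - G * E i with hn
  have hcover : ∀ x ∈ {x : Plane | x ≠ 0 ∧ D.invPoly (x 0) (x 1) = 0}, ∃ s : ℝ,
      (n 0 ^ 2 + n 1 ^ 2).eval s ≠ 0 ∧
      ∀ i, x i = (n i * Q).eval s / (n 0 ^ 2 + n 1 ^ 2).eval s := by
    rintro x ⟨hx, hxD⟩
    set v := EuclideanGeometry.inversion (0 : Plane) 1 x with hvdef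
    have hv : v ∈ D.zeros := (invPoly_inversion D hx).mpr hxD
    obtain ⟨s, hs, hi⟩ := exists_chord hD hu hv
    have hQs : Q.eval s ≠ 0 := by simpa [hQ] using hs
    have hns : ∀ i, (n i).eval s = Q.eval s * v i := by
      intro i
      have := hi i
      fin_cases i
      · simpa [hn, hQ, hG, E] using this
      · simpa [hn, hQ, hG, E] using this
    have hr := (sq_add_sq_pos hx).ne'
    have hvi : ∀ i, v i = x i / (x 0 ^ 2 + x 1 ^ 2) := inversion_apply x
    have hN : (n 0 ^ 2 + n 1 ^ 2).eval s = Q.eval s ^ 2 / (x 0 ^ 2 + x 1 ^ 2) := by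
      simp only [eval_add, eval_pow, hns, hvi]
      field_simp
    refine ⟨s, ?_, fun i => ?_⟩
    · rw [hN]; positivity
    · rw [hN, eval_mul, hns, hvi]
      field_simp
  obtain ⟨hinf, hsub⟩ := ratCurve_subset_polyZeros hcover h
  refine ⟨hsub, fun hcirc => ?_⟩
  -- At a complex parameter `s` with `Q = 0` the chord points to infinity: there `n = -G E`, so `n ·
  -- n = G² (E · E)`. This is nonzero because the conic contains no line and the direction is not
  -- Euclidean-isotropic, so the inverse point `n Q / (n · n)` is the origin.
  obtain ⟨Z, W, hZW, hiso⟩ := exists_isotropic hcirc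
  obtain ⟨ρ, hρ⟩ : ∃ ρ : ℂ, ρ ^ 2 = Z ^ 2 + W ^ 2 := IsAlgClosed.exists_pow_nat_eq _ two_pos
  obtain ⟨s, l, hl, rfl, rfl⟩ := exists_direction hρ (by rintro rfl; exact hZW (by simp [← hρ]))
  have two : aeval s (2 : ℝ[X]) = 2 := map_ofNat _ 2
  have hQs : aeval s Q = 0 := by
    simp [hQ, two]
    apply mul_left_cancel₀ (pow_ne_zero 2 hl)
    linear_combination hiso
  have hE : (2 * s) ^ 2 + (1 - s ^ 2) ^ 2 ≠ 0 := by
    intro h0; apply hZW; linear_combination l ^ 2 * h0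
  have hGs : aeval s G ≠ 0 := by
    intro h0
    simp [hG, two] at h0
    rw [mem_zeros] at hu
    have hdet := det_mul_eq_zero_of_line (D.a₁₁ : ℂ) D.a₂₂ D.a₁₂ D.a₁ D.a₂ D.c (u 0) (u 1) (2 * s)
      (1 - s ^ 2) (by exact_mod_cast hu) h0 (by simpa [hQ, two] using hQs)
    rcases mul_eq_zero.mp hdet with h' | h'
    · apply hD; rw [QuadEq.det]; exact_mod_cast h'
    · exact hE (pow_eq_zero_iff two_ne_zero |>.mp h')
  have hN : aeval s (n 0 ^ 2 + n 1 ^ 2) ≠ 0 := by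
    have : aeval s (n 0 ^ 2 + n 1 ^ 2) = aeval s G ^ 2 * ((2 * s) ^ 2 + (1 - s ^ 2) ^ 2) := by
      simp [hn, hQs, E, two]; ring
    rw [this]
    exact mul_ne_zero (pow_ne_zero 2 hGs) hE
  have := aeval_ratCurve_eq_zero hinf ℂ s hN
  simp only [map_mul, hQs, mul_zero, zero_div] at this
  rw [mem_polyZeros]
  have hz : (fun _ : Fin 2 => (0 : ℂ)) = algebraMap ℝ ℂ ∘ fun _ => 0 := by ext; simp
  rw [hz, MvPolynomial.aeval_algebraMap_apply, Complex.coe_algebraMap,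
    Complex.ofReal_eq_zero] at this
  exact this

/-! ### The primitive of an arc -/

/-- By continuity the no-silhouette condition persists on a shorter arc, so the primitive can be
differentiated along it. -/
theorem exists_noSilhouette_arc {S : Set Plane} {x n : Plane} (h : (x, n) ∈ contactElements S)
    (hxn : inner ℝ x n ≠ 0) : ∃ (γ ν : ℝ → Plane) (t₀ δ : ℝ), 0 < δ ∧ γ t₀ = x ∧ ν t₀ = n ∧
      IsLegendrianOn γ ν (Set.Ioo (t₀ - δ) (t₀ + δ)) ∧ Set.InjOn γ (Set.Ioo (t₀ - δ) (t₀ + δ)) ∧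
      ∀ t ∈ Set.Ioo (t₀ - δ) (t₀ + δ), (γ t, ν t) ∈ contactElements S ∧
        inner ℝ (γ t) (ν t) ≠ 0 := by
  obtain ⟨γ, ν, t₀, ε, hε, hL, hinj, hmaps, hx, hn⟩ := h
  dsimp only at hx hn
  have hmem : t₀ ∈ Set.Ioo (t₀ - ε) (t₀ + ε) := by constructor <;> linarith
  have hcont : ContinuousAt (fun t => (inner ℝ (γ t) (ν t) : ℝ)) t₀ :=
    ContinuousAt.inner (𝕜 := ℝ) (hL.1.continuousOn.continuousAt (isOpen_Ioo.mem_nhds hmem))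
      (hL.2.1.continuousOn.continuousAt (isOpen_Ioo.mem_nhds hmem))
  have hev := hcont.eventually_ne (y := 0) (by rw [hx, hn]; exact hxn)
  obtain ⟨η, hη, hball⟩ := Metric.eventually_nhds_iff.mp hev
  have hsub : Set.Ioo (t₀ - min ε η) (t₀ + min ε η) ⊆ Set.Ioo (t₀ - ε) (t₀ + ε) := by
    apply Set.Ioo_subset_Ioo <;> linarith [min_le_left ε η]
  refine ⟨γ, ν, t₀, min ε η, lt_min hε hη, hx, hn,
    ⟨hL.1.mono hsub, hL.2.1.mono hsub, fun t ht => hL.2.2 t (hsub ht)⟩, hinj.mono hsub,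
    fun t ht => ⟨?_, ?_⟩⟩
  · have ht' := hsub ht
    have hsub' : Set.Ioo (t - min (t - (t₀ - ε)) (t₀ + ε - t))
        (t + min (t - (t₀ - ε)) (t₀ + ε - t)) ⊆ Set.Ioo (t₀ - ε) (t₀ + ε) := by
      apply Set.Ioo_subset_Ioo
      · linarith [min_le_left (t - (t₀ - ε)) (t₀ + ε - t)]
      · linarith [min_le_right (t - (t₀ - ε)) (t₀ + ε - t)]
    exact ⟨γ, ν, t, min (t - (t₀ - ε)) (t₀ + ε - t),
      lt_min (by linarith [ht'.1]) (by linarith [ht'.2]),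
      ⟨hL.1.mono hsub', hL.2.1.mono hsub', fun s hs => hL.2.2 s (hsub' hs)⟩, hinj.mono hsub',
      hmaps.mono hsub' subset_rfl, rfl, rfl⟩
  · apply hball
    rw [Real.dist_eq, abs_lt]
    constructor <;> linarith [ht.1, ht.2, min_le_right ε η]

theorem noSilhouettePart_subset (S : Set Plane) : noSilhouettePart S ⊆ S := by
  rintro x ⟨n, ⟨γ, ν, t₀, ε, hε, -, -, hmaps, hx, -⟩, -⟩
  rw [show x = γ t₀ from hx.symm]
  exact hmaps ⟨by linarith, by linarith⟩

theorem zero_notMem_noSilhouettePart (S : Set Plane) : (0 : Plane) ∉ noSilhouettePart S := by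
  rintro ⟨n, -, h⟩
  exact h (inner_zero_left n)

theorem noSilhouettePart_infinite {S : Set Plane} (h : (noSilhouettePart S).Nonempty) :
    (noSilhouettePart S).Infinite := by
  obtain ⟨x, n, hxn, h0⟩ := h
  obtain ⟨γ, ν, t₀, δ, hδ, -, -, -, hinj, hmem⟩ := exists_noSilhouette_arc hxn h0
  have := (Set.Ioo_infinite (show t₀ - δ < t₀ + δ by linarith)).image hinj
  refine this.mono ?_
  rintro _ ⟨t, ht, rfl⟩
  exact ⟨ν t, (hmem t ht).1, (hmem t ht).2⟩

/-- If a line through `y`, with normal vector `x` and foot `x`, is tangent to the conic `q`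
at `y`, then `x` lies on the pedal curve of the conic. -/
theorem invPoly_dual_of_tangent {q : QuadEq} (hq : q.det ≠ 0) {x₀ x₁ y₀ y₁ d₀ d₁ : ℝ}
    (hx : x₀ ^ 2 + x₁ ^ 2 ≠ 0) (hd : d₀ ^ 2 + d₁ ^ 2 ≠ 0)
    (hyx : y₀ * x₀ + y₁ * x₁ = x₀ ^ 2 + x₁ ^ 2) (hdx : d₀ * x₀ + d₁ * x₁ = 0)
    (hqy : q.a₁₁ * y₀ ^ 2 + q.a₂₂ * y₁ ^ 2 + 2 * q.a₁₂ * (y₀ * y₁) + 2 * q.a₁ * y₀ + 2 * q.a₂ * y₁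
      + q.c = 0)
    (hqd : (q.a₁₁ * y₀ + q.a₁₂ * y₁ + q.a₁) * d₀ + (q.a₁₂ * y₀ + q.a₂₂ * y₁ + q.a₂) * d₁ = 0) :
    q.dual.invPoly x₀ x₁ = 0 := by
  set g₀ := q.a₁₁ * y₀ + q.a₁₂ * y₁ + q.a₁ with hg₀
  set g₁ := q.a₁₂ * y₀ + q.a₂₂ * y₁ + q.a₂ with hg₁
  set g₂ := q.a₁ * y₀ + q.a₂ * y₁ + q.c with hg₂
  -- The vector `g = M (y, 1)` holds the coordinates of the tangent line at `y`. It equals `l (x,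
  -- -‖x‖²)`, and `l ≠ 0` because `M` is invertible.
  set l := (g₀ * x₀ + g₁ * x₁) / (x₀ ^ 2 + x₁ ^ 2) with hl
  have hcross : g₀ * x₁ - g₁ * x₀ = 0 := by
    apply mul_left_cancel₀ hd
    linear_combination (d₀ * x₁ - d₁ * x₀) * hqd + (g₀ * d₁ - g₁ * d₀) * hdx
  have h0 : g₀ = l * x₀ := by
    rw [hl]; field_simp; linear_combination x₁ * hcross
  have h1 : g₁ = l * x₁ := by
    rw [hl]; field_simp; linear_combination -x₀ * hcross
  have h2 : g₂ = -l * (x₀ ^ 2 + x₁ ^ 2) := by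
    have : g₀ * y₀ + g₁ * y₁ + g₂ = 0 := by rw [hg₀, hg₁, hg₂]; linear_combination hqy
    rw [h0, h1] at this
    linear_combination this - l * hyx
  have hl0 : l ≠ 0 := by
    intro hl0
    rw [hl0] at h0 h1 h2
    apply hq
    simp only [zero_mul, neg_zero] at h0 h1 h2
    rw [QuadEq.det]
    linear_combination (q.a₁₂ * q.a₂ - q.a₂₂ * q.a₁) * h0
      + (q.a₁₂ * q.a₁ - q.a₁₁ * q.a₂) * h1 + (q.a₁₁ * q.a₂₂ - q.a₁₂ ^ 2) * h2
  -- Up to sign the right side is `gᵀ adj(M) g = det M · (y, 1)ᵀ M (y, 1)`, which vanishes because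
  -- `y` lies on the conic.
  have key : l ^ 2 * q.dual.invPoly x₀ x₁ = q.dual.c * g₂ ^ 2 - 2 * q.dual.a₁ * g₂ * g₀
      - 2 * q.dual.a₂ * g₂ * g₁ + q.dual.a₁₁ * g₀ ^ 2 + 2 * q.dual.a₁₂ * (g₀ * g₁)
      + q.dual.a₂₂ * g₁ ^ 2 := by
    rw [h0, h1, h2, QuadEq.invPoly]; ring
  have : l ^ 2 * q.dual.invPoly x₀ x₁ = 0 := by
    rw [key, hg₀, hg₁, hg₂]
    simp only [QuadEq.dual]
    simp only [QuadEq.det] at *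
    linear_combination (-(q.a₁₁ * (q.a₂₂ * q.c - q.a₂ ^ 2) - q.a₁₂ * (q.a₁₂ * q.c - q.a₂ * q.a₁)
      + q.a₁ * (q.a₁₂ * q.a₂ - q.a₂₂ * q.a₁))) * hqy
  exact (mul_eq_zero.mp this).resolve_left (pow_ne_zero 2 hl0)

/-- The circle with diameter from the origin to `y`. -/
theorem sphere_half_eq (y : Plane) :
    Metric.sphere ((1 / 2 : ℝ) • y) (‖y‖ / 2) = {x : Plane | ‖x‖ ^ 2 = inner ℝ y x} := by
  ext x
  rw [mem_sphere_iff_norm, Set.mem_ofPred_eq]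
  have e : ‖x - (1 / 2 : ℝ) • y‖ ^ 2 = ‖x‖ ^ 2 - inner ℝ y x + (‖y‖ / 2) ^ 2 := by
    rw [norm_sub_sq_real, inner_smul_right, norm_smul, real_inner_comm]
    norm_num
    ring
  constructor
  · intro h; rw [h] at e; linarith
  · intro h
    rw [← abs_of_nonneg (norm_nonneg (x - (1 / 2 : ℝ) • y)),
      ← abs_of_nonneg (show 0 ≤ ‖y‖ / 2 by positivity), ← sq_eq_sq_iff_abs_eq_abs]
    linarith

/-- The tangency argument needs `y' ≠ 0`. If the pedal equation failed at a point it would fail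
nearby, forcing `y' = 0` on an interval; the arc would then run on a circle through the origin. -/
theorem invPoly_dual_of_noSilhouette {q : QuadEq} (hq : q.det ≠ 0) {F : MvPolynomial (Fin 2) ℝ}
    (hnocircle : ∀ (p : Plane) (r : ℝ), 0 < r → (0 : Plane) ∈ Metric.sphere p r →
      ¬ Metric.sphere p r ⊆ polyZeros F)
    (hprim : primitiveLocus (polyZeros F) ⊆ q.zeros) {x : Plane}
    (hx : x ∈ noSilhouettePart (polyZeros F)) : q.dual.invPoly (x 0) (x 1) = 0 := by
  obtain ⟨n, hxn, h0⟩ := hx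
  obtain ⟨γ, ν, t₀, δ, hδ, rfl, rfl, hL, hinj, hmem⟩ := exists_noSilhouette_arc hxn h0
  set I := Set.Ioo (t₀ - δ) (t₀ + δ)
  have hI : IsOpen I := isOpen_Ioo
  have ht₀ : t₀ ∈ I := by constructor <;> linarith
  set y : ℝ → Plane := fun t => (2 : ℝ) • γ t - (‖γ t‖ ^ 2 / inner ℝ (γ t) (ν t)) • ν t with hy
  have hγd : ∀ t ∈ I, DifferentiableAt ℝ γ t := fun t ht =>
    (hL.1.contDiffAt (hI.mem_nhds ht)).differentiableAt (by simp)
  have hνd : ∀ t ∈ I, DifferentiableAt ℝ ν t := fun t ht =>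
    (hL.2.1.contDiffAt (hI.mem_nhds ht)).differentiableAt (by simp)
  have hyd : ∀ t ∈ I, DifferentiableAt ℝ y t := by
    intro t ht
    have h1 := hγd t ht
    have h2 := hνd t ht
    exact (h1.const_smul (2 : ℝ)).sub (((h1.norm_sq ℝ).div (h1.inner ℝ h2) (hmem t ht).2).smul h2)
  have hγ0 : ∀ t ∈ I, γ t ≠ 0 := by
    intro t ht h
    apply (hmem t ht).2
    rw [h, inner_zero_left]
  have hyq : ∀ t ∈ I, y t ∈ q.zeros := fun t ht =>
    hprim ⟨γ t, ν t, (hmem t ht).1, (hmem t ht).2, rfl⟩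
  have hyγ : ∀ t ∈ I, inner ℝ (y t) (γ t) = ‖γ t‖ ^ 2 := by
    intro t ht
    have := (hmem t ht).2
    rw [hy]
    simp only [inner_sub_left, inner_smul_left, real_inner_self_eq_norm_sq, RCLike.conj_to_real,
      real_inner_comm (γ t) (ν t)]
    field_simp
    ring
  have hyγ' : ∀ t ∈ I, inner ℝ (y t) (deriv γ t) = 2 * inner ℝ (γ t) (deriv γ t) := by
    intro t ht
    rw [hy]
    simp only [inner_sub_left, inner_smul_left, RCLike.conj_to_real,
      real_inner_comm (deriv γ t) (ν t), (hL.2.2 t ht).2]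
    ring
  have hdγ : ∀ t ∈ I, inner ℝ (deriv y t) (γ t) = 0 := by
    intro t ht
    have e1 := (hyd t ht).hasDerivAt.inner ℝ (hγd t ht).hasDerivAt
    have e2 := (hγd t ht).hasDerivAt.norm_sq
    have e3 : (fun t => inner ℝ (y t) (γ t)) =ᶠ[nhds t] fun t => ‖γ t‖ ^ 2 := by
      filter_upwards [hI.mem_nhds ht] with s hs using hyγ s hs
    have e4 := e1.unique (e2.congr_of_eventuallyEq e3)
    rw [hyγ' t ht] at e4
    linarith
  have hcoord : ∀ t ∈ I, ∀ i, HasDerivAt (fun s => y s i) (deriv y t i) t := fun t ht i =>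
    (PiLp.hasFDerivAt_apply (𝕜 := ℝ) 2 (y t) i).comp_hasDerivAt t (hyd t ht).hasDerivAt
  have hqd : ∀ t ∈ I, (q.a₁₁ * y t 0 + q.a₁₂ * y t 1 + q.a₁) * deriv y t 0
      + (q.a₁₂ * y t 0 + q.a₂₂ * y t 1 + q.a₂) * deriv y t 1 = 0 := by
    intro t ht
    have c0 := hcoord t ht 0
    have c1 := hcoord t ht 1
    have e1 := ((((((c0.pow 2).const_mul q.a₁₁).add ((c1.pow 2).const_mul q.a₂₂)).add
      ((c0.mul c1).const_mul (2 * q.a₁₂))).add (c0.const_mul (2 * q.a₁))).add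
      (c1.const_mul (2 * q.a₂))).add_const q.c
    have e4 := e1.unique ((hasDerivAt_const t (0 : ℝ)).congr_of_eventuallyEq ?_)
    · norm_num at e4
      linear_combination e4 / 2
    · filter_upwards [hI.mem_nhds ht] with s hs
      simpa [mem_zeros] using hyq s hs
  have hreg : ∀ t ∈ I, deriv y t ≠ 0 → q.dual.invPoly (γ t 0) (γ t 1) = 0 := by
    intro t ht hne
    refine invPoly_dual_of_tangent hq (sq_add_sq_pos (hγ0 t ht)).ne' (sq_add_sq_pos hne).ne'
      ?_ ?_ (hyq t ht) (hqd t ht)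
    · rw [← inner_eq, ← norm_sq_eq]; exact hyγ t ht
    · rw [← inner_eq]; exact hdγ t ht
  by_contra hP
  have hcont : ContinuousAt (fun t => q.dual.invPoly (γ t 0) (γ t 1)) t₀ := by
    have hγc := (hγd t₀ ht₀).continuousAt
    have h0 : ContinuousAt (fun t => γ t 0) t₀ := by fun_prop
    have h1 : ContinuousAt (fun t => γ t 1) t₀ := by fun_prop
    simp only [QuadEq.invPoly]
    fun_prop
  obtain ⟨η, hη, hball⟩ := Metric.eventually_nhds_iff_ball.mp
    ((hcont.eventually_ne hP).and (hI.mem_nhds ht₀))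
  set J := Metric.ball t₀ η
  have hJI : J ⊆ I := fun t ht => (hball t ht).2
  have hdy : ∀ t ∈ J, deriv y t = 0 := by
    intro t ht
    by_contra hne
    exact (hball t ht).1 (hreg t (hJI ht) hne)
  have hconst : ∀ t ∈ J, y t = y t₀ := fun t ht =>
    Metric.isOpen_ball.is_const_of_deriv_eq_zero (convex_ball t₀ η).isPreconnected
      (fun s hs => (hyd s (hJI hs)).differentiableWithinAt) hdy ht (Metric.mem_ball_self hη)
  have hy0 : y t₀ ≠ 0 := by
    intro h
    have := hyγ t₀ ht₀
    rw [h, inner_zero_left] at this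
    exact hγ0 t₀ ht₀ (norm_eq_zero.mp (pow_eq_zero_iff two_ne_zero |>.mp this.symm))
  refine hnocircle ((1 / 2 : ℝ) • y t₀) (‖y t₀‖ / 2) (by positivity) ?_ ?_
  · rw [sphere_half_eq]; simp
  · rw [sphere_half_eq]
    apply circle_subset_polyZeros hy0
    -- Injectivity of the frontal arc is used here: it gives infinitely many points on the circle.
    have hJinf : J.Infinite := by
      rw [show J = Set.Ioo (t₀ - η) (t₀ + η) from Real.ball_eq_Ioo t₀ η]
      exact Set.Ioo_infinite (by linarith)
    refine (hJinf.image (hinj.mono hJI)).mono ?_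
    rintro _ ⟨t, ht, rfl⟩
    refine ⟨?_, noSilhouettePart_subset _ ⟨ν t, hmem t (hJI ht)⟩⟩
    rw [Set.mem_ofPred_eq, ← hyγ t (hJI ht), hconst t ht]

/-! ### The equation of the curve -/

/-- The inverse of a conic, as an algebraic curve. -/
def QuadEq.invZeros (D : QuadEq) : Set Plane := {x | D.invPoly (x 0) (x 1) = 0}

theorem mem_invZeros {D : QuadEq} {x : Plane} :
    x ∈ D.invZeros ↔ D.invPoly (x 0) (x 1) = 0 := Iff.rfl

theorem zero_mem_invZeros (D : QuadEq) : (0 : Plane) ∈ D.invZeros := by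
  simp [mem_invZeros, QuadEq.invPoly]

theorem isClosed_invZeros (D : QuadEq) : IsClosed D.invZeros := by
  apply isClosed_eq
  · simp only [QuadEq.invPoly]; fun_prop
  · exact continuous_const

theorem isClosed_zeros (D : QuadEq) : IsClosed D.zeros := by
  apply isClosed_eq
  · fun_prop
  · exact continuous_const

/-- The inverse of a circle, without the origin, is a line or a circle. -/
theorem isLine_or_sphere_of_circle {D : QuadEq} (hD : D.det ≠ 0) (h1 : D.a₁₁ = D.a₂₂)
    (h2 : D.a₁₂ = 0) (hinf : (D.invZeros \ {0}).Infinite) :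
    IsLine (D.invZeros \ {0}) ∨
      ∃ (p : Plane) (r : ℝ), 0 < r ∧ D.invZeros \ {0} = Metric.sphere p r := by
  have h0 : D.a₁₁ ≠ 0 := by
    rcases D.quad_ne_zero_of_det hD with h | h | h
    · exact h
    · rwa [h1]
    · exact absurd h2 h
  have heq : D.invZeros \ {0} = {x : Plane | D.c * (x 0 ^ 2 + x 1 ^ 2) + 2 * D.a₁ * x 0
      + 2 * D.a₂ * x 1 + D.a₁₁ = 0} := by
    ext x
    rw [Set.mem_sdiff, mem_invZeros, Set.mem_singleton_iff, Set.mem_ofPred_eq]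
    have e : D.invPoly (x 0) (x 1) = (x 0 ^ 2 + x 1 ^ 2) * (D.c * (x 0 ^ 2 + x 1 ^ 2)
        + 2 * D.a₁ * x 0 + 2 * D.a₂ * x 1 + D.a₁₁) := by
      rw [QuadEq.invPoly, ← h1, h2]; ring
    rw [e]
    constructor
    · rintro ⟨h, hx⟩
      exact (mul_eq_zero.mp h).resolve_left (sq_add_sq_pos hx).ne'
    · intro h
      refine ⟨by rw [h, mul_zero], ?_⟩
      rintro rfl
      apply h0
      simpa using h
  by_cases hc : D.c = 0
  · left
    rw [heq]
    refine ⟨2 * D.a₁, 2 * D.a₂, D.a₁₁, ?_, by ext x; simp [hc]⟩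
    by_contra hne
    push Not at hne
    have e1 : D.a₁ = 0 := by linarith [hne.1]
    have e2 : D.a₂ = 0 := by linarith [hne.2]
    apply hD
    simp [QuadEq.det, hc, e1, e2]
  · right
    set R := (D.a₁ ^ 2 + D.a₂ ^ 2 - D.c * D.a₁₁) / D.c ^ 2 with hR
    have heq2 : D.invZeros \ {0} =
        {x : Plane | (x 0 + D.a₁ / D.c) ^ 2 + (x 1 + D.a₂ / D.c) ^ 2 = R} := by
      rw [heq]
      ext x
      rw [Set.mem_ofPred_eq, Set.mem_ofPred_eq, hR]
      field_simp
      constructor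
      · intro h; linear_combination D.c * h
      · intro h; apply mul_left_cancel₀ hc; linear_combination h
    have hRpos : 0 < R := by
      by_contra hneg
      apply hinf
      rw [heq2]
      apply Set.Subsingleton.finite
      intro x hx y hy
      have key : ∀ z : Plane, (z 0 + D.a₁ / D.c) ^ 2 + (z 1 + D.a₂ / D.c) ^ 2 = R →
          z 0 = -(D.a₁ / D.c) ∧ z 1 = -(D.a₂ / D.c) := by
        intro z hz
        have hz' : (z 0 + D.a₁ / D.c) ^ 2 + (z 1 + D.a₂ / D.c) ^ 2 = 0 :=
          le_antisymm (by linarith) (by positivity)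
        obtain ⟨e0, e1⟩ := eq_zero_of_sq_add_sq hz'
        constructor <;> linarith
      exact plane_ext ((key x hx).1.trans (key y hy).1.symm) ((key x hx).2.trans (key y hy).2.symm)
    refine ⟨!₂[-(D.a₁ / D.c), -(D.a₂ / D.c)], √R, Real.sqrt_pos.mpr hRpos, ?_⟩
    rw [heq2]
    ext x
    rw [mem_sphere_iff_norm, Set.mem_ofPred_eq, eq_comm (b := √R), eq_comm (b := R),
      Real.sqrt_eq_iff_eq_sq hRpos.le (norm_nonneg _), norm_sq_eq]
    simp [sub_neg_eq_add]

/-- Away from the origin, the two inclusions come from the tangency argument with density and from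
the rational parametrization. Membership of the origin is a separate matter, since the real zero set
of a polynomial could leave out an isolated point of the inverse conic. -/
theorem curve_eq_invZeros {Γ : Set Plane} {q : QuadEq}
    (hΓ : IsAlgebraicCurve Γ)
    (hdense : Γ \ {0} ⊆ closure (noSilhouettePart Γ))
    (hnocircle : ∀ (p : Plane) (r : ℝ), 0 < r → (0 : Plane) ∈ Metric.sphere p r →
      ¬ Metric.sphere p r ⊆ Γ)
    (hline : ¬ IsLine Γ)
    (hcircle : ∀ (p : Plane) (r : ℝ), 0 < r → Γ ≠ Metric.sphere p r)
    (hC : IsIrreducibleQuadraticCurve q.zeros)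
    (hprim : closure (primitiveLocus Γ) = q.zeros) :
    Γ = q.dual.invZeros ∧ (Γ \ {0}).Infinite := by
  have hq := det_ne_zero_of_irreducible hC
  have hD : q.dual.det ≠ 0 := by
    rw [QuadEq.det_dual]; exact neg_ne_zero.mpr (pow_ne_zero 2 hq)
  obtain ⟨F, -, rfl⟩ := hΓ
  have hns : noSilhouettePart (polyZeros F) ⊆ q.dual.invZeros := fun x hx =>
    invPoly_dual_of_noSilhouette hq hnocircle (subset_closure.trans_eq hprim) hx
  have hsub : polyZeros F \ {0} ⊆ q.dual.invZeros :=
    hdense.trans (closure_minimal hns (isClosed_invZeros _))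
  have hnsne : (noSilhouettePart (polyZeros F)).Nonempty := by
    have : (primitiveLocus (polyZeros F)).Nonempty := by
      rw [← closure_nonempty_iff, hprim]; exact hC.2.1.nonempty
    obtain ⟨y, x, n, hxn, h0, -⟩ := this
    exact ⟨x, n, hxn, h0⟩
  have hnsinf := noSilhouettePart_infinite hnsne
  have hns0 : ∀ x ∈ noSilhouettePart (polyZeros F), x ≠ 0 := fun x hx h =>
    zero_notMem_noSilhouettePart _ (h ▸ hx)
  have hinf : (polyZeros F \ {0}).Infinite :=
    hnsinf.mono fun x hx => ⟨noSilhouettePart_subset _ hx, hns0 x hx⟩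
  obtain ⟨h1, h2⟩ := inverse_conic_subset hD (F := F) (hnsinf.mono fun x hx =>
    ⟨⟨hns0 x hx, hns hx⟩, noSilhouettePart_subset _ hx⟩)
  refine ⟨?_, hinf⟩
  have hpunct : polyZeros F \ {0} = q.dual.invZeros \ {0} := by
    apply Set.Subset.antisymm
    · exact fun x hx => ⟨hsub hx, hx.2⟩
    · exact fun x hx => ⟨h1 ⟨hx.2, hx.1⟩, hx.2⟩
  have h0 : (0 : Plane) ∈ polyZeros F := by
    -- When the dual is a circle, only the hypotheses that `Γ` is neither a line nor a circle force
    -- the origin into `Γ`.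
    by_cases hc : q.dual.a₁₁ = q.dual.a₂₂ ∧ q.dual.a₁₂ = 0
    · by_contra h0
      have e : polyZeros F \ {0} = polyZeros F := by simp [h0]
      rw [e] at hpunct
      rw [e, hpunct] at hinf
      rcases isLine_or_sphere_of_circle hD hc.1 hc.2 hinf with h | ⟨p, r, hr, h⟩
      · exact hline (hpunct ▸ h)
      · exact hcircle p r hr (hpunct.trans h)
    · exact h2 hc
  ext x
  by_cases hx : x = 0
  · simp [hx, h0, zero_mem_invZeros]
  · have := Set.ext_iff.mp hpunct x
    simpa [hx] using this

/-! ### The inversion of the curve -/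

theorem puncturedInversion_invZeros (D : QuadEq) :
    puncturedInversion D.invZeros = D.zeros \ {0} := by
  ext x
  constructor
  · rintro ⟨y, ⟨hy, hy0⟩, rfl⟩
    exact ⟨(invPoly_inversion D hy0).mpr hy, inversion_ne_zero hy0⟩
  · rintro ⟨hx, hx0⟩
    refine ⟨EuclideanGeometry.inversion 0 1 x, ⟨?_, inversion_ne_zero hx0⟩,
      EuclideanGeometry.inversion_inversion _ one_ne_zero x⟩
    rw [mem_invZeros, ← invPoly_inversion D (inversion_ne_zero hx0),
      EuclideanGeometry.inversion_inversion _ one_ne_zero x]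
    exact hx

/-- The tangent direction of a conic at the origin is not an asymptotic direction. -/
theorem QuadEq.quad_tangent_ne_zero {D : QuadEq} (hD : D.det ≠ 0) (hc : D.c = 0) :
    D.a₁ ^ 2 + D.a₂ ^ 2 ≠ 0 ∧
      D.a₁₁ * D.a₂ ^ 2 - 2 * D.a₁₂ * (D.a₁ * D.a₂) + D.a₂₂ * D.a₁ ^ 2 ≠ 0 := by
  have key : D.det = -(D.a₁₁ * D.a₂ ^ 2 - 2 * D.a₁₂ * (D.a₁ * D.a₂) + D.a₂₂ * D.a₁ ^ 2) := by
    rw [QuadEq.det, hc]; ring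
  constructor
  · intro h
    obtain ⟨h1, h2⟩ := eq_zero_of_sq_add_sq h
    apply hD; rw [key, h1, h2]; ring
  · intro h
    apply hD; rw [key, h, neg_zero]

/-- If the origin lies on the conic, it is the limit of the second intersections with lines through
it whose directions tend to the tangent. -/
theorem closure_zeros_diff {D : QuadEq} (hD : D.det ≠ 0) : closure (D.zeros \ {0}) = D.zeros := by
  apply Set.Subset.antisymm
  · exact closure_minimal Set.sdiff_subset (isClosed_zeros D)
  · intro x hx
    by_cases hx0 : x = 0
    · subst hx0
      have hc : D.c = 0 := by simpa [mem_zeros] using hx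
      obtain ⟨hl, hA⟩ := QuadEq.quad_tangent_ne_zero hD hc
      -- `Q t` is the quadratic part on the direction tangent plus `t` times normal. The line in
      -- this direction meets the conic again at the multiple `s t` of the direction vector.
      set Q : ℝ → ℝ := fun t => D.a₁₁ * (-D.a₂ + t * D.a₁) ^ 2
        + 2 * D.a₁₂ * ((-D.a₂ + t * D.a₁) * (D.a₁ + t * D.a₂)) + D.a₂₂ * (D.a₁ + t * D.a₂) ^ 2
        with hQ
      set s : ℝ → ℝ := fun t => -2 * t * (D.a₁ ^ 2 + D.a₂ ^ 2) / Q t with hs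
      have hQc : Continuous Q := by simp only [hQ]; fun_prop
      have hQ0 : Q 0 ≠ 0 := by
        intro h; apply hA; simp only [hQ] at h; linear_combination h
      have hsc : ContinuousAt s 0 := by
        apply ContinuousAt.div (by fun_prop) hQc.continuousAt hQ0
      set f : ℝ → Plane := fun t => s t • !₂[-D.a₂ + t * D.a₁, D.a₁ + t * D.a₂] with hf
      have hfc : Filter.Tendsto f (nhdsWithin 0 {0}ᶜ) (nhds 0) := by
        have : ContinuousAt f 0 := by
          apply ContinuousAt.smul hsc
          fun_prop
        have h0 : f 0 = 0 := by simp [hf, hs]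
        rw [ContinuousAt, h0] at this
        exact this.mono_left nhdsWithin_le_nhds
      apply mem_closure_of_tendsto hfc
      have hev : ∀ᶠ t in nhdsWithin (0 : ℝ) {0}ᶜ, Q t ≠ 0 :=
        (hQc.continuousAt.eventually_ne hQ0).filter_mono nhdsWithin_le_nhds
      filter_upwards [hev, self_mem_nhdsWithin] with t hQt ht
      have ht0 : t ≠ 0 := ht
      have hst : s t * Q t = -2 * t * (D.a₁ ^ 2 + D.a₂ ^ 2) := by
        simp only [hs]; field_simp
      refine ⟨?_, ?_⟩
      · rw [mem_zeros]
        simp [hf, hc]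
        simp only [hQ] at hst
        linear_combination s t * hst
      · intro h0
        have hst0 : s t ≠ 0 := by
          simp only [hs]
          positivity
        have c0 := congrArg (fun v : Plane => v 0) h0
        have c1 := congrArg (fun v : Plane => v 1) h0
        simp [hf, hst0] at c0 c1
        apply hl
        have : (1 + t ^ 2) * (D.a₁ ^ 2 + D.a₂ ^ 2) = 0 := by
          linear_combination (-D.a₂ + t * D.a₁) * c0 + (D.a₁ + t * D.a₂) * c1
        exact (mul_eq_zero.mp this).resolve_left (by positivity)
    · exact subset_closure ⟨hx, hx0⟩

theorem curveInversion_invZeros {D : QuadEq} (hD : D.det ≠ 0) :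
    curveInversion D.invZeros = D.zeros := by
  rw [curveInversion, puncturedInversion_invZeros, closure_zeros_diff hD]

/-! ### The degree of the curve -/

open Polynomial in
theorem quartic_coeff_eq_zero {a b c d e : ℝ}
    (h : {t : ℝ | a + b * t + c * t ^ 2 + d * t ^ 3 + e * t ^ 4 = 0}.Infinite) :
    a = 0 ∧ b = 0 ∧ c = 0 ∧ d = 0 ∧ e = 0 := by
  have h0 : (C a + C b * X + C c * X ^ 2 + C d * X ^ 3 + C e * X ^ 4 : ℝ[X]) = 0 := by
    apply Polynomial.eq_zero_of_infinite_isRoot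
    refine h.mono fun t ht => ?_
    simpa using ht
  have k := fun n => congrArg (fun p : ℝ[X] => p.coeff n) h0
  have k0 := k 0
  have k1 := k 1
  have k2 := k 2
  have k3 := k 3
  have k4 := k 4
  simp [coeff_X, coeff_C] at k0 k1 k2 k3 k4
  exact ⟨k0, k1, k2, k3, k4⟩

theorem finite_line_inter {D : QuadEq} (hD : D.det ≠ 0) {a b : ℝ} (c : ℝ) (hab : a ≠ 0 ∨ b ≠ 0) :
    {x : Plane | x ∈ D.zeros ∧ a * x 0 + b * x 1 + c = 0}.Finite := by
  have hs : a ^ 2 + b ^ 2 ≠ 0 := by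
    intro hs
    obtain ⟨h0, h1⟩ := eq_zero_of_sq_add_sq hs
    simp [h0, h1] at hab
  set p₀ := -a * c / (a ^ 2 + b ^ 2) with hp₀
  set p₁ := -b * c / (a ^ 2 + b ^ 2) with hp₁
  by_contra hinf
  have hT : {t : ℝ | (!₂[p₀ + t * b, p₁ + t * -a] : Plane) ∈ D.zeros}.Infinite := by
    refine Set.Infinite.of_image (fun t : ℝ => (!₂[p₀ + t * b, p₁ + t * -a] : Plane))
      (Set.Infinite.mono ?_ hinf)
    rintro x ⟨hx, hl⟩
    have e : (!₂[p₀ + (b * x 0 - a * x 1) / (a ^ 2 + b ^ 2) * b,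
        p₁ + (b * x 0 - a * x 1) / (a ^ 2 + b ^ 2) * -a] : Plane) = x := by
      apply plane_ext
      · simp [hp₀]; field_simp; linear_combination -a * hl
      · simp [hp₁]; field_simp; linear_combination -b * hl
    exact ⟨_, by rw [Set.mem_ofPred_eq, e]; exact hx, e⟩
  obtain ⟨k0, k1, k2, -, -⟩ := quartic_coeff_eq_zero
    (a := D.a₁₁ * p₀ ^ 2 + D.a₂₂ * p₁ ^ 2 + 2 * D.a₁₂ * (p₀ * p₁) + 2 * D.a₁ * p₀ + 2 * D.a₂ * p₁
      + D.c)
    (b := 2 * ((D.a₁₁ * p₀ + D.a₁₂ * p₁ + D.a₁) * b + (D.a₁₂ * p₀ + D.a₂₂ * p₁ + D.a₂) * -a))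
    (c := D.a₁₁ * b ^ 2 + 2 * D.a₁₂ * (b * -a) + D.a₂₂ * (-a) ^ 2) (d := 0) (e := 0) (hT.mono
    (by
      intro t ht
      simp [mem_zeros] at ht
      rw [Set.mem_ofPred_eq]
      linear_combination ht))
  rcases mul_eq_zero.mp (det_mul_eq_zero_of_line _ _ _ _ _ _ _ _ _ _ k0
    ((mul_eq_zero.mp k1).resolve_left two_ne_zero) k2) with h | h
  · exact hD h
  · apply hs
    have := pow_eq_zero_iff (two_ne_zero) |>.mp h
    linear_combination this

theorem exists_coeff_of_totalDegree_le_two {G : MvPolynomial (Fin 2) ℝ} (h : G.totalDegree ≤ 2) :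
    ∃ a b c d e f : ℝ, ∀ x : Fin 2 → ℝ, MvPolynomial.eval x G =
      a * x 0 ^ 2 + b * (x 0 * x 1) + c * x 1 ^ 2 + d * x 0 + e * x 1 + f := by
  have key : ∃ a b c d e f : ℝ,
      (∑ m ∈ G.support, fun x : Fin 2 → ℝ => G.coeff m * ∏ i, x i ^ m i) =
      fun x => a * x 0 ^ 2 + b * (x 0 * x 1) + c * x 1 ^ 2 + d * x 0 + e * x 1 + f := by
    apply Finset.sum_induction _ (fun g : (Fin 2 → ℝ) → ℝ => ∃ a b c d e f : ℝ,
      g = fun x => a * x 0 ^ 2 + b * (x 0 * x 1) + c * x 1 ^ 2 + d * x 0 + e * x 1 + f)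
    · rintro _ _ ⟨a, b, c, d, e, f, rfl⟩ ⟨a', b', c', d', e', f', rfl⟩
      exact ⟨a + a', b + b', c + c', d + d', e + e', f + f', by ext x; simp only [Pi.add_apply]; ring⟩
    · exact ⟨0, 0, 0, 0, 0, 0, by ext x; simp⟩
    · intro m hm
      have hdeg := (MvPolynomial.le_totalDegree hm).trans h
      rw [Finsupp.sum_fintype _ _ (fun _ => rfl), Fin.sum_univ_two] at hdeg
      simp only [Fin.prod_univ_two]
      generalize G.coeff m = k
      have h0 : m 0 ≤ 2 := by omega
      generalize m 0 = i at *
      generalize m 1 = j at *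
      interval_cases i
      · have h1 : j ≤ 2 := by omega
        interval_cases j
        · exact ⟨0, 0, 0, 0, 0, k, by ext x; ring⟩
        · exact ⟨0, 0, 0, 0, k, 0, by ext x; ring⟩
        · exact ⟨0, 0, k, 0, 0, 0, by ext x; ring⟩
      · have h1 : j ≤ 1 := by omega
        interval_cases j
        · exact ⟨0, 0, 0, k, 0, 0, by ext x; ring⟩
        · exact ⟨0, k, 0, 0, 0, 0, by ext x; ring⟩
      · have h1 : j = 0 := by omega
        subst h1
        exact ⟨k, 0, 0, 0, 0, 0, by ext x; ring⟩
  obtain ⟨a, b, c, d, e, f, hk⟩ := key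
  refine ⟨a, b, c, d, e, f, fun x => ?_⟩
  rw [MvPolynomial.eval_eq']
  have := congrFun hk x
  rwa [Finset.sum_apply] at this

/-- The inverse of a nondegenerate conic is not the zero set of a quadratic polynomial. -/
theorem coeff_eq_zero_of_invZeros_eq {D : QuadEq} (hD : D.det ≠ 0) (hinf : D.zeros.Infinite)
    {a b c d e f : ℝ} (h : D.invZeros = {x : Plane | a * x 0 ^ 2 + b * (x 0 * x 1) + c * x 1 ^ 2
      + d * x 0 + e * x 1 + f = 0}) :
    a = 0 ∧ b = 0 ∧ c = 0 ∧ d = 0 ∧ e = 0 ∧ f = 0 := by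
  have hiff : ∀ x y : ℝ, D.invPoly x y = 0 ↔
      a * x ^ 2 + b * (x * y) + c * y ^ 2 + d * x + e * y + f = 0 := by
    intro x y
    have := Set.ext_iff.mp h !₂[x, y]
    simpa [mem_invZeros] using this
  have hf : f = 0 := by
    have := (hiff 0 0).mp (by simp [QuadEq.invPoly])
    simpa using this
  subst hf
  -- The quadratic polynomial pulled back by inversion: on the conic, the quadratic form plus `‖x‖²`
  -- times the linear form vanishes.
  have hon : ∀ x ∈ D.zeros, a * x 0 ^ 2 + b * (x 0 * x 1) + c * x 1 ^ 2
      + (x 0 ^ 2 + x 1 ^ 2) * (d * x 0 + e * x 1) = 0 := by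
    intro x hx
    by_cases hx0 : x = 0
    · simp [hx0]
    · have hr := (sq_add_sq_pos hx0).ne'
      have hinv := (invPoly_inversion D (inversion_ne_zero hx0)).mp (by
        rw [EuclideanGeometry.inversion_inversion _ one_ne_zero x]; exact hx)
      rw [hiff, inversion_apply, inversion_apply] at hinv
      field_simp at hinv
      linear_combination hinv
  -- A line through the origin is its own inverse, so it would lie on `D` as well. The values at
  -- `1`, `-1`, `2` suffice to separate the three homogeneous parts.
  have hcone : ¬ ∃ u v : ℝ, u ^ 2 + v ^ 2 ≠ 0 ∧ ∀ t : ℝ, t ≠ 0 → D.invPoly (t * u) (t * v) = 0 := by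
    rintro ⟨u, v, huv, ht⟩
    have p1 := ht 1 one_ne_zero
    have p2 := ht (-1) (by norm_num)
    have p3 := ht 2 two_ne_zero
    simp only [QuadEq.invPoly] at p1 p2 p3
    have q2 : D.c = 0 := by
      apply mul_left_cancel₀ (pow_ne_zero 2 huv)
      apply mul_left_cancel₀ (show (12 : ℝ) ≠ 0 by norm_num)
      linear_combination p3 - 8 * p1 + 2 * (p1 + p2)
    have q1 : D.a₁ * u + D.a₂ * v = 0 := by
      apply mul_left_cancel₀ huv
      linear_combination (p1 - p2) / 4
    have q0 : D.a₁₁ * u ^ 2 + 2 * D.a₁₂ * (u * v) + D.a₂₂ * v ^ 2 = 0 := by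
      rw [q2] at p1 p2
      linear_combination (p1 + p2) / 2
    rcases mul_eq_zero.mp (det_mul_eq_zero_of_line D.a₁₁ D.a₂₂ D.a₁₂ D.a₁ D.a₂ D.c 0 0 u v
      (by rw [q2]; ring) (by linear_combination q1) q0) with h | h
    · exact hD h
    · exact huv (pow_eq_zero_iff two_ne_zero |>.mp h)
  -- Without a linear part, the zero set of a nonzero quadratic form is a cone, so any point of it
  -- other than the origin yields a forbidden line.
  suffices hlin : d = 0 ∧ e = 0 by
    obtain ⟨rfl, rfl⟩ := hlin
    by_contra hne
    obtain ⟨x, hx⟩ := (hinf.sdiff (Set.finite_singleton (0 : Plane))).nonempty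
    have hr := sq_add_sq_pos hx.2
    refine hcone ⟨x 0, x 1, hr.ne', fun t _ => ?_⟩
    rw [hiff]
    linear_combination t ^ 2 * hon x hx.1
  -- If `D` passes through the origin, the lines through it, of direction tangent plus `t` times
  -- normal, parametrize `D` rationally. The relation `hon` becomes a quartic identity in `t`.
  by_cases hc : D.c = 0
  · obtain ⟨hl, hA⟩ := QuadEq.quad_tangent_ne_zero hD hc
    set l₀ := D.a₁ with hl₀
    set l₁ := D.a₂ with hl₁
    set A := D.a₁₁ * l₁ ^ 2 - 2 * D.a₁₂ * (l₀ * l₁) + D.a₂₂ * l₀ ^ 2 with hAdef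
    set B := -2 * D.a₁₁ * (l₀ * l₁) + 2 * D.a₁₂ * (l₀ ^ 2 - l₁ ^ 2) + 2 * D.a₂₂ * (l₀ * l₁) with hB
    set E := D.a₁₁ * l₀ ^ 2 + 2 * D.a₁₂ * (l₀ * l₁) + D.a₂₂ * l₁ ^ 2 with hE
    set M := 2 * (l₀ ^ 2 + l₁ ^ 2) ^ 2 with hM
    have hM0 : M ≠ 0 := by positivity
    set G₀ := a * l₁ ^ 2 - b * (l₀ * l₁) + c * l₀ ^ 2 with hG₀
    set G₁ := -2 * a * (l₀ * l₁) + b * (l₀ ^ 2 - l₁ ^ 2) + 2 * c * (l₀ * l₁) with hG₁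
    set G₂ := a * l₀ ^ 2 + b * (l₀ * l₁) + c * l₁ ^ 2 with hG₂
    set H₀ := -d * l₁ + e * l₀ with hH₀
    set H₁ := d * l₀ + e * l₁ with hH₁
    have hquart : {t : ℝ | G₀ * A + (G₀ * B + G₁ * A - M * H₀) * t
        + (G₀ * E + G₁ * B + G₂ * A - M * H₁) * t ^ 2
        + (G₁ * E + G₂ * B - M * H₀) * t ^ 3 + (G₂ * E - M * H₁) * t ^ 4 = 0}.Infinite := by
      have hfin : {t : ℝ | A * t + B * t ^ 2 + E * t ^ 3 = 0}.Finite := by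
        by_contra hi
        refine hA (quartic_coeff_eq_zero (a := 0) (b := A) (c := B) (d := E) (e := 0)
          (Set.Infinite.mono (fun t ht => ?_) hi)).2.1
        rw [Set.mem_ofPred_eq] at ht ⊢
        linear_combination ht
      refine hfin.infinite_compl.mono fun t ht => ?_
      rw [Set.mem_compl_iff, Set.mem_ofPred_eq] at ht
      have hQ : A + B * t + E * t ^ 2 ≠ 0 := fun h => ht (by linear_combination t * h)
      have ht0 : t ≠ 0 := by rintro rfl; simp at ht
      set s := -2 * t * (l₀ ^ 2 + l₁ ^ 2) / (A + B * t + E * t ^ 2) with hs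
      have hs0 : s ≠ 0 := by rw [hs]; positivity
      have hsQ : s * (A + B * t + E * t ^ 2) = -2 * t * (l₀ ^ 2 + l₁ ^ 2) := by
        rw [hs, div_mul_cancel₀ _ hQ]
      have hmem : (!₂[s * (-l₁ + t * l₀), s * (l₀ + t * l₁)] : Plane) ∈ D.zeros := by
        rw [mem_zeros]
        simp [hc, ← hl₀, ← hl₁]
        rw [hAdef, hB, hE] at hsQ
        linear_combination s * hsQ
      have := hon _ hmem
      simp at this
      have h2 : G₀ + G₁ * t + G₂ * t ^ 2
          + s * (l₀ ^ 2 + l₁ ^ 2) * (1 + t ^ 2) * (H₀ + H₁ * t) = 0 := by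
        apply mul_left_cancel₀ (pow_ne_zero 2 hs0)
        rw [hG₀, hG₁, hG₂, hH₀, hH₁]
        linear_combination this
      rw [Set.mem_ofPred_eq, hM]
      linear_combination (A + B * t + E * t ^ 2) * h2
        - (l₀ ^ 2 + l₁ ^ 2) * (1 + t ^ 2) * (H₀ + H₁ * t) * hsQ
    obtain ⟨c0, c1, c2, c3, c4⟩ := quartic_coeff_eq_zero hquart
    have hG0 : G₀ = 0 := (mul_eq_zero.mp c0).resolve_right hA
    rw [hG0] at c1 c2
    by_cases hG : G₁ ^ 2 + G₂ ^ 2 = 0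
    · obtain ⟨g1, g2⟩ := eq_zero_of_sq_add_sq hG
      have hh0 : H₀ = 0 := by
        apply mul_left_cancel₀ hM0; rw [g1] at c1; linear_combination -c1
      have hh1 : H₁ = 0 := by
        apply mul_left_cancel₀ hM0; rw [g2] at c4; linear_combination -c4
      rw [hH₀] at hh0
      rw [hH₁] at hh1
      constructor
      · apply mul_left_cancel₀ hl; linear_combination l₀ * hh1 - l₁ * hh0
      · apply mul_left_cancel₀ hl; linear_combination l₁ * hh1 + l₀ * hh0
    -- Comparing coefficients leaves only `A = E` and `B = 0`, that is, a circle `D` through the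
    -- origin. Its punctured inverse is a line, and the quadratic polynomial would vanish on a
    -- parallel line through the origin as well; the direction is read off from `G₁` and `G₂`.
    · exfalso
      have hAE : A = E := by
        apply mul_left_cancel₀ hG
        linear_combination G₁ * (c1 - c3) + G₂ * (c2 - c4)
      have hB0 : B = 0 := by
        apply mul_left_cancel₀ hG
        rw [← hAE] at c3 c4
        linear_combination G₁ * (c2 - c4) + G₂ * (c3 - c1)
      refine hcone ⟨-G₂ * l₁ - G₁ * l₀, G₂ * l₀ - G₁ * l₁, ?_, fun t _ => ?_⟩
      · have : (-G₂ * l₁ - G₁ * l₀) ^ 2 + (G₂ * l₀ - G₁ * l₁) ^ 2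
          = (G₁ ^ 2 + G₂ ^ 2) * (l₀ ^ 2 + l₁ ^ 2) := by ring
        rw [this]; exact mul_ne_zero hG hl
      · rw [hiff]
        have e1 : G₂ * H₀ - G₁ * H₁ = 0 := by
          apply mul_left_cancel₀ hM0
          rw [← hAE] at c4
          linear_combination G₁ * c4 - G₂ * c1
        have e3 : ∀ x y : ℝ, a * (-x * l₁ - y * l₀) ^ 2
            + b * ((-x * l₁ - y * l₀) * (x * l₀ - y * l₁)) + c * (x * l₀ - y * l₁) ^ 2
            = x ^ 2 * G₀ - x * y * G₁ + y ^ 2 * G₂ := by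
          intro x y
          rw [hG₀, hG₁, hG₂]; ring
        have e2 := e3 G₂ G₁
        rw [hG0] at e2
        rw [hH₀, hH₁] at e1
        linear_combination t ^ 2 * e2 + t * e1
  · by_contra hne
    have hde : d ≠ 0 ∨ e ≠ 0 := by
      by_contra hc; push Not at hc; exact hne hc
    apply hinf
    -- If `D` misses the origin, the line through `0` and `x` meets `D` again at `σ x` with `σ = c /
    -- Q`. Subtracting `hon` at the two points gives `σ² (σ - 1) ‖x‖² (d x₀ + e x₁) = 0`. The finite
    -- sets cover the exceptions: a vanishing linear form, an asymptotic direction (`Q = 0`), and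
    -- tangency (`σ = 1`).
    have f1 := finite_line_inter hD 0 hde
    have f2 : {x : Plane | x ∈ D.zeros ∧ 2 * (D.a₁ * x 0 + D.a₂ * x 1) + D.c = 0}.Finite := by
      by_cases hl : D.a₁ ≠ 0 ∨ D.a₂ ≠ 0
      · refine (finite_line_inter hD (a := 2 * D.a₁) (b := 2 * D.a₂) D.c (by simpa using hl)).subset
          fun x hx => ⟨hx.1, by linear_combination hx.2⟩
      · push Not at hl
        simp [hl.1, hl.2, hc]
    have f3 : {x : Plane | x ∈ D.zeros ∧ (D.a₁ * x 0 + D.a₂ * x 1) + D.c = 0}.Finite := by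
      by_cases hl : D.a₁ ≠ 0 ∨ D.a₂ ≠ 0
      · exact finite_line_inter hD D.c hl
      · push Not at hl
        simp [hl.1, hl.2, hc]
    refine ((f1.union f2).union f3).subset fun x hx => ?_
    by_contra hx'
    simp only [Set.mem_union, Set.mem_ofPred_eq, hx, true_and, not_or] at hx'
    obtain ⟨⟨n1, n2⟩, n3⟩ := hx'
    set Q := D.a₁₁ * x 0 ^ 2 + 2 * D.a₁₂ * (x 0 * x 1) + D.a₂₂ * x 1 ^ 2 with hQ
    have hDx : Q + 2 * (D.a₁ * x 0 + D.a₂ * x 1) + D.c = 0 := by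
      rw [hQ]; rw [mem_zeros] at hx; linear_combination hx
    have hQ0 : Q ≠ 0 := fun h => n2 (by rw [h] at hDx; linear_combination hDx)
    have hQc : Q ≠ D.c := fun h => n3 (by rw [h] at hDx; linear_combination hDx / 2)
    set σ := D.c / Q with hσdef
    have hσ : σ * Q = D.c := div_mul_cancel₀ _ hQ0
    have hσ0 : σ ≠ 0 := div_ne_zero hc hQ0
    have hmem : σ • x ∈ D.zeros := by
      rw [mem_zeros]
      simp
      rw [hQ] at hDx hσ
      linear_combination σ * hDx + (σ - 1) * hσ
    have o1 := hon x hx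
    have o2 := hon _ hmem
    simp at o2
    have hx0 : x ≠ 0 := by rintro rfl; simp at n1
    have hr := (sq_add_sq_pos hx0).ne'
    apply n1
    have h3 : (D.c - Q) * ((x 0 ^ 2 + x 1 ^ 2) * (d * x 0 + e * x 1)) = 0 := by
      apply mul_left_cancel₀ (pow_ne_zero 2 hσ0)
      linear_combination Q * o2 - Q * σ ^ 2 * o1
        - σ ^ 2 * ((x 0 ^ 2 + x 1 ^ 2) * (d * x 0 + e * x 1)) * hσ
    have h4 := (mul_eq_zero.mp h3).resolve_left (sub_ne_zero.mpr hQc.symm)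
    linear_combination (mul_eq_zero.mp h4).resolve_left hr

theorem three_le_totalDegree {D : QuadEq} (hD : D.det ≠ 0) (hinf : D.zeros.Infinite)
    {G : MvPolynomial (Fin 2) ℝ} (hG : G ≠ 0) (h : D.invZeros = polyZeros G) :
    3 ≤ G.totalDegree := by
  by_contra hlt
  obtain ⟨a, b, c, d, e, f, hev⟩ := exists_coeff_of_totalDegree_le_two
    (show G.totalDegree ≤ 2 by omega)
  obtain ⟨rfl, rfl, rfl, rfl, rfl, rfl⟩ := coeff_eq_zero_of_invZeros_eq hD hinf
    (a := a) (b := b) (c := c) (d := d) (e := e) (f := f) (by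
      rw [h]; ext x; rw [mem_polyZeros, hev, Set.mem_ofPred_eq])
  apply hG
  apply MvPolynomial.funext
  intro x
  rw [hev, map_zero]
  ring

open MvPolynomial in
theorem exists_polynomial_invZeros {D : QuadEq} (hD : D.det ≠ 0) :
    ∃ G : MvPolynomial (Fin 2) ℝ, G ≠ 0 ∧ G.totalDegree ≤ 4 ∧ (D.c = 0 → G.totalDegree ≤ 3) ∧
      D.invZeros = polyZeros G := by
  set R : MvPolynomial (Fin 2) ℝ := X 0 ^ 2 + X 1 ^ 2 with hR
  set G : MvPolynomial (Fin 2) ℝ := C D.c * R ^ 2 + (C (2 * D.a₁) * (R * X 0)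
    + C (2 * D.a₂) * (R * X 1)) + (C D.a₁₁ * X 0 ^ 2 + C (2 * D.a₁₂) * (X 0 * X 1)
    + C D.a₂₂ * X 1 ^ 2) with hG
  have hev : ∀ x : Fin 2 → ℝ, eval x G = D.invPoly (x 0) (x 1) := by
    intro x
    simp [hG, hR, QuadEq.invPoly]
    ring
  have hX : ∀ i : Fin 2, (X i : MvPolynomial (Fin 2) ℝ).IsHomogeneous 1 := isHomogeneous_X ℝ
  have hRh : R.IsHomogeneous 2 := ((hX 0).pow 2).add ((hX 1).pow 2)
  have hC : ∀ (c : ℝ) {n : ℕ} {P : MvPolynomial (Fin 2) ℝ}, P.IsHomogeneous n →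
      (C c * P).IsHomogeneous n := by
    intro c n P hP
    simpa using (isHomogeneous_C (Fin 2) c).mul hP
  have h4 : (C D.c * R ^ 2).IsHomogeneous 4 := hC _ (hRh.pow 2)
  have h3 : (C (2 * D.a₁) * (R * X 0) + C (2 * D.a₂) * (R * X 1)).IsHomogeneous 3 :=
    (hC _ (hRh.mul (hX 0))).add (hC _ (hRh.mul (hX 1)))
  have h2 : (C D.a₁₁ * X 0 ^ 2 + C (2 * D.a₁₂) * (X 0 * X 1)
      + C D.a₂₂ * X 1 ^ 2 : MvPolynomial (Fin 2) ℝ).IsHomogeneous 2 :=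
    ((hC _ ((hX 0).pow 2)).add (hC _ ((hX 0).mul (hX 1)))).add (hC _ ((hX 1).pow 2))
  refine ⟨G, ?_, ?_, ?_, ?_⟩
  · intro h0
    have hP : ∀ x y : ℝ, D.invPoly x y = 0 := by
      intro x y
      have := hev ![x, y]
      rw [h0, map_zero] at this
      simpa using this.symm
    have p1 := hP 1 0
    have p2 := hP (-1) 0
    have p3 := hP 2 0
    simp only [QuadEq.invPoly] at p1 p2 p3
    apply hD
    have hc : D.c = 0 := by linarith
    have h1 : D.a₁ = 0 := by linarith
    have h11 : D.a₁₁ = 0 := by linarith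
    simp [QuadEq.det, hc, h1, h11]
  · refine (totalDegree_add _ _).trans (max_le ((totalDegree_add _ _).trans (max_le ?_ ?_)) ?_)
    · exact h4.totalDegree_le
    · exact h3.totalDegree_le.trans (by norm_num)
    · exact h2.totalDegree_le.trans (by norm_num)
  · intro hc
    rw [hG, hc, C_0, zero_mul, zero_add]
    refine (totalDegree_add _ _).trans (max_le h3.totalDegree_le ?_)
    exact h2.totalDegree_le.trans (by norm_num)
  · ext x
    rw [mem_polyZeros, hev, mem_invZeros]

theorem hasDegree_invZeros {D : QuadEq} (hD : D.det ≠ 0) (hinf : D.zeros.Infinite) :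
    (HasDegree D.invZeros 3 ∨ HasDegree D.invZeros 4) ∧ (D.c = 0 → HasDegree D.invZeros 3) := by
  obtain ⟨G, hG0, h4, h3, hG⟩ := exists_polynomial_invZeros hD
  have hlow : ∀ n ∈ {n : ℕ | ∃ F : MvPolynomial (Fin 2) ℝ, F ≠ 0 ∧ F.totalDegree = n ∧
      D.invZeros = polyZeros F}, 3 ≤ n := by
    rintro n ⟨F, hF, rfl, hz⟩
    exact three_le_totalDegree hD hinf hF hz
  have h3' : 3 ≤ G.totalDegree := three_le_totalDegree hD hinf hG0 hG
  refine ⟨?_, fun hc => ⟨⟨G, hG0, le_antisymm (h3 hc) h3', hG⟩, hlow⟩⟩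
  -- The degree is that of a real zero set, so the explicit quartic need not be minimal. The
  -- disjunction does not require deciding which value occurs.
  by_cases hex : ∃ F : MvPolynomial (Fin 2) ℝ, F ≠ 0 ∧ F.totalDegree = 3 ∧ D.invZeros = polyZeros F
  · exact Or.inl ⟨hex, hlow⟩
  · right
    refine ⟨⟨G, hG0, ?_, hG⟩, fun n hn => ?_⟩
    · have : G.totalDegree ≠ 3 := fun h => hex ⟨G, hG0, h, hG⟩
      omega
    · have h1 := hlow n hn
      have : n ≠ 3 := by rintro rfl; exact hex hn
      omega

/-! ### Orthonormal frames, and the leading coefficient for a parabola -/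

theorem frame_coords {u v : Plane} (h : IsFrame u v) :
    u 0 ^ 2 + u 1 ^ 2 = 1 ∧ ∃ δ : ℝ, δ ^ 2 = 1 ∧ v 0 = -δ * u 1 ∧ v 1 = δ * u 0 := by
  obtain ⟨hu, hv, huv⟩ := h
  have e1 : u 0 ^ 2 + u 1 ^ 2 = 1 := by rw [← norm_sq_eq, hu, one_pow]
  have e2 : v 0 ^ 2 + v 1 ^ 2 = 1 := by rw [← norm_sq_eq, hv, one_pow]
  rw [inner_eq] at huv
  refine ⟨e1, u 0 * v 1 - u 1 * v 0, ?_, ?_, ?_⟩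
  · linear_combination (v 0 ^ 2 + v 1 ^ 2) * e1 + e2 - (u 0 * v 0 + u 1 * v 1) * huv
  · linear_combination -v 0 * e1 + u 0 * huv
  · linear_combination -v 1 * e1 + u 1 * huv

/-- Only the zero set is known to be a parabola, so the equation is evaluated along `p + s u + k s²
v`. The coefficients of `s⁴` and `s³` show that `v` is in the kernel of the quadratic part, whose
determinant is therefore zero. -/
theorem dual_c_eq_zero_of_isParabola {q : QuadEq} (h : IsParabola q.zeros) : q.dual.c = 0 := by
  obtain ⟨v, p, u, k, hf, hk, hS⟩ := h
  obtain ⟨hu, δ, hδ, hv0, hv1⟩ := frame_coords hf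
  have hmem : ∀ s : ℝ, p + s • u + (k * s ^ 2) • v ∈ q.zeros := by
    intro s
    rw [hS, Set.mem_ofPred_eq, show p + s • u + (k * s ^ 2) • v - p = s • u + (k * s ^ 2) • v by
      abel]
    simp only [inner_add_left, inner_smul_left, real_inner_self_eq_norm_sq, hf.1, hf.2.1, hf.2.2,
      real_inner_comm u v, RCLike.conj_to_real]
    ring
  have hinf : {s : ℝ | (p + s • u + (k * s ^ 2) • v) ∈ q.zeros}.Infinite := by
    simp only [hmem]; exact Set.infinite_univ
  simp only [mem_zeros, PiLp.add_apply, PiLp.smul_apply, smul_eq_mul] at hinf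
  obtain ⟨-, -, -, h3, h4⟩ := quartic_coeff_eq_zero
    (a := q.a₁₁ * p 0 ^ 2 + q.a₂₂ * p 1 ^ 2 + 2 * q.a₁₂ * (p 0 * p 1) + 2 * q.a₁ * p 0
      + 2 * q.a₂ * p 1 + q.c)
    (b := 2 * ((q.a₁₁ * p 0 + q.a₁₂ * p 1 + q.a₁) * u 0 + (q.a₁₂ * p 0 + q.a₂₂ * p 1 + q.a₂) * u 1))
    (c := q.a₁₁ * u 0 ^ 2 + 2 * q.a₁₂ * (u 0 * u 1) + q.a₂₂ * u 1 ^ 2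
      + 2 * k * ((q.a₁₁ * p 0 + q.a₁₂ * p 1 + q.a₁) * v 0
      + (q.a₁₂ * p 0 + q.a₂₂ * p 1 + q.a₂) * v 1))
    (d := 2 * k * (q.a₁₁ * (u 0 * v 0) + q.a₁₂ * (u 0 * v 1 + u 1 * v 0) + q.a₂₂ * (u 1 * v 1)))
    (e := k ^ 2 * (q.a₁₁ * v 0 ^ 2 + 2 * q.a₁₂ * (v 0 * v 1) + q.a₂₂ * v 1 ^ 2))
    (hinf.mono fun s hs => by
      rw [Set.mem_ofPred_eq] at hs ⊢
      linear_combination hs)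
  have hδ0 : δ ≠ 0 := by rintro rfl; simp at hδ
  rw [hv0, hv1] at h3 h4
  have hX : q.a₁₁ * u 1 ^ 2 - 2 * q.a₁₂ * (u 0 * u 1) + q.a₂₂ * u 0 ^ 2 = 0 := by
    apply mul_left_cancel₀ (show k ^ 2 * δ ^ 2 ≠ 0 by positivity)
    linear_combination h4
  have hY : -q.a₁₁ * (u 0 * u 1) + q.a₁₂ * (u 0 ^ 2 - u 1 ^ 2) + q.a₂₂ * (u 0 * u 1) = 0 := by
    apply mul_left_cancel₀ (show 2 * k * δ ≠ 0 by positivity)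
    linear_combination h3
  simp only [QuadEq.dual]
  linear_combination -(q.a₁₂ ^ 2 - q.a₁₁ * q.a₂₂) * (u 0 ^ 2 + u 1 ^ 2 + 1) * hu
    - (q.a₁₁ * u 0 ^ 2 + 2 * q.a₁₂ * (u 0 * u 1) + q.a₂₂ * u 1 ^ 2) * hX
    + (-q.a₁₁ * (u 0 * u 1) + q.a₁₂ * (u 0 ^ 2 - u 1 ^ 2) + q.a₂₂ * (u 0 * u 1)) * hY

/-! ### Local models -/

/-- The linear form with the given coefficients. -/
def linForm (a b : ℝ) : Plane →L[ℝ] ℝ :=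
  a • (EuclideanSpace.proj 0 : Plane →L[ℝ] ℝ) + b • (EuclideanSpace.proj 1 : Plane →L[ℝ] ℝ)

@[simp]
theorem linForm_apply (a b : ℝ) (w : Plane) : linForm a b w = a * w 0 + b * w 1 := by
  simp [linForm]

theorem exists_linearEquiv {a b c d : ℝ} (h : a * d - b * c ≠ 0) :
    ∃ e : Plane ≃L[ℝ] Plane, ∀ w, e w = !₂[a * w 0 + b * w 1, c * w 0 + d * w 1] := by
  obtain ⟨κ, hκ⟩ : ∃ κ, κ * (a * d - b * c) = 1 := ⟨_, inv_mul_cancel₀ h⟩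
  let e : Plane ≃ₗ[ℝ] Plane :=
    { toFun := fun w => !₂[a * w 0 + b * w 1, c * w 0 + d * w 1]
      invFun := fun w => !₂[κ * (d * w 0 - b * w 1), κ * (a * w 1 - c * w 0)]
      map_add' := fun v w => by
        apply plane_ext <;> simp <;> ring
      map_smul' := fun t w => by
        apply plane_ext <;> simp <;> ring
      left_inv := fun w => by
        apply plane_ext
        · simp; linear_combination w 0 * hκ
        · simp; linear_combination w 1 * hκ
      right_inv := fun w => by
        apply plane_ext
        · simp; linear_combination w 0 * hκ
        · simp; linear_combination w 1 * hκ }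
  exact ⟨e.toContinuousLinearEquiv, fun w => rfl⟩

/-- The inverse function theorem, arranged so that a local normal form needs only two coordinate
functions, their differentials at the point and an equivalence of equations. -/
theorem exists_localModel {f₀ f₁ : Plane → ℝ} {Ω S T : Set Plane} {x : Plane} {a b c d : ℝ}
    (hΩ : IsOpen Ω) (hx : x ∈ Ω) (h₀ : ContDiffOn ℝ ∞ f₀ Ω) (h₁ : ContDiffOn ℝ ∞ f₁ Ω)
    (hz₀ : f₀ x = 0) (hz₁ : f₁ x = 0) (hd₀ : HasFDerivAt f₀ (linForm a b) x)
    (hd₁ : HasFDerivAt f₁ (linForm c d) x) (hdet : a * d - b * c ≠ 0)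
    (hST : ∀ z ∈ Ω, z ∈ S ↔ !₂[f₀ z, f₁ z] ∈ T) :
    ∃ φ : OpenPartialHomeomorph Plane Plane, IsLocalModel φ S x T ∧
      ∀ w, fderiv ℝ φ x w = !₂[a * w 0 + b * w 1, c * w 0 + d * w 1] := by
  obtain ⟨e, he⟩ := exists_linearEquiv hdet
  set f : Plane → Plane := fun z => !₂[f₀ z, f₁ z] with hf
  have hfs : ContDiffOn ℝ ∞ f Ω := by
    rw [contDiffOn_euclidean]
    intro i; fin_cases i
    · exact h₀
    · exact h₁
  have hfd : HasFDerivAt f (e : Plane →L[ℝ] Plane) x := by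
    rw [← hasFDerivWithinAt_univ, hasFDerivWithinAt_piLp]
    intro i; fin_cases i
    · refine (hd₀.congr_fderiv ?_).hasFDerivWithinAt
      ext w; simp [he]
    · refine (hd₁.congr_fderiv ?_).hasFDerivWithinAt
      ext w; simp [he]
  have hfx : ContDiffAt ℝ ∞ f x := hfs.contDiffAt (hΩ.mem_nhds hx)
  -- The chart is shrunk to points where the differential is invertible, so that the inverse is
  -- smooth on the whole target.
  set Ω' := Ω ∩ fderiv ℝ f ⁻¹' Set.range
    (ContinuousLinearEquiv.toContinuousLinearMap : (Plane ≃L[ℝ] Plane) → Plane →L[ℝ] Plane)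
  have hΩ' : IsOpen Ω' :=
    (hfs.continuousOn_fderiv_of_isOpen hΩ (by simp)).isOpen_inter_preimage hΩ
      ContinuousLinearEquiv.isOpen
  set φ₀ := hfx.toOpenPartialHomeomorph f hfd (by simp)
  set φ := φ₀.restrOpen Ω' hΩ'
  have hφ : (φ : Plane → Plane) = f := rfl
  have hsrc : φ.source = φ₀.source ∩ Ω' := OpenPartialHomeomorph.restrOpen_source _ _ _
  have hsub : φ.source ⊆ Ω := by rw [hsrc]; exact fun z hz => hz.2.1
  refine ⟨φ, ⟨?_, ?_, ?_, ?_, ?_⟩, ?_⟩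
  · rw [hsrc]
    exact ⟨hfx.mem_toOpenPartialHomeomorph_source hfd (by simp), hx, ⟨e, hfd.fderiv.symm⟩⟩
  · rw [hφ]; apply plane_ext <;> simp [hf, hz₀, hz₁]
  · rw [hφ]; exact hfs.mono hsub
  · intro y hy
    have hy' := φ.map_target hy
    rw [hsrc] at hy'
    obtain ⟨-, hyΩ, e', he'⟩ := hy'
    have hc : ContDiffAt ℝ ∞ f (φ.symm y) := hfs.contDiffAt (hΩ.mem_nhds hyΩ)
    refine (φ.contDiffAt_symm (f₀' := e') hy ?_ hc).contDiffWithinAt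
    rw [he']
    exact (hc.differentiableAt (by simp)).hasFDerivAt
  · ext y
    constructor
    · rintro ⟨z, ⟨hz, hzS⟩, rfl⟩
      exact ⟨φ.map_source hz, (hST z (hsub hz)).mp hzS⟩
    · rintro ⟨hy, hyT⟩
      refine ⟨φ.symm y, ⟨φ.map_target hy, ?_⟩, φ.right_inv hy⟩
      rw [hST _ (hsub (φ.map_target hy))]
      have : f (φ.symm y) = y := φ.right_inv hy
      rw [← this] at hyT
      exact hyT
  · intro w
    rw [hφ, hfd.fderiv]
    exact he w

theorem hasFDerivAt_coord (x : Plane) :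
    HasFDerivAt (fun z : Plane => z 0) (linForm 1 0) x ∧
      HasFDerivAt (fun z : Plane => z 1) (linForm 0 1) x := by
  constructor
  · exact (PiLp.hasFDerivAt_apply (𝕜 := ℝ) 2 x 0).congr_fderiv (by ext w; simp)
  · exact (PiLp.hasFDerivAt_apply (𝕜 := ℝ) 2 x 1).congr_fderiv (by ext w; simp)

/-- The zero set of a smooth function is a regular curve where the gradient does not vanish. -/
theorem isRegularAt_of_gradient {P : Plane → ℝ} {S : Set Plane} {x : Plane} {g₀ g₁ : ℝ}
    (hP : ContDiff ℝ ∞ P) (hS : ∀ z, z ∈ S ↔ P z = 0) (hx : x ∈ S)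
    (hd : HasFDerivAt P (linForm g₀ g₁) x) (hg : g₀ ^ 2 + g₁ ^ 2 ≠ 0) : IsRegularAt S x := by
  obtain ⟨c0, c1⟩ := hasFDerivAt_coord x
  -- The first coordinate is the displacement along the tangent `(-g₁, g₀)`, so the Jacobian is
  -- `-(g₀² + g₁²)`.
  obtain ⟨φ, hφ, -⟩ := exists_localModel (f₀ := fun z => -g₁ * (z 0 - x 0) + g₀ * (z 1 - x 1))
    (f₁ := P) (a := -g₁) (b := g₀) (c := g₀) (d := g₁) (S := S) (T := {y | y 1 = 0}) (x := x)
    isOpen_univ (Set.mem_univ x) (by apply ContDiff.contDiffOn; fun_prop) hP.contDiffOn (by simp)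
    ((hS x).mp hx)
    ((((c0.sub_const (x 0)).const_mul (-g₁)).add ((c1.sub_const (x 1)).const_mul g₀)).congr_fderiv
      (by ext w; simp)) hd (by intro h; apply hg; linear_combination -h)
    (fun z _ => by simp [hS])
  exact ⟨φ, hφ⟩

theorem isRegularAt_invZeros {D : QuadEq} (hD : D.det ≠ 0) {x : Plane} (hx : x ∈ D.invZeros)
    (hx0 : x ≠ 0) : IsRegularAt D.invZeros x := by
  obtain ⟨c0, c1⟩ := hasFDerivAt_coord x
  set g₀ := 2 * D.c * (x 0 ^ 2 + x 1 ^ 2) * x 0 + D.a₁ * (3 * x 0 ^ 2 + x 1 ^ 2)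
    + 2 * D.a₂ * (x 0 * x 1) + D.a₁₁ * x 0 + D.a₁₂ * x 1 with hg₀
  set g₁ := 2 * D.c * (x 0 ^ 2 + x 1 ^ 2) * x 1 + 2 * D.a₁ * (x 0 * x 1)
    + D.a₂ * (x 0 ^ 2 + 3 * x 1 ^ 2) + D.a₁₂ * x 0 + D.a₂₂ * x 1 with hg₁
  have cr := (c0.pow 2).add (c1.pow 2)
  refine isRegularAt_of_gradient (P := fun z => D.invPoly (z 0) (z 1)) (g₀ := 2 * g₀)
    (g₁ := 2 * g₁) ?_ (fun z => mem_invZeros) hx ?_ ?_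
  · simp only [QuadEq.invPoly]; fun_prop
  · refine HasFDerivAt.congr_fderiv (((((((cr.pow 2).const_mul D.c).add
      ((cr.const_mul (2 * D.a₁)).mul c0)).add ((cr.const_mul (2 * D.a₂)).mul c1)).add
      ((c0.pow 2).const_mul D.a₁₁)).add ((c0.mul c1).const_mul (2 * D.a₁₂))).add
      ((c1.pow 2).const_mul D.a₂₂)) ?_
    ext w
    simp [hg₀, hg₁]
    ring
  · intro h
    obtain ⟨h0, h1⟩ := eq_zero_of_sq_add_sq h
    exact invPoly_gradient_ne_zero hD (sq_add_sq_pos hx0).ne' hx (by linarith) (by linarith)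

theorem hasFDerivAt_sub_sq (a b c : ℝ) :
    HasFDerivAt (fun z : Plane => a * z 0 + b * z 1 - c * (z 0 ^ 2 + z 1 ^ 2)) (linForm a b) 0 := by
  obtain ⟨c0, c1⟩ := hasFDerivAt_coord 0
  refine (((c0.const_mul a).add (c1.const_mul b)).sub
    (((c0.pow 2).add (c1.pow 2)).const_mul c)).congr_fderiv ?_
  ext w; simp

/-- The derivative of a product at a zero of the second factor. -/
theorem HasFDerivAt.mul_of_eq_zero {U g : Plane → ℝ} {x : Plane} {g' : Plane →L[ℝ] ℝ}
    (hU : DifferentiableAt ℝ U x) (hg : HasFDerivAt g g' x) (h0 : g x = 0) :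
    HasFDerivAt (fun z => U z * g z) (U x • g') x := by
  refine (hU.hasFDerivAt.mul hg).congr_fderiv ?_
  rw [h0, zero_smul, add_zero]

/-- Multiplied by `(1 - s)²`, the equation `m n = e r²` reads `V m n - e a² m⁴ - e g² n⁴ = 0`. The
pure fourth powers prevent division by `m n`. Expanding the product of the two corrected factors
shows that it is `U` times this expression exactly when, up to a factor `m n`, `U` solves the
quadratic equation `hU`. -/
theorem node_factorization {s r m n a b g e U V : ℝ}
    (hV : V = (1 - s) ^ 2 - e * (4 * (a * b) * m ^ 2
      + (2 * (a * g) + 4 * b ^ 2) * (m * n) + 4 * (b * g) * n ^ 2))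
    (hU : U ^ 2 - V * U + (e * a * g) ^ 2 * (m * n) ^ 2 = 0)
    (hsr : (1 - s) * r = a * m ^ 2 + 2 * b * (m * n) + g * n ^ 2) :
    (U * n - e * a ^ 2 * m ^ 3) * (U * m - e * g ^ 2 * n ^ 3)
      = U * (1 - s) ^ 2 * (m * n - e * r ^ 2) := by
  subst hV
  have h2 : (1 - s) ^ 2 * r ^ 2 = (a * m ^ 2 + 2 * b * (m * n) + g * n ^ 2) ^ 2 := by
    rw [← hsr]; ring
  linear_combination m * n * hU + U * e * h2

/-- Eliminating `r` turns the equation into `n³ = W m²`. Multiplication by `W³` gives `(W n)³ = (W²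
m)²`, and the cusp parameter is the quotient `W m / n`. -/
theorem cusp_iff {s r m n k W : ℝ} (hW0 : W ≠ 0) (h1s : 1 - s ≠ 0) (hW : W = k * (1 - s) - n)
    (hsr : (1 - s) * r = m ^ 2 + n ^ 2) :
    k * m ^ 2 = n * r ↔ ∃ t : ℝ, W * n = t ^ 2 ∧ W ^ 2 * m = t ^ 3 := by
  have hcube : k * m ^ 2 = n * r ↔ n ^ 3 = m ^ 2 * W := by
    constructor
    · intro h
      linear_combination -(1 - s) * h - m ^ 2 * hW - n * hsr
    · intro h
      apply mul_left_cancel₀ h1s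
      linear_combination -h - m ^ 2 * hW - n * hsr
  rw [hcube]
  constructor
  · intro h
    by_cases hn : n = 0
    · subst hn
      have h' : m ^ 2 * W = 0 := by rw [← h]; ring
      have hm : m = 0 := pow_eq_zero_iff two_ne_zero |>.mp ((mul_eq_zero.mp h').resolve_right hW0)
      subst hm
      exact ⟨0, by ring, by ring⟩
    · refine ⟨W * m / n, ?_, ?_⟩
      · field_simp; linear_combination h
      · field_simp; linear_combination m * h
  · rintro ⟨t, ht0, ht1⟩
    have h6 : (W * n) ^ 3 = (W ^ 2 * m) ^ 2 := by rw [ht0, ht1]; ring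
    apply mul_left_cancel₀ (pow_ne_zero 3 hW0)
    linear_combination h6

theorem form_eq_of_independent {α₀ α₁ β₀ β₁ : ℝ} (hdet : α₀ * β₁ - α₁ * β₀ ≠ 0) :
    ∃ a b g : ℝ, ∀ x y : ℝ, x ^ 2 + y ^ 2 = a * (α₀ * x + α₁ * y) ^ 2
      + 2 * b * ((α₀ * x + α₁ * y) * (β₀ * x + β₁ * y)) + g * (β₀ * x + β₁ * y) ^ 2 := by
  obtain ⟨κ, hκ⟩ : ∃ κ, κ * (α₀ * β₁ - α₁ * β₀) = 1 := ⟨_, inv_mul_cancel₀ hdet⟩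
  refine ⟨κ ^ 2 * (β₁ ^ 2 + β₀ ^ 2), -κ ^ 2 * (α₁ * β₁ + α₀ * β₀), κ ^ 2 * (α₁ ^ 2 + α₀ ^ 2),
    fun x y => ?_⟩
  linear_combination -(x ^ 2 + y ^ 2) * (κ * (α₀ * β₁ - α₁ * β₀) + 1) * hκ

/-- The curve `(l₁ - c₁ ‖z‖²) (l₂ - c₂ ‖z‖²) = e ‖z‖⁴` has a node at the origin if the linear forms
`l₁` and `l₂` are independent. -/
theorem hasNodeAt_of_eq {α₀ α₁ β₀ β₁ c₁ c₂ e : ℝ} (hdet : α₀ * β₁ - α₁ * β₀ ≠ 0) {S : Set Plane}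
    (hS : ∀ z : Plane, z ∈ S ↔ (α₀ * z 0 + α₁ * z 1 - c₁ * (z 0 ^ 2 + z 1 ^ 2))
      * (β₀ * z 0 + β₁ * z 1 - c₂ * (z 0 ^ 2 + z 1 ^ 2)) - e * (z 0 ^ 2 + z 1 ^ 2) ^ 2 = 0)
    {d₁ d₂ : Plane} (hd₁ : d₁ ≠ 0) (hd₂ : d₂ ≠ 0) (h₁ : α₀ * d₁ 0 + α₁ * d₁ 1 = 0)
    (h₂ : β₀ * d₂ 0 + β₁ * d₂ 1 = 0) : HasNodeAt S 0 d₁ d₂ := by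
  obtain ⟨a, b, g, hform⟩ := form_eq_of_independent hdet
  set r : Plane → ℝ := fun z => z 0 ^ 2 + z 1 ^ 2 with hr
  set M₁ : Plane → ℝ := fun z => α₀ * z 0 + α₁ * z 1 - c₁ * r z with hM₁
  set M₂ : Plane → ℝ := fun z => β₀ * z 0 + β₁ * z 1 - c₂ * r z with hM₂
  -- Substituting `lᵢ = Mᵢ + cᵢ r` in the expression of `r` as a quadratic form in `l₁`, `l₂` leaves
  -- the same form in `M₁`, `M₂` and a remainder `s r`. Since `s` vanishes at the origin, `r` is a
  -- unit times that form.
  set s : Plane → ℝ := fun z => a * (2 * c₁ * M₁ z + c₁ ^ 2 * r z)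
    + 2 * b * (c₂ * M₁ z + c₁ * M₂ z + c₁ * c₂ * r z) + g * (2 * c₂ * M₂ z + c₂ ^ 2 * r z) with hs
  have hsr : ∀ z, (1 - s z) * r z = a * M₁ z ^ 2 + 2 * b * (M₁ z * M₂ z) + g * M₂ z ^ 2 := by
    intro z
    have hlin := hform (z 0) (z 1)
    rw [show α₀ * z 0 + α₁ * z 1 = M₁ z + c₁ * r z by simp only [hM₁]; ring,
      show β₀ * z 0 + β₁ * z 1 = M₂ z + c₂ * r z by simp only [hM₂]; ring] at hlin
    have hrz : r z = z 0 ^ 2 + z 1 ^ 2 := rfl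
    have hsz : s z = a * (2 * c₁ * M₁ z + c₁ ^ 2 * r z)
      + 2 * b * (c₂ * M₁ z + c₁ * M₂ z + c₁ * c₂ * r z) + g * (2 * c₂ * M₂ z + c₂ ^ 2 * r z) := rfl
    rw [← hrz] at hlin
    clear_value s M₁ M₂ r
    linear_combination hlin - r z * hsz
  set V : Plane → ℝ := fun z => (1 - s z) ^ 2 - e * (4 * (a * b) * M₁ z ^ 2
    + (2 * (a * g) + 4 * b ^ 2) * (M₁ z * M₂ z) + 4 * (b * g) * M₂ z ^ 2) with hV
  set Δ : Plane → ℝ := fun z => V z ^ 2 - 4 * (e * a * g) ^ 2 * (M₁ z * M₂ z) ^ 2 with hΔ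
  -- The root with value 1 at the origin; it is smooth where the discriminant `Δ` is positive.
  set U : Plane → ℝ := fun z => (V z + √(Δ z)) / 2 with hU
  have hrs : ContDiff ℝ ∞ r := by simp only [hr]; fun_prop
  have hM₁s : ContDiff ℝ ∞ M₁ := by simp only [hM₁]; fun_prop
  have hM₂s : ContDiff ℝ ∞ M₂ := by simp only [hM₂]; fun_prop
  have hss : ContDiff ℝ ∞ s := by simp only [hs]; fun_prop
  have hVs : ContDiff ℝ ∞ V := by simp only [hV]; fun_prop
  have hΔs : ContDiff ℝ ∞ Δ := by simp only [hΔ]; fun_prop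
  set Ω : Set Plane := {z | 0 < Δ z} ∩ {z | 0 < V z} ∩ {z | s z < 1}
  have hΩ : IsOpen Ω :=
    ((isOpen_lt continuous_const hΔs.continuous).inter
      (isOpen_lt continuous_const hVs.continuous)).inter (isOpen_lt hss.continuous continuous_const)
  have hr0 : r 0 = 0 := by simp [hr]
  have hM₁0 : M₁ 0 = 0 := by simp [hM₁, hr0]
  have hM₂0 : M₂ 0 = 0 := by simp [hM₂, hr0]
  have hs0 : s 0 = 0 := by simp [hs, hr0, hM₁0, hM₂0]
  have hV0 : V 0 = 1 := by simp [hV, hs0, hM₁0, hM₂0]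
  have hΔ0 : Δ 0 = 1 := by simp [hΔ, hV0, hM₁0, hM₂0]
  have hU0 : U 0 = 1 := by simp [hU, hV0, hΔ0]
  have h0Ω : (0 : Plane) ∈ Ω := ⟨⟨by simp [hΔ0], by simp [hV0]⟩, by simp [hs0]⟩
  have hUs : ContDiffOn ℝ ∞ U Ω := by
    simp only [hU]
    exact (hVs.contDiffOn.add (hΔs.contDiffOn.sqrt fun z hz => ne_of_gt hz.1.1)).div_const 2
  have hUd : DifferentiableAt ℝ U 0 :=
    (hUs.contDiffAt (hΩ.mem_nhds h0Ω)).differentiableAt (by simp)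
  have hM₁d : HasFDerivAt M₁ (linForm α₀ α₁) 0 := hasFDerivAt_sub_sq α₀ α₁ c₁
  have hM₂d : HasFDerivAt M₂ (linForm β₀ β₁) 0 := hasFDerivAt_sub_sq β₀ β₁ c₂
  -- The factor led by `M₂` is taken as coordinate 0, so that the branch `y 1 = 0` is tangent to the
  -- kernel of `l₁`, which contains `d₁`.
  obtain ⟨φ, hφ, hφd⟩ := exists_localModel
    (f₀ := fun z => U z * M₂ z - e * a ^ 2 * M₁ z ^ 3)
    (f₁ := fun z => U z * M₁ z - e * g ^ 2 * M₂ z ^ 3)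
    (a := β₀) (b := β₁) (c := α₀) (d := α₁) (S := S) (T := {y : Plane | y 0 * y 1 = 0})
    hΩ h0Ω (by fun_prop) (by fun_prop) (by simp [hM₁0, hM₂0]) (by simp [hM₁0, hM₂0])
    (((HasFDerivAt.mul_of_eq_zero hUd hM₂d hM₂0).sub ((hM₁d.pow 3).const_mul _)).congr_fderiv
      (by ext w; simp [hU0, hM₁0]))
    (((HasFDerivAt.mul_of_eq_zero hUd hM₁d hM₁0).sub ((hM₂d.pow 3).const_mul _)).congr_fderiv
      (by ext w; simp [hU0, hM₂0]))
    (by intro h; apply hdet; linear_combination -h)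
    (by
      intro z hz
      have hUpos : 0 < U z := by
        have h1 : 0 < V z := hz.1.2
        have := Real.sqrt_nonneg (Δ z)
        simp only [hU]; linarith
      have h1s : 1 - s z ≠ 0 := by
        have : s z < 1 := hz.2
        linarith
      have hUeq : U z ^ 2 - V z * U z + (e * a * g) ^ 2 * (M₁ z * M₂ z) ^ 2 = 0 := by
        have hsq : √(Δ z) ^ 2 = Δ z := Real.sq_sqrt (le_of_lt hz.1.1)
        have hΔz : Δ z = V z ^ 2 - 4 * (e * a * g) ^ 2 * (M₁ z * M₂ z) ^ 2 := rfl
        have hUz : U z = (V z + √(Δ z)) / 2 := rfl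
        rw [hUz]
        generalize √(Δ z) = ρ at hsq
        clear_value V Δ M₁ M₂
        linear_combination hsq / 4 + hΔz / 4
      have key := node_factorization (hV := rfl) (hU := hUeq) (hsr := hsr z)
      have hU0 := hUpos.ne'
      simp only [hS, Set.mem_ofPred_eq, Matrix.cons_val_zero, Matrix.cons_val_one]
      rw [key, mul_eq_zero, or_iff_right (mul_ne_zero hU0 (pow_ne_zero 2 h1s))])
  refine ⟨hd₁, hd₂, φ, hφ, ?_, ?_⟩
  · rw [hφd]; simpa using h₁
  · rw [hφd]; simpa using h₂

/-- The curve `k (ξ - c₁ ‖z‖²)² = (η - c₂ ‖z‖²) ‖z‖²`, where `ξ`, `η` are Cartesian coordinates, has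
an ordinary cusp at the origin. -/
theorem hasOrdinaryCuspAt_of_eq {u v : Plane} (huv : IsFrame u v) {k c₁ c₂ : ℝ} (hk : k ≠ 0)
    {S : Set Plane}
    (hS : ∀ z : Plane, z ∈ S ↔ k * (u 0 * z 0 + u 1 * z 1 - c₁ * (z 0 ^ 2 + z 1 ^ 2)) ^ 2
      = (v 0 * z 0 + v 1 * z 1 - c₂ * (z 0 ^ 2 + z 1 ^ 2)) * (z 0 ^ 2 + z 1 ^ 2)) :
    HasOrdinaryCuspAt S 0 v := by
  obtain ⟨hu, δ, hδ, hv0, hv1⟩ := frame_coords huv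
  have hδ0 : δ ≠ 0 := by rintro rfl; simp at hδ
  set r : Plane → ℝ := fun z => z 0 ^ 2 + z 1 ^ 2 with hr
  set m : Plane → ℝ := fun z => u 0 * z 0 + u 1 * z 1 - c₁ * r z with hm
  set n : Plane → ℝ := fun z => v 0 * z 0 + v 1 * z 1 - c₂ * r z with hn
  set s : Plane → ℝ := fun z => 2 * c₁ * m z + 2 * c₂ * n z + (c₁ ^ 2 + c₂ ^ 2) * r z with hs
  have hsr : ∀ z, (1 - s z) * r z = m z ^ 2 + n z ^ 2 := by
    intro z
    have hlin : z 0 ^ 2 + z 1 ^ 2 = (u 0 * z 0 + u 1 * z 1) ^ 2 + (v 0 * z 0 + v 1 * z 1) ^ 2 := by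
      rw [hv0, hv1]
      linear_combination -(z 0 ^ 2 + z 1 ^ 2) * hu - (u 0 * z 1 - u 1 * z 0) ^ 2 * hδ
    rw [show u 0 * z 0 + u 1 * z 1 = m z + c₁ * r z by simp only [hm]; ring,
      show v 0 * z 0 + v 1 * z 1 = n z + c₂ * r z by simp only [hn]; ring] at hlin
    have hrz : r z = z 0 ^ 2 + z 1 ^ 2 := rfl
    have hsz : s z = 2 * c₁ * m z + 2 * c₂ * n z + (c₁ ^ 2 + c₂ ^ 2) * r z := rfl
    rw [← hrz] at hlin
    clear_value s m n r
    linear_combination hlin - r z * hsz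
  set W : Plane → ℝ := fun z => k * (1 - s z) - n z with hW
  have hrs : ContDiff ℝ ∞ r := by simp only [hr]; fun_prop
  have hms : ContDiff ℝ ∞ m := by simp only [hm]; fun_prop
  have hns : ContDiff ℝ ∞ n := by simp only [hn]; fun_prop
  have hss : ContDiff ℝ ∞ s := by simp only [hs]; fun_prop
  have hWs : ContDiff ℝ ∞ W := by simp only [hW]; fun_prop
  have hr0 : r 0 = 0 := by simp [hr]
  have hm0 : m 0 = 0 := by simp [hm, hr0]
  have hn0 : n 0 = 0 := by simp [hn, hr0]
  have hs0 : s 0 = 0 := by simp [hs, hr0, hm0, hn0]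
  have hW0 : W 0 = k := by simp [hW, hs0, hn0]
  set Ω : Set Plane := {z | W z ≠ 0} ∩ {z | s z < 1}
  have hΩ : IsOpen Ω := (isOpen_ne_fun hWs.continuous continuous_const).inter
    (isOpen_lt hss.continuous continuous_const)
  have hWd : DifferentiableAt ℝ W 0 := hWs.differentiable (by simp) 0
  have hmd : HasFDerivAt m (linForm (u 0) (u 1)) 0 := hasFDerivAt_sub_sq _ _ c₁
  have hnd : HasFDerivAt n (linForm (v 0) (v 1)) 0 := hasFDerivAt_sub_sq _ _ c₂
  obtain ⟨φ, hφ, hφd⟩ := exists_localModel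
    (f₀ := fun z => W z * n z) (f₁ := fun z => W z ^ 2 * m z)
    (a := k * v 0) (b := k * v 1) (c := k ^ 2 * u 0) (d := k ^ 2 * u 1) (S := S)
    (T := {y : Plane | ∃ t : ℝ, y 0 = t ^ 2 ∧ y 1 = t ^ 3})
    hΩ (show (0 : Plane) ∈ Ω from ⟨by simpa [hW0] using hk, by simp [hs0]⟩)
    (by fun_prop) (by fun_prop) (by simp [hn0]) (by simp [hm0])
    ((HasFDerivAt.mul_of_eq_zero hWd hnd hn0).congr_fderiv (by ext w; simp [hW0]; ring))
    ((HasFDerivAt.mul_of_eq_zero (hWd.pow 2) hmd hm0).congr_fderiv (by ext w; simp [hW0]; ring))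
    (by
      rw [hv0, hv1, show k * (-δ * u 1) * (k ^ 2 * u 1) - k * (δ * u 0) * (k ^ 2 * u 0)
        = -(δ * k ^ 3) * (u 0 ^ 2 + u 1 ^ 2) by ring, hu, mul_one]
      exact neg_ne_zero.mpr (mul_ne_zero hδ0 (pow_ne_zero 3 hk)))
    (by
      intro z hz
      have hWz : W z ≠ 0 := hz.1
      have h1s : 1 - s z ≠ 0 := by
        have : s z < 1 := hz.2
        linarith
      exact (hS z).trans (cusp_iff hWz h1s rfl (hsr z)))
  refine ⟨?_, φ, hφ, ?_⟩
  · intro h; have := huv.2.1; rw [h, norm_zero] at this; exact zero_ne_one this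
  · rw [hφd]
    simp [hv0, hv1]
    ring

/-! ### Local unions of regular curves and fronts -/

/-- The normal direction obtained by a quarter turn. -/
def quarterTurn : Plane →L[ℝ] Plane :=
  LinearMap.toContinuousLinearMap
    { toFun := fun w => !₂[-w 1, w 0]
      map_add' := fun v w => by
        apply plane_ext
        · simp; ring
        · simp
      map_smul' := fun t w => by apply plane_ext <;> simp }

theorem quarterTurn_apply (w : Plane) : quarterTurn w = !₂[-w 1, w 0] := rfl

theorem norm_quarterTurn (w : Plane) : ‖quarterTurn w‖ = ‖w‖ := by
  rw [← sq_eq_sq₀ (norm_nonneg _) (norm_nonneg _), norm_sq_eq, norm_sq_eq, quarterTurn_apply]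
  simp; ring

theorem inner_quarterTurn (w : Plane) : inner ℝ w (quarterTurn w) = 0 := by
  rw [inner_eq, quarterTurn_apply]; simp; ring

/-- The unit normal associated with a direction. -/
def unitNormal (w : Plane) : Plane := ‖w‖⁻¹ • quarterTurn w

theorem norm_unitNormal {w : Plane} (hw : w ≠ 0) : ‖unitNormal w‖ = 1 := by
  rw [unitNormal, norm_smul, norm_quarterTurn, norm_inv, norm_norm,
    inv_mul_cancel₀ (norm_ne_zero_iff.mpr hw)]

theorem inner_unitNormal (w : Plane) : inner ℝ w (unitNormal w) = 0 := by
  rw [unitNormal, inner_smul_right, inner_quarterTurn, mul_zero]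

theorem contDiffOn_unitNormal {w : ℝ → Plane} {I : Set ℝ} (hw : ContDiffOn ℝ ∞ w I)
    (h0 : ∀ t ∈ I, w t ≠ 0) : ContDiffOn ℝ ∞ (fun t => unitNormal (w t)) I := by
  have hn : ContDiffOn ℝ ∞ (fun t => ‖w t‖) I := hw.norm ℝ h0
  exact (hn.inv fun t ht => norm_ne_zero_iff.mpr (h0 t ht)).smul
    (quarterTurn.contDiff.comp_contDiffOn hw)

theorem IsRegularOn.isFrontOn {γ : ℝ → Plane} {I : Set ℝ} (hI : IsOpen I) (h : IsRegularOn γ I) :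
    IsFrontOn γ I :=
  ⟨fun t => unitNormal (deriv γ t), ⟨h.1,
    contDiffOn_unitNormal (h.1.deriv_of_isOpen hI (by simp)) h.2,
    fun t ht => ⟨norm_unitNormal (h.2 t ht), inner_unitNormal _⟩⟩, fun t ht => Or.inl (h.2 t ht)⟩

/-- If the velocity of `γ` is `t • w t`, where `w` and `w'` are independent at the time zero, then
`γ` is a front. -/
theorem isFrontOn_of_deriv_eq_smul {γ w : ℝ → Plane} {I : Set ℝ} (hI : IsOpen I)
    (hγ : ContDiffOn ℝ ∞ γ I) (hw : ContDiffOn ℝ ∞ w I) (h0 : ∀ t ∈ I, w t ≠ 0)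
    (hγw : ∀ t ∈ I, deriv γ t = t • w t) (w' : Plane) (hw' : HasDerivAt w w' 0)
    (hind : inner ℝ w' (quarterTurn (w 0)) ≠ 0) : IsFrontOn γ I := by
  have hν := contDiffOn_unitNormal hw h0
  refine ⟨fun t => unitNormal (w t), ⟨hγ, hν, fun t ht => ⟨norm_unitNormal (h0 t ht), ?_⟩⟩,
    fun t ht => ?_⟩
  · rw [hγw t ht, inner_smul_left, inner_unitNormal, mul_zero]
  · by_cases ht0 : t = 0
    · right
      subst ht0
      intro hd
      have hνd : HasDerivAt (fun t => unitNormal (w t)) 0 0 := by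
        rw [← hd]
        exact ((hν.contDiffAt (hI.mem_nhds ht)).differentiableAt (by simp)).hasDerivAt
      -- Differentiating `⟨w, ν⟩ = 0` at the time zero: if `ν' = 0`, then `w'` is orthogonal to `ν`,
      -- against the independence of `w` and `w'`.
      have e1 := hw'.inner ℝ hνd
      have e2 : (fun t => inner ℝ (w t) (unitNormal (w t))) = fun _ => (0 : ℝ) := by
        ext t; exact inner_unitNormal _
      rw [e2] at e1
      have e3 := e1.unique (hasDerivAt_const _ _)
      rw [inner_zero_right, zero_add, unitNormal, inner_smul_right] at e3
      rcases mul_eq_zero.mp e3 with h | h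
      · exact h0 0 ht (norm_eq_zero.mp (inv_eq_zero.mp h))
      · exact hind h
    · left
      rw [hγw t ht]
      exact smul_ne_zero ht0 (h0 t ht)

/-- Local branches of a set, transported from a model set. The curves `c i` parametrize the model
set in arbitrarily small neighbourhoods of the origin. -/
theorem exists_branches_of_localModel {P : (ℝ → Plane) → Set ℝ → Prop}
    {φ : OpenPartialHomeomorph Plane Plane} {S T : Set Plane} {x : Plane}
    (hφ : IsLocalModel φ S x T) {r : ℕ} (c : Fin r → ℝ → Plane) (hc0 : ∀ i, c i 0 = 0)
    (hc : ∀ W ∈ nhds (0 : Plane), ∃ ε > 0, ∃ B ⊆ W, IsOpen B ∧ (0 : Plane) ∈ B ∧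
      ⋃ i, c i '' Set.Ioo (-ε) ε = B ∩ T)
    (hP : ∀ i, ∀ ε > 0, Set.MapsTo (c i) (Set.Ioo (-ε) ε) φ.target →
      P (φ.symm ∘ c i) (Set.Ioo (-ε) ε)) :
    ∃ U : Set Plane, IsOpen U ∧ x ∈ U ∧
      ∃ (r : ℕ) (γ : Fin r → ℝ → Plane) (t ε : Fin r → ℝ),
        (∀ i, 0 < ε i ∧ γ i (t i) = x ∧ P (γ i) (Set.Ioo (t i - ε i) (t i + ε i))) ∧
        (⋃ i, γ i '' Set.Ioo (t i - ε i) (t i + ε i)) = U ∩ S := by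
  obtain ⟨hx, hφx, -, -, himg⟩ := hφ
  have hsymm0 : φ.symm 0 = x := by rw [← hφx, φ.left_inv hx]
  obtain ⟨ε, hε, B, hBW, hB, h0B, hun⟩ := hc φ.target
    (φ.open_target.mem_nhds (by rw [← hφx]; exact φ.map_source hx))
  have hmaps : ∀ i, Set.MapsTo (c i) (Set.Ioo (-ε) ε) (B ∩ T) := fun i t ht => by
    rw [← hun]; exact Set.mem_iUnion.mpr ⟨i, t, ht, rfl⟩
  have hmem : ∀ z ∈ φ.source, (z ∈ S ↔ φ z ∈ T) := by
    intro z hz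
    constructor
    · intro hzS
      have : φ z ∈ φ '' (φ.source ∩ S) := ⟨z, ⟨hz, hzS⟩, rfl⟩
      rw [himg] at this
      exact this.2
    · intro hzT
      have : φ z ∈ φ '' (φ.source ∩ S) := by rw [himg]; exact ⟨φ.map_source hz, hzT⟩
      obtain ⟨z', ⟨hz', hz'S⟩, he⟩ := this
      rwa [← φ.injOn hz' hz he]
  refine ⟨φ.source ∩ φ ⁻¹' B, φ.isOpen_inter_preimage hB, ⟨hx, by
    rw [Set.mem_preimage, hφx]; exact h0B⟩, r, fun i => φ.symm ∘ c i, fun _ => 0, fun _ => ε,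
    fun i => ⟨hε, ?_, ?_⟩, ?_⟩
  · simp [hc0, hsymm0]
  · simp only [zero_sub, zero_add]
    exact hP i ε hε fun t ht => hBW (hmaps i ht).1
  · simp only [zero_sub, zero_add]
    ext z
    simp only [Set.mem_iUnion, Set.mem_image, Function.comp_apply]
    constructor
    · rintro ⟨i, t, ht, rfl⟩
      have h1 := hmaps i ht
      have h2 := hBW h1.1
      have h3 := φ.map_target h2
      refine ⟨⟨h3, ?_⟩, ?_⟩
      · rw [Set.mem_preimage, φ.right_inv h2]; exact h1.1
      · rw [hmem _ h3, φ.right_inv h2]; exact h1.2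
    · rintro ⟨⟨hz, hzB⟩, hzS⟩
      have h1 : φ z ∈ B ∩ T := ⟨hzB, (hmem z hz).mp hzS⟩
      rw [← hun] at h1
      obtain ⟨i, t, ht, he⟩ := Set.mem_iUnion.mp h1
      exact ⟨i, t, ht, by rw [he, φ.left_inv hz]⟩

theorem fderiv_symm_injective {φ : OpenPartialHomeomorph Plane Plane}
    (h₁ : ContDiffOn ℝ ∞ φ φ.source) (h₂ : ContDiffOn ℝ ∞ φ.symm φ.target) {y : Plane}
    (hy : y ∈ φ.target) : Function.Injective (fderiv ℝ φ.symm y) := by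
  have hs := φ.map_target hy
  have d1 := ((h₁.contDiffAt (φ.open_source.mem_nhds hs)).differentiableAt (by simp)).hasFDerivAt
  have d2 := ((h₂.contDiffAt (φ.open_target.mem_nhds hy)).differentiableAt (by simp)).hasFDerivAt
  have d3 := d1.comp y d2
  have d4 : HasFDerivAt (φ ∘ φ.symm) (ContinuousLinearMap.id ℝ Plane) y := by
    refine (hasFDerivAt_id y).congr_of_eventuallyEq ?_
    filter_upwards [φ.open_target.mem_nhds hy] with z hz using φ.right_inv hz
  have d5 := d3.unique d4
  intro v w hvw
  have hv := congrArg (fun L : Plane →L[ℝ] Plane => L v) d5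
  have hw := congrArg (fun L : Plane →L[ℝ] Plane => L w) d5
  simp only [ContinuousLinearMap.comp_apply, ContinuousLinearMap.id_apply] at hv hw
  rw [← hv, ← hw, hvw]

theorem isRegularOn_symm_comp {φ : OpenPartialHomeomorph Plane Plane} {S T : Set Plane}
    {x : Plane} (hφ : IsLocalModel φ S x T) {c : ℝ → Plane} (hc : ContDiff ℝ ∞ c)
    (hc' : ∀ t, deriv c t ≠ 0) {I : Set ℝ} (hI : Set.MapsTo c I φ.target) :
    IsRegularOn (φ.symm ∘ c) I := by
  obtain ⟨-, -, h₁, h₂, -⟩ := hφ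
  refine ⟨h₂.comp hc.contDiffOn hI, fun t ht => ?_⟩
  have hy := hI ht
  have d2 := ((h₂.contDiffAt (φ.open_target.mem_nhds hy)).differentiableAt (by simp)).hasFDerivAt
  have d := d2.comp_hasDerivAt t ((hc.differentiable (by simp)) t).hasDerivAt
  rw [d.deriv]
  intro h0
  exact hc' t (fderiv_symm_injective h₁ h₂ hy (h0.trans (map_zero _).symm))

theorem exists_box {W : Set Plane} (hW : W ∈ nhds (0 : Plane)) :
    ∃ ε > 0, ε < 1 ∧ ∀ y : Plane, |y 0| < ε → |y 1| < ε → y ∈ W := by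
  obtain ⟨ρ, hρ, hball⟩ := Metric.mem_nhds_iff.mp hW
  refine ⟨min (ρ / 2) (1 / 2), by positivity, by linarith [min_le_right (ρ / 2) (1 / 2 : ℝ)],
    fun y h0 h1 => hball ?_⟩
  rw [mem_ball_zero_iff]
  apply lt_of_pow_lt_pow_left₀ 2 hρ.le
  rw [norm_sq_eq]
  have hm := min_le_left (ρ / 2) (1 / 2 : ℝ)
  rw [abs_lt] at h0 h1
  nlinarith [h0.1, h0.2, h1.1, h1.2]

/-- The coordinate axes, parametrized. -/
def axis (i : Fin 2) (t : ℝ) : Plane := EuclideanSpace.single i t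

theorem contDiff_axis (i : Fin 2) : ContDiff ℝ ∞ (axis i) := by
  rw [contDiff_euclidean]
  intro j
  by_cases h : j = i
  · subst h; simp [axis]; exact contDiff_id
  · simp [axis, h]; exact contDiff_const

theorem deriv_axis_ne_zero (i : Fin 2) (t : ℝ) : deriv (axis i) t ≠ 0 := by
  intro h
  have d := ((contDiff_axis i).differentiable (by simp) t).hasDerivAt
  have d1 := (PiLp.hasFDerivAt_apply (𝕜 := ℝ) 2 (axis i t) i).comp_hasDerivAt t d
  rw [h, map_zero] at d1
  have e : ((fun f : Plane => f i) ∘ axis i) = id := by ext t; simp [axis]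
  rw [e] at d1
  exact one_ne_zero ((hasDerivAt_id t).unique d1)

theorem isRegularAt_exists_branches {S : Set Plane} {x : Plane} (h : IsRegularAt S x) :
    ∃ U : Set Plane, IsOpen U ∧ x ∈ U ∧
      ∃ (r : ℕ) (γ : Fin r → ℝ → Plane) (t ε : Fin r → ℝ),
        (∀ i, 0 < ε i ∧ γ i (t i) = x ∧ IsRegularOn (γ i) (Set.Ioo (t i - ε i) (t i + ε i))) ∧
        (⋃ i, γ i '' Set.Ioo (t i - ε i) (t i + ε i)) = U ∩ S := by
  obtain ⟨φ, hφ⟩ := h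
  refine exists_branches_of_localModel hφ (fun _ : Fin 1 => axis 0) (fun _ => by simp [axis])
    (fun W hW => ?_) (fun _ ε _ hmaps => isRegularOn_symm_comp hφ (contDiff_axis 0)
      (deriv_axis_ne_zero 0) hmaps)
  obtain ⟨ε, hε, -, hbox⟩ := exists_box hW
  refine ⟨ε, hε, {y | |y 0| < ε} ∩ {y | |y 1| < ε}, fun y hy => hbox y hy.1 hy.2,
    (isOpen_lt (by fun_prop) continuous_const).inter (isOpen_lt (by fun_prop) continuous_const),
    by simp [hε], ?_⟩
  ext y
  simp only [Set.mem_iUnion, Set.mem_image, Set.mem_inter_iff, Set.mem_ofPred_eq, exists_const]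
  constructor
  · rintro ⟨t, ht, rfl⟩
    simp [axis, abs_lt, ht.1, ht.2, hε]
  · rintro ⟨⟨h0, -⟩, h1⟩
    exact ⟨y 0, abs_lt.mp h0, plane_ext (by simp [axis]) (by simp [axis, h1])⟩

theorem hasNodeAt_exists_branches {S : Set Plane} {x d₁ d₂ : Plane} (h : HasNodeAt S x d₁ d₂) :
    ∃ U : Set Plane, IsOpen U ∧ x ∈ U ∧
      ∃ (r : ℕ) (γ : Fin r → ℝ → Plane) (t ε : Fin r → ℝ),
        (∀ i, 0 < ε i ∧ γ i (t i) = x ∧ IsRegularOn (γ i) (Set.Ioo (t i - ε i) (t i + ε i))) ∧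
        (⋃ i, γ i '' Set.Ioo (t i - ε i) (t i + ε i)) = U ∩ S := by
  obtain ⟨-, -, φ, hφ, -, -⟩ := h
  refine exists_branches_of_localModel hφ axis (fun _ => by simp [axis])
    (fun W hW => ?_) (fun i ε _ hmaps => isRegularOn_symm_comp hφ (contDiff_axis i)
      (deriv_axis_ne_zero i) hmaps)
  obtain ⟨ε, hε, -, hbox⟩ := exists_box hW
  refine ⟨ε, hε, {y | |y 0| < ε} ∩ {y | |y 1| < ε}, fun y hy => hbox y hy.1 hy.2,
    (isOpen_lt (by fun_prop) continuous_const).inter (isOpen_lt (by fun_prop) continuous_const),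
    by simp [hε], ?_⟩
  ext y
  simp only [Set.mem_iUnion, Set.mem_image, Set.mem_inter_iff, Set.mem_ofPred_eq, Fin.exists_fin_two]
  constructor
  · rintro (⟨t, ht, rfl⟩ | ⟨t, ht, rfl⟩) <;> simp [axis, abs_lt, ht.1, ht.2, hε]
  · rintro ⟨⟨h0, h0'⟩, h1⟩
    rcases mul_eq_zero.mp h1 with h1 | h1
    · exact Or.inr ⟨y 1, abs_lt.mp h0', plane_ext (by simp [axis, h1]) (by simp [axis])⟩
    · exact Or.inl ⟨y 0, abs_lt.mp h0, plane_ext (by simp [axis]) (by simp [axis, h1])⟩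

/-- The semicubical parabola. -/
def cuspCurve (t : ℝ) : Plane := !₂[t ^ 2, t ^ 3]

theorem hasDerivAt_plane {f₀ f₁ : ℝ → ℝ} {a b t : ℝ} (h₀ : HasDerivAt f₀ a t)
    (h₁ : HasDerivAt f₁ b t) : HasDerivAt (fun t => (!₂[f₀ t, f₁ t] : Plane)) !₂[a, b] t := by
  rw [hasDerivAt_iff_hasFDerivAt, ← hasFDerivWithinAt_univ, hasFDerivWithinAt_piLp]
  intro i; fin_cases i
  · refine (h₀.hasFDerivAt.congr_fderiv ?_).hasFDerivWithinAt
    ext; simp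
  · refine (h₁.hasFDerivAt.congr_fderiv ?_).hasFDerivWithinAt
    ext; simp

theorem hasDerivAt_cuspCurve (t : ℝ) :
    HasDerivAt cuspCurve (t • (!₂[2, 3 * t] : Plane)) t := by
  have := hasDerivAt_plane (hasDerivAt_pow 2 t) (hasDerivAt_pow 3 t)
  have e : (!₂[((2 : ℕ) : ℝ) * t ^ (2 - 1), ((3 : ℕ) : ℝ) * t ^ (3 - 1)] : Plane)
      = t • (!₂[2, 3 * t] : Plane) := by
    apply plane_ext <;> simp <;> ring
  rw [e] at this
  exact this

theorem contDiff_cuspCurve : ContDiff ℝ ∞ cuspCurve := by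
  rw [contDiff_euclidean]
  intro i; fin_cases i <;> simp [cuspCurve] <;> fun_prop

theorem quarterTurn_independent {v w : Plane} (hv : v ≠ 0)
    (h : inner ℝ w (quarterTurn v) = 0) : ∃ k : ℝ, w = k • v := by
  have hr := (sq_add_sq_pos hv).ne'
  rw [inner_eq, quarterTurn_apply] at h
  simp at h
  refine ⟨(w 0 * v 0 + w 1 * v 1) / (v 0 ^ 2 + v 1 ^ 2), plane_ext ?_ ?_⟩
  · simp; field_simp; linear_combination -v 1 * h
  · simp; field_simp; linear_combination v 0 * h

/-- The velocity is `t • w t` with `w t` the image of `(2, 3 t)` under the differential of `φ.symm`.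
As the cusp has zero velocity at the time zero, the second derivative of `φ.symm` does not enter `w'
0`, which is the image of `(0, 3)` and so independent of `w 0`. -/
theorem isFrontOn_symm_cuspCurve {φ : OpenPartialHomeomorph Plane Plane} {S T : Set Plane}
    {x : Plane} (hφ : IsLocalModel φ S x T) {ε : ℝ}
    (hI : Set.MapsTo cuspCurve (Set.Ioo (-ε) ε) φ.target) (hε : 0 < ε) :
    IsFrontOn (φ.symm ∘ cuspCurve) (Set.Ioo (-ε) ε) := by
  obtain ⟨-, -, h₁, h₂, -⟩ := hφ
  set v : ℝ → Plane := fun t => !₂[2, 3 * t] with hv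
  have hvs : ContDiff ℝ ∞ v := by
    rw [contDiff_euclidean]
    intro i; fin_cases i <;> simp [hv] <;> fun_prop
  have hfd : ContDiffOn ℝ ∞ (fderiv ℝ φ.symm) φ.target :=
    h₂.fderiv_of_isOpen φ.open_target (by simp)
  have hinj : ∀ t ∈ Set.Ioo (-ε) ε, Function.Injective (fderiv ℝ φ.symm (cuspCurve t)) :=
    fun t ht => fderiv_symm_injective h₁ h₂ (hI ht)
  have h0 : (0 : ℝ) ∈ Set.Ioo (-ε) ε := by constructor <;> linarith
  have hv' : HasDerivAt v !₂[0, 3] 0 := by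
    have := hasDerivAt_plane (hasDerivAt_const (0 : ℝ) (2 : ℝ)) ((hasDerivAt_id (0 : ℝ)).const_mul 3)
    simpa [hv] using this
  refine isFrontOn_of_deriv_eq_smul isOpen_Ioo (h₂.comp contDiff_cuspCurve.contDiffOn hI)
    (w := fun t => fderiv ℝ φ.symm (cuspCurve t) (v t))
    ((hfd.comp contDiff_cuspCurve.contDiffOn hI).clm_apply hvs.contDiffOn) ?_ ?_
    (fderiv ℝ φ.symm (cuspCurve 0) !₂[0, 3]) ?_ ?_
  · intro t ht h
    have := hinj t ht (h.trans (map_zero _).symm)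
    have := congrArg (fun z : Plane => z 0) this
    simp [hv] at this
  · intro t ht
    have d2 := ((h₂.contDiffAt (φ.open_target.mem_nhds (hI ht))).differentiableAt
      (by simp)).hasFDerivAt
    rw [(d2.comp_hasDerivAt t (hasDerivAt_cuspCurve t)).deriv, map_smul]
  · have d := ((hfd.contDiffAt (φ.open_target.mem_nhds (hI h0))).differentiableAt
      (by simp)).hasFDerivAt
    have d1 := d.comp_hasDerivAt (0 : ℝ) (hasDerivAt_cuspCurve 0)
    rw [zero_smul, map_zero] at d1
    have d2 := d1.clm_apply hv'
    simpa using d2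
  · intro h
    obtain ⟨k, hk⟩ := quarterTurn_independent (fun h => by
      have := hinj 0 h0 (h.trans (map_zero _).symm)
      have := congrArg (fun z : Plane => z 0) this
      simp [hv] at this) h
    rw [← map_smul] at hk
    have h2 := hinj 0 h0 hk
    have e0 := congrArg (fun z : Plane => z 0) h2
    have e1 := congrArg (fun z : Plane => z 1) h2
    simp [hv] at e0 e1

theorem hasOrdinaryCuspAt_exists_branches {S : Set Plane} {x d : Plane}
    (h : HasOrdinaryCuspAt S x d) :
    ∃ U : Set Plane, IsOpen U ∧ x ∈ U ∧
      ∃ (r : ℕ) (γ : Fin r → ℝ → Plane) (t ε : Fin r → ℝ),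
        (∀ i, 0 < ε i ∧ γ i (t i) = x ∧ IsFrontOn (γ i) (Set.Ioo (t i - ε i) (t i + ε i))) ∧
        (⋃ i, γ i '' Set.Ioo (t i - ε i) (t i + ε i)) = U ∩ S := by
  obtain ⟨-, φ, hφ, -⟩ := h
  refine exists_branches_of_localModel hφ (fun _ : Fin 1 => cuspCurve)
    (fun _ => by apply plane_ext <;> simp [cuspCurve])
    (fun W hW => ?_) (fun _ ε hε hmaps => isFrontOn_symm_cuspCurve hφ hmaps hε)
  obtain ⟨ε, hε, hε1, hbox⟩ := exists_box hW
  have h2 : ε ^ 2 ≤ ε := by nlinarith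
  have h3 : ε ^ 3 ≤ ε := by nlinarith [sq_nonneg ε]
  -- The sides match the two powers, so the box cuts out of the cusp exactly the parameters `|t| <
  -- ε`.
  refine ⟨ε, hε, {y | |y 0| < ε ^ 2} ∩ {y | |y 1| < ε ^ 3},
    fun y hy => hbox y (lt_of_lt_of_le hy.1 h2) (lt_of_lt_of_le hy.2 h3),
    (isOpen_lt (by fun_prop) continuous_const).inter (isOpen_lt (by fun_prop) continuous_const),
    by simp [hε], ?_⟩
  ext y
  simp only [Set.mem_iUnion, Set.mem_image, Set.mem_inter_iff, Set.mem_ofPred_eq, exists_const]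
  constructor
  · rintro ⟨t, ht, rfl⟩
    have hta : |t| < ε := abs_lt.mpr ht
    refine ⟨⟨?_, ?_⟩, t, by simp [cuspCurve], by simp [cuspCurve]⟩
    · simp only [cuspCurve, Matrix.cons_val_zero, abs_pow]
      exact pow_lt_pow_left₀ hta (abs_nonneg t) two_ne_zero
    · simp only [cuspCurve, Matrix.cons_val_one, Matrix.cons_val_zero, abs_pow]
      exact pow_lt_pow_left₀ hta (abs_nonneg t) three_ne_zero
  · rintro ⟨⟨h0, -⟩, t, ht0, ht1⟩
    refine ⟨t, abs_lt.mp ?_, plane_ext (by simp [cuspCurve, ht0]) (by simp [cuspCurve, ht1])⟩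
    rw [ht0, abs_pow] at h0
    exact lt_of_pow_lt_pow_left₀ 2 hε.le h0

/-- A constant curve with a rotating unit normal has an immersive Legendrian lift, so a single point
is the image of a front. -/
theorem isIsolatedPointOf_exists_branches {S : Set Plane} {x : Plane}
    (h : IsIsolatedPointOf S x) :
    ∃ U : Set Plane, IsOpen U ∧ x ∈ U ∧
      ∃ (r : ℕ) (γ : Fin r → ℝ → Plane) (t ε : Fin r → ℝ),
        (∀ i, 0 < ε i ∧ γ i (t i) = x ∧ IsFrontOn (γ i) (Set.Ioo (t i - ε i) (t i + ε i))) ∧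
        (⋃ i, γ i '' Set.Ioo (t i - ε i) (t i + ε i)) = U ∩ S := by
  obtain ⟨U, hU, hUS⟩ := h
  have hx : x ∈ U ∩ S := by rw [hUS]; rfl
  refine ⟨U, hU, hx.1, 1, fun _ _ => x, fun _ => 0, fun _ => 1,
    fun _ => ⟨one_pos, rfl, fun t => !₂[Real.cos t, Real.sin t], ⟨contDiffOn_const, ?_, ?_⟩, ?_⟩, ?_⟩
  · apply ContDiff.contDiffOn
    rw [contDiff_euclidean]
    intro i; fin_cases i
    · exact Real.contDiff_cos
    · exact Real.contDiff_sin
  · intro t _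
    refine ⟨?_, by simp⟩
    rw [← sq_eq_sq₀ (norm_nonneg _) zero_le_one, norm_sq_eq]
    simp
  · intro t _
    right
    rw [(hasDerivAt_plane (Real.hasDerivAt_cos t) (Real.hasDerivAt_sin t)).deriv]
    intro h
    have e0 := congrArg (fun z : Plane => z 0) h
    have e1 := congrArg (fun z : Plane => z 1) h
    simp at e0 e1
    have := Real.sin_sq_add_cos_sq t
    rw [e0, e1] at this
    norm_num at this
  · rw [hUS]
    ext y
    simp only [Set.mem_iUnion, Set.mem_image, exists_const, Set.mem_singleton_iff]
    constructor
    · rintro ⟨_, _, h⟩; exact h.symm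
    · rintro rfl; exact ⟨0, by norm_num, rfl⟩

/-! ### The origin -/

/-- The inverse of a nondegenerate conic has at the origin an isolated point, a node, or an
ordinary cusp. -/
theorem origin_trichotomy {D : QuadEq} (hD : D.det ≠ 0) :
    IsIsolatedPointOf D.invZeros 0 ∨ (∃ d₁ d₂, HasNodeAt D.invZeros 0 d₁ d₂) ∨
      ∃ v, HasOrdinaryCuspAt D.invZeros 0 v := by
  have hquad := D.quad_ne_zero_of_det hD
  rcases lt_trichotomy (D.a₁₂ ^ 2 - D.a₁₁ * D.a₂₂) 0 with hneg | hzero | hpos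
  · left
    -- By Cayley–Hamilton, the trace times the quadratic form at `z` equals `‖A z‖² + det A ‖z‖²`,
    -- where `A` is its matrix. Hence `τ` times the equation is a sum of nonnegative terms near the
    -- origin, whatever the sign of the form.
    set τ := D.a₁₁ + D.a₂₂
    refine ⟨{z : Plane | 0 < D.a₁₁ * D.a₂₂ - D.a₁₂ ^ 2
      + τ * (2 * (D.a₁ * z 0 + D.a₂ * z 1) + D.c * (z 0 ^ 2 + z 1 ^ 2))},
      isOpen_lt continuous_const (by fun_prop), ?_⟩
    ext z
    constructor
    · rintro ⟨hz, hzP⟩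
      by_contra hz0
      have hr := sq_add_sq_pos hz0
      rw [Set.mem_ofPred_eq] at hz
      rw [mem_invZeros, QuadEq.invPoly] at hzP
      have hmul := mul_pos hr hz
      have : (D.a₁₁ * z 0 + D.a₁₂ * z 1) ^ 2 + (D.a₁₂ * z 0 + D.a₂₂ * z 1) ^ 2
          + (z 0 ^ 2 + z 1 ^ 2) * (D.a₁₁ * D.a₂₂ - D.a₁₂ ^ 2
          + τ * (2 * (D.a₁ * z 0 + D.a₂ * z 1) + D.c * (z 0 ^ 2 + z 1 ^ 2))) = 0 := by
        linear_combination τ * hzP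
      linarith [sq_nonneg (D.a₁₁ * z 0 + D.a₁₂ * z 1), sq_nonneg (D.a₁₂ * z 0 + D.a₂₂ * z 1)]
    · rintro rfl
      refine ⟨?_, zero_mem_invZeros D⟩
      simp
      linarith
  · right; right
    set τ := D.a₁₁ + D.a₂₂ with hτdef
    have hτ : τ ≠ 0 := by
      intro h
      have e1 : D.a₂₂ = -D.a₁₁ := by linarith
      rw [e1] at hzero
      obtain ⟨e2, e3⟩ := eq_zero_of_sq_add_sq (a := D.a₁₂) (b := D.a₁₁) (by linarith)
      rcases hquad with h | h | h
      · exact h e3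
      · exact h (by rw [e1, e3, neg_zero])
      · exact h e2
    obtain ⟨u₀, u₁, hu, h0, h1, h2⟩ : ∃ u₀ u₁ : ℝ, u₀ ^ 2 + u₁ ^ 2 = 1 ∧ D.a₁₁ = τ * u₀ ^ 2 ∧
        D.a₁₂ = τ * (u₀ * u₁) ∧ D.a₂₂ = τ * u₁ ^ 2 := by
      by_cases h11 : D.a₁₁ = 0
      · refine ⟨0, 1, by norm_num, by rw [h11]; ring, ?_, by rw [hτdef, h11]; ring⟩
        rw [h11] at hzero
        have : D.a₁₂ ^ 2 = 0 := by linarith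
        rw [pow_eq_zero_iff two_ne_zero |>.mp this]; ring
      · have hsum : D.a₁₁ ^ 2 + D.a₁₂ ^ 2 = D.a₁₁ * τ := by rw [hτdef]; linarith
        have hpos : 0 < D.a₁₁ * τ := by rw [← hsum]; positivity
        have hδ := Real.sq_sqrt hpos.le
        have hδ0 := (Real.sqrt_pos.mpr hpos).ne'
        generalize √(D.a₁₁ * τ) = δ at hδ hδ0
        refine ⟨D.a₁₁ / δ, D.a₁₂ / δ, ?_, ?_, ?_, ?_⟩
        · field_simp; linarith
        · field_simp; rw [hδ]
        · field_simp; rw [hδ]; ring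
        · field_simp
          apply mul_left_cancel₀ h11
          linear_combination D.a₁₁ * D.a₂₂ * hδ - D.a₁₁ * τ * hzero
    -- The quadratic part has rank one, `τ ξ²`. The component `l` of the linear part along its
    -- kernel is nonzero, since the determinant equals `-τ l²`.
    set p := D.a₁ * u₀ + D.a₂ * u₁ with hp
    set l := -D.a₁ * u₁ + D.a₂ * u₀ with hl
    have hl0 : l ≠ 0 := by
      intro h
      apply hD
      rw [QuadEq.det, h0, h1, h2]
      linear_combination (-τ * l) * h + τ * (l + (-D.a₁ * u₁ + D.a₂ * u₀)) * hl
    have hframe : IsFrame !₂[u₀, u₁] !₂[-u₁, u₀] := by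
      refine ⟨?_, ?_, ?_⟩
      · rw [← sq_eq_sq₀ (norm_nonneg _) zero_le_one, norm_sq_eq]; simpa using hu
      · rw [← sq_eq_sq₀ (norm_nonneg _) zero_le_one, norm_sq_eq]; simp; linarith
      · rw [inner_eq]; simp; ring
    -- The constants come from completing the square in `ξ` and dividing by `-2 l`.
    refine ⟨_, hasOrdinaryCuspAt_of_eq hframe (k := -τ / (2 * l)) (c₁ := -p / τ)
      (c₂ := -D.c / (2 * l) + p ^ 2 / (2 * τ * l)) (by simp [hτ, hl0]) ?_⟩
    intro z
    have hx : z 0 = u₀ * (u₀ * z 0 + u₁ * z 1) - u₁ * (-u₁ * z 0 + u₀ * z 1) := by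
      linear_combination -z 0 * hu
    have hy : z 1 = u₁ * (u₀ * z 0 + u₁ * z 1) + u₀ * (-u₁ * z 0 + u₀ * z 1) := by
      linear_combination -z 1 * hu
    have hL : D.a₁ * z 0 + D.a₂ * z 1
        = p * (u₀ * z 0 + u₁ * z 1) + l * (-u₁ * z 0 + u₀ * z 1) := by
      rw [hp, hl]
      linear_combination D.a₁ * hx + D.a₂ * hy
    have hP : D.invPoly (z 0) (z 1) = τ * (u₀ * z 0 + u₁ * z 1) ^ 2
        + 2 * (z 0 ^ 2 + z 1 ^ 2) * (p * (u₀ * z 0 + u₁ * z 1) + l * (-u₁ * z 0 + u₀ * z 1))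
        + D.c * (z 0 ^ 2 + z 1 ^ 2) ^ 2 := by
      rw [← hL, QuadEq.invPoly, h0, h1, h2]; ring
    rw [mem_invZeros, hP]
    simp only [Matrix.cons_val_zero, Matrix.cons_val_one]
    generalize u₀ * z 0 + u₁ * z 1 = ξ
    generalize -u₁ * z 0 + u₀ * z 1 = η
    generalize z 0 ^ 2 + z 1 ^ 2 = r
    clear_value τ p l
    rw [← sub_eq_zero (a := _ / _ * _)]
    have e : -τ / (2 * l) * (ξ - -p / τ * r) ^ 2
        - (η - (-D.c / (2 * l) + p ^ 2 / (2 * τ * l)) * r) * r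
        = -(τ * ξ ^ 2 + 2 * r * (p * ξ + l * η) + D.c * r ^ 2) / (2 * l) := by
      field_simp
      ring
    rw [e, div_eq_zero_iff, neg_eq_zero, or_iff_left (mul_ne_zero two_ne_zero hl0)]
  · right; left
    obtain ⟨κ, α₀, α₁, β₀, β₁, hκ, hdet, h0, h1, h2⟩ : ∃ κ α₀ α₁ β₀ β₁ : ℝ, κ ≠ 0 ∧
        α₀ * β₁ - α₁ * β₀ ≠ 0 ∧ κ * D.a₁₁ = α₀ * β₀ ∧ 2 * κ * D.a₁₂ = α₀ * β₁ + α₁ * β₀ ∧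
        κ * D.a₂₂ = α₁ * β₁ := by
      by_cases h11 : D.a₁₁ = 0
      · refine ⟨1, 0, 1, 2 * D.a₁₂, D.a₂₂, one_ne_zero, ?_, by rw [h11]; ring, by ring, by ring⟩
        intro h
        rw [h11] at hpos
        have : D.a₁₂ = 0 := by linarith
        rw [this] at hpos
        norm_num at hpos
      · have hδ := Real.sq_sqrt hpos.le
        have hδ0 := Real.sqrt_pos.mpr hpos
        generalize √(D.a₁₂ ^ 2 - D.a₁₁ * D.a₂₂) = δ at hδ hδ0
        refine ⟨D.a₁₁, D.a₁₁, D.a₁₂ + δ, D.a₁₁, D.a₁₂ - δ, h11, ?_, by ring, by ring, ?_⟩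
        · intro h
          have : D.a₁₁ * δ = 0 := by linear_combination -h / 2
          rcases mul_eq_zero.mp this with h | h
          · exact h11 h
          · exact hδ0.ne' h
        · linear_combination hδ
    -- The shifts `c₁`, `c₂` of the two linear factors absorb the cubic part; the quartic remainder
    -- then fixes `e = c₁ c₂ - κ c`.
    obtain ⟨c₁, c₂, hc0, hc1⟩ : ∃ c₁ c₂ : ℝ, 2 * κ * D.a₁ = -(c₁ * β₀ + c₂ * α₀) ∧
        2 * κ * D.a₂ = -(c₁ * β₁ + c₂ * α₁) := by
      obtain ⟨ι, hι⟩ : ∃ ι, ι * (α₀ * β₁ - α₁ * β₀) = 1 := ⟨_, inv_mul_cancel₀ hdet⟩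
      refine ⟨2 * κ * ι * (D.a₁ * α₁ - D.a₂ * α₀), 2 * κ * ι * (D.a₂ * β₀ - D.a₁ * β₁), ?_, ?_⟩
      · linear_combination -2 * κ * D.a₁ * hι
      · linear_combination -2 * κ * D.a₂ * hι
    refine ⟨!₂[-α₁, α₀], !₂[-β₁, β₀], hasNodeAt_of_eq (c₁ := c₁) (c₂ := c₂)
      (e := c₁ * c₂ - κ * D.c) hdet ?_ ?_ ?_ ?_ ?_⟩
    · intro z
      rw [mem_invZeros, ← mul_eq_zero_iff_left hκ, QuadEq.invPoly]
      constructor <;> intro h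
      · linear_combination h - z 0 ^ 2 * h0 - z 0 * z 1 * h1 - z 1 ^ 2 * h2
          - (z 0 ^ 2 + z 1 ^ 2) * (z 0 * hc0 + z 1 * hc1)
      · linear_combination h + z 0 ^ 2 * h0 + z 0 * z 1 * h1 + z 1 ^ 2 * h2
          + (z 0 ^ 2 + z 1 ^ 2) * (z 0 * hc0 + z 1 * hc1)
    · intro h
      have e0 := congrArg (fun z : Plane => z 0) h
      have e1 := congrArg (fun z : Plane => z 1) h
      simp at e0 e1
      apply hdet; rw [e0, e1]; ring
    · intro h
      have e0 := congrArg (fun z : Plane => z 0) h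
      have e1 := congrArg (fun z : Plane => z 1) h
      simp at e0 e1
      apply hdet; rw [e0, e1]; ring
    · simp; ring
    · simp; ring

theorem isFrontSet_invZeros {D : QuadEq} (hD : D.det ≠ 0) : IsFrontSet D.invZeros := by
  have reg : ∀ {x : Plane}, (∃ U : Set Plane, IsOpen U ∧ x ∈ U ∧
      ∃ (r : ℕ) (γ : Fin r → ℝ → Plane) (t ε : Fin r → ℝ),
        (∀ i, 0 < ε i ∧ γ i (t i) = x ∧ IsRegularOn (γ i) (Set.Ioo (t i - ε i) (t i + ε i))) ∧
        (⋃ i, γ i '' Set.Ioo (t i - ε i) (t i + ε i)) = U ∩ D.invZeros) →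
      ∃ U : Set Plane, IsOpen U ∧ x ∈ U ∧
      ∃ (r : ℕ) (γ : Fin r → ℝ → Plane) (t ε : Fin r → ℝ),
        (∀ i, 0 < ε i ∧ γ i (t i) = x ∧ IsFrontOn (γ i) (Set.Ioo (t i - ε i) (t i + ε i))) ∧
        (⋃ i, γ i '' Set.Ioo (t i - ε i) (t i + ε i)) = U ∩ D.invZeros := by
    rintro x ⟨U, hU, hx, r, γ, t, ε, h, hun⟩
    exact ⟨U, hU, hx, r, γ, t, ε, fun i => ⟨(h i).1, (h i).2.1, (h i).2.2.isFrontOn isOpen_Ioo⟩,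
      hun⟩
  intro x hx
  by_cases hx0 : x = 0
  · subst hx0
    rcases origin_trichotomy hD with h | ⟨d₁, d₂, h⟩ | ⟨v, h⟩
    · exact isIsolatedPointOf_exists_branches h
    · exact reg (hasNodeAt_exists_branches h)
    · exact hasOrdinaryCuspAt_exists_branches h
  · exact reg (isRegularAt_exists_branches (isRegularAt_invZeros hD hx hx0))

/-! ### The three types of conics -/

theorem mem_invZeros_iff {D : QuadEq} {x : Plane} (hx : x ≠ 0) :
    x ∈ D.invZeros ↔ EuclideanGeometry.inversion (0 : Plane) 1 x ∈ D.zeros :=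
  (invPoly_inversion D hx).symm

theorem inner_inversion_sub (x p w : Plane) :
    inner ℝ (EuclideanGeometry.inversion (0 : Plane) 1 x - p) w
      = (w 0 * x 0 + w 1 * x 1) / (x 0 ^ 2 + x 1 ^ 2) - inner ℝ p w := by
  rw [inner_sub_left, inner_eq, inversion_apply, inversion_apply]
  ring

theorem norm_sq_eq_frame {u v : Plane} (h : IsFrame u v) (x : Plane) :
    ‖x‖ ^ 2 = inner ℝ x u ^ 2 + inner ℝ x v ^ 2 := by
  obtain ⟨hu, δ, hδ, hv0, hv1⟩ := frame_coords h
  rw [norm_sq_eq, inner_eq, inner_eq, hv0, hv1]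
  linear_combination -(x 0 ^ 2 + x 1 ^ 2) * hu - (u 0 * x 1 - u 1 * x 0) ^ 2 * hδ

/-- An ellipse is bounded, so its inverse avoids a punctured ball about the origin. -/
theorem isIsolatedPointOf_of_isEllipse {D : QuadEq} (h : IsEllipse D.zeros) :
    IsIsolatedPointOf D.invZeros 0 := by
  obtain ⟨p, u, v, a, b, huv, ha, hb, hE⟩ := h
  have hbound : ∀ y ∈ D.zeros, ‖y‖ < ‖p‖ + (a + b) + 1 := by
    intro y hy
    rw [hE, Set.mem_ofPred_eq, div_pow, div_pow] at hy
    have h1 : inner ℝ (y - p) u ^ 2 ≤ a ^ 2 := by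
      have : 0 ≤ inner ℝ (y - p) v ^ 2 / b ^ 2 := by positivity
      exact (div_le_one (by positivity)).mp (by linarith)
    have h2 : inner ℝ (y - p) v ^ 2 ≤ b ^ 2 := by
      have : 0 ≤ inner ℝ (y - p) u ^ 2 / a ^ 2 := by positivity
      exact (div_le_one (by positivity)).mp (by linarith)
    have h3 : ‖y - p‖ ≤ a + b := by
      apply le_of_sq_le_sq _ (by positivity)
      rw [norm_sq_eq_frame huv]
      nlinarith
    have h4 := norm_add_le p (y - p)
    rw [add_sub_cancel] at h4
    linarith
  have hR : 0 < ‖p‖ + (a + b) + 1 := by positivity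
  refine ⟨Metric.ball 0 (‖p‖ + (a + b) + 1)⁻¹, Metric.isOpen_ball, ?_⟩
  ext x
  constructor
  · rintro ⟨hx, hxD⟩
    by_contra hx0
    have hlt := hbound _ ((mem_invZeros_iff hx0).mp hxD)
    rw [← dist_zero_right, EuclideanGeometry.dist_inversion_center, dist_zero_right, one_pow,
      one_div] at hlt
    rw [mem_ball_zero_iff] at hx
    have hxpos : 0 < ‖x‖ := norm_pos_iff.mpr hx0
    have := (inv_lt_comm₀ hxpos hR).mp hlt
    linarith
  · rintro rfl
    exact ⟨Metric.mem_ball_self (by positivity), zero_mem_invZeros D⟩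

/-- The equation of the hyperbola, written as a product of two asymptotic forms equal to 1 and
multiplied by `‖z‖⁴` after inversion, is the node equation with `e = 1`. Each asymptotic form kills
its own asymptotic direction. -/
theorem hasNodeAt_of_isHyperbola {D : QuadEq} {d₁ d₂ : Plane}
    (h : IsHyperbolaWithAsymptotes D.zeros d₁ d₂) : HasNodeAt D.invZeros 0 d₁ d₂ := by
  obtain ⟨p, u, v, a, b, huv, ha, hb, hH, rfl, rfl⟩ := h
  obtain ⟨hu, δ, hδ, hv0, hv1⟩ := frame_coords huv
  have hδ0 : δ ≠ 0 := by rintro rfl; simp at hδ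
  have hn : ∀ s : ℝ, s ^ 2 = 1 → ‖a • u + (s * b) • v‖ ^ 2 = a ^ 2 + b ^ 2 := by
    intro s hs
    rw [norm_sq_eq]
    simp [hv0, hv1]
    linear_combination (a ^ 2 + b ^ 2) * hu + (s ^ 2 * b ^ 2 * (u 0 ^ 2 + u 1 ^ 2)) * hδ
      + (b ^ 2 * (u 0 ^ 2 + u 1 ^ 2)) * hs
  have hne : ∀ s : ℝ, s ^ 2 = 1 → a • u + (s * b) • v ≠ 0 := by
    intro s hs h0
    have := hn s hs
    rw [h0, norm_zero] at this
    have : 0 < a ^ 2 + b ^ 2 := by positivity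
    nlinarith
  refine hasNodeAt_of_eq (α₀ := u 0 / a - v 0 / b) (α₁ := u 1 / a - v 1 / b)
    (β₀ := u 0 / a + v 0 / b) (β₁ := u 1 / a + v 1 / b)
    (c₁ := inner ℝ p u / a - inner ℝ p v / b) (c₂ := inner ℝ p u / a + inner ℝ p v / b) (e := 1)
    ?_ ?_ (by simpa using hne 1 (by norm_num))
    (by simpa [sub_eq_add_neg] using hne (-1) (by norm_num)) ?_ ?_
  · have : (u 0 / a - v 0 / b) * (u 1 / a + v 1 / b) - (u 1 / a - v 1 / b) * (u 0 / a + v 0 / b)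
        = 2 * δ / (a * b) := by
      rw [hv0, hv1]
      field_simp
      linear_combination 2 * δ * a * b * hu
    rw [this]
    positivity
  · intro z
    by_cases hz : z = 0
    · subst hz; simp [zero_mem_invZeros]
    · have hr := (sq_add_sq_pos hz).ne'
      rw [mem_invZeros_iff hz, hH, Set.mem_ofPred_eq, inner_inversion_sub, inner_inversion_sub]
      have e1 : (u 0 / a - v 0 / b) * z 0 + (u 1 / a - v 1 / b) * z 1
          = (u 0 * z 0 + u 1 * z 1) / a - (v 0 * z 0 + v 1 * z 1) / b := by ring
      have e2 : (u 0 / a + v 0 / b) * z 0 + (u 1 / a + v 1 / b) * z 1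
          = (u 0 * z 0 + u 1 * z 1) / a + (v 0 * z 0 + v 1 * z 1) / b := by ring
      rw [e1, e2]
      generalize u 0 * z 0 + u 1 * z 1 = ξ
      generalize v 0 * z 0 + v 1 * z 1 = η
      generalize inner ℝ p u = P
      generalize inner ℝ p v = Q
      generalize z 0 ^ 2 + z 1 ^ 2 = r at hr
      rw [← sub_eq_zero, ← mul_eq_zero_iff_left (pow_ne_zero 2 hr)]
      have e3 : r ^ 2 * (((ξ / r - P) / a) ^ 2 - ((η / r - Q) / b) ^ 2 - 1)
          = (ξ / a - η / b - (P / a - Q / b) * r) * (ξ / a + η / b - (P / a + Q / b) * r)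
            - 1 * r ^ 2 := by
        field_simp
        ring
      rw [e3]
  · simp [hv0, hv1]
    field_simp
    linear_combination -a * b * (u 0 ^ 2 + u 1 ^ 2) * hδ
  · simp [hv0, hv1]
    field_simp
    linear_combination -a * b * (u 0 ^ 2 + u 1 ^ 2) * hδ

/-- Inverting the parabola equation in its frame and multiplying by `‖z‖⁴` gives the cusp equation
directly, with the coordinates of the vertex as `c₁` and `c₂`. -/
theorem hasOrdinaryCuspAt_of_isParabola {D : QuadEq} {v : Plane}
    (h : IsParabolaWithAxis D.zeros v) : HasOrdinaryCuspAt D.invZeros 0 v := by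
  obtain ⟨p, u, k, huv, hk, hH⟩ := h
  refine hasOrdinaryCuspAt_of_eq huv (c₁ := inner ℝ p u) (c₂ := inner ℝ p v) hk fun z => ?_
  by_cases hz : z = 0
  · subst hz; simp [zero_mem_invZeros]
  · have hr := (sq_add_sq_pos hz).ne'
    rw [mem_invZeros_iff hz, hH, Set.mem_ofPred_eq, inner_inversion_sub, inner_inversion_sub]
    generalize u 0 * z 0 + u 1 * z 1 = ξ
    generalize v 0 * z 0 + v 1 * z 1 = η
    generalize inner ℝ p u = P
    generalize inner ℝ p v = Q
    generalize z 0 ^ 2 + z 1 ^ 2 = r at hr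
    field_simp
    constructor <;> intro h <;> linear_combination -h

end PlaneCurve

end

/-! ### The theorem -/

theorem theorem3p7 (Γ : Set Plane) (q : QuadEq)
    (hΓ : IsAlgebraicCurve Γ)
    (hdense : Γ \ {0} ⊆ closure (noSilhouettePart Γ))
    (hnocircle : ∀ (p : Plane) (r : ℝ), 0 < r → (0 : Plane) ∈ Metric.sphere p r →
      ¬ Metric.sphere p r ⊆ Γ)
    (hline : ¬ IsLine Γ)
    (hcircle : ∀ (p : Plane) (r : ℝ), 0 < r → Γ ≠ Metric.sphere p r)
    (hC : IsIrreducibleQuadraticCurve q.zeros)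
    (hprim : closure (primitiveLocus Γ) = q.zeros) :
    ((HasDegree Γ 3 ∨ HasDegree Γ 4) ∧
      IsFrontSet Γ ∧
      IsIrreducibleQuadraticCurve (curveInversion Γ) ∧
      curveInversion Γ \ {0} = puncturedInversion Γ ∧
      Γ = {x : Plane |
        (q.a₁₂ ^ 2 - q.a₁₁ * q.a₂₂) * (x 0 ^ 2 + x 1 ^ 2) ^ 2
          + 2 * (q.a₁₂ * q.a₂ - q.a₁ * q.a₂₂) * (x 0 ^ 2 + x 1 ^ 2) * x 0
          + 2 * (q.a₁ * q.a₁₂ - q.a₂ * q.a₁₁) * (x 0 ^ 2 + x 1 ^ 2) * x 1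
          + (q.a₂ ^ 2 - q.a₂₂ * q.c) * x 0 ^ 2
          + 2 * (q.a₁₂ * q.c - q.a₁ * q.a₂) * (x 0 * x 1)
          + (q.a₁ ^ 2 - q.a₁₁ * q.c) * x 1 ^ 2 = 0} ∧
      (IsParabola q.zeros → HasDegree Γ 3)) ∧
    (IsEllipse (curveInversion Γ) →
      IsIsolatedPointOf Γ 0 ∧ ∀ x ∈ Γ, x ≠ 0 → IsRegularAt Γ x) ∧
    (∀ d₁ d₂ : Plane, IsHyperbolaWithAsymptotes (curveInversion Γ) d₁ d₂ →
      IsRegularlyParametrized Γ ∧ HasNodeAt Γ 0 d₁ d₂ ∧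
        ∀ x ∈ Γ, x ≠ 0 → IsRegularAt Γ x) ∧
    (∀ v : Plane, IsParabolaWithAxis (curveInversion Γ) v →
      HasOrdinaryCuspAt Γ 0 v ∧ ∀ x ∈ Γ, x ≠ 0 → IsRegularAt Γ x) := by
  obtain ⟨hΓeq, hinf⟩ := curve_eq_invZeros hΓ hdense hnocircle hline hcircle hC hprim
  have hD : q.dual.det ≠ 0 := by
    rw [QuadEq.det_dual]
    exact neg_ne_zero.mpr (pow_ne_zero 2 (det_ne_zero_of_irreducible hC))
  have hzinf : q.dual.zeros.Infinite := by
    rw [hΓeq] at hinf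
    have h := hinf.image
      ((EuclideanGeometry.inversion_injective (0 : Plane) one_ne_zero).injOn (s := _))
    rw [← puncturedInversion, puncturedInversion_invZeros] at h
    exact h.mono Set.sdiff_subset
  have hreg : ∀ x ∈ q.dual.invZeros, x ≠ 0 → IsRegularAt q.dual.invZeros x :=
    fun x hx hx0 => isRegularAt_invZeros hD hx hx0
  rw [hΓeq, curveInversion_invZeros hD]
  obtain ⟨hdeg, hdeg3⟩ := hasDegree_invZeros hD hzinf
  refine ⟨⟨hdeg, isFrontSet_invZeros hD, irreducible_of_det_ne_zero hD hzinf,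
    (puncturedInversion_invZeros _).symm, rfl,
    fun h => hdeg3 (dual_c_eq_zero_of_isParabola h)⟩,
    fun h => ⟨isIsolatedPointOf_of_isEllipse h, hreg⟩, fun d₁ d₂ h => ?_,
    fun v h => ⟨hasOrdinaryCuspAt_of_isParabola h, hreg⟩⟩
  have hnode := hasNodeAt_of_isHyperbola h
  refine ⟨fun x hx => ?_, hnode, hreg⟩
  by_cases hx0 : x = 0
  · subst hx0; exact hasNodeAt_exists_branches hnode
  · exact isRegularAt_exists_branches (hreg x hx hx0)
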